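/- **Setting.** Let $\mathcal E$ be the set of real sequences $\mathbf y=(y_0,y_1,\dots)$ with $y_0>0$, $y_1\ge y_2\ge\dots\ge 0$ and $y_i\to0$, with the supremum distance (which induces on $\mathcal E$ the product topology). A *splitting measure* is a Borel measure $\boldsymbol\Xi$ on $\mathcal E$ with $\int (1\wedge \log^2 y_0)\,\mathrm d\boldsymbol\Xi<\infty$, $\int (y_0-1)^2\,\mathrm d\boldsymbol\Xi<\infty$ and $\boldsymbol\Xi(y_1>\varepsilon)<\infty$ for every $\varepsilon>0$. Fix $q\in[1,\infty]$, write $|\cdot|$ for the $\ell_q$-norm, and let $\mathrm{Supp}(\boldsymbol\Xi)$ be the set of $\mathbf y\in\mathcal E\cap\ell_q$ all of whose $\ell_q$-neighbourhoods $U$ satisfy $\boldsymbol\Xi(\mathcal E\cap U)>0$. **Nicely growing.** Let $\boldsymbol\Xi$ be a splitting measure and $\alpha>0$. Assume that there are an open set $\mathcal O\subset\ell_q$ with $\boldsymbol\Xi(\mathcal E\setminus\mathcal O)=0$ and a map $\mathtt V:\mathcal O\to\ell_q$ such that: 1. $\mathtt V(\mathbf y)\le\mathbf y$ coordinatewise for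 $\mathbf y\in\mathcal O\cap\mathrm{Supp}(\boldsymbol\Xi)$; 2. $\mathrm{div}(\mathtt V\boldsymbol\Xi)=-\alpha\boldsymbol\Xi$, i.e. $\int\langle\mathtt V,\nabla F\rangle\,\mathrm d\boldsymbol\Xi=\alpha\int F\,\mathrm d\boldsymbol\Xi$ for every $\boldsymbol\Xi$-integrable $F(\mathbf y)=f(y_0,\dots,y_{n-1})$ with $n\ge0$, $f\in C_c^\infty(\mathbb R^n)$, $f\ge0$; 3. $|\mathtt V|\in L^2(\boldsymbol\Xi)$; 4. $\mathtt V$ is Lipschitz and $C^1$ on $\mathcal O$ for the $\ell_q$-norm; 5. there is $\varepsilon>0$ such that $\mathbf y+t\mathtt V(\mathbf y)\in\mathcal O$ for all $\mathbf y\in\mathcal O$ and $|t|<\varepsilon$. **Conclusion.** For every $\mathbf y\in\mathcal O$ there is exactly one $\mathcal O$-valued curve $x\mapsto G_x(\mathbf y)$, $x>0$, differentiable in $\ell_q$, with $$\partial_xG_x(\mathbf y)=-\tfrac1x\mathtt V(G_x(\mathbf y))\quad(x>0),\qquad G_1(\mathbf y)=\mathbf y .$$ Put $\mathcal E_0=\{\mathbf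 y\in\mathcal O\cap\mathrm{Supp}(\boldsymbol\Xi): G_x(\mathbf y)_0>0\ \text{for all }x>0\}$; it equals $\mathcal O\cap\mathrm{Supp}(\boldsymbol\Xi)$ whenever all points of $\mathcal O$ have a positive coordinate of index $0$. Then $G_x$ maps $\mathcal E_0$ into $\mathcal E$, and, with $G_x$ extended to $\mathcal E$ by the identity on $\mathcal E\setminus\mathcal E_0$, $(\boldsymbol\Xi;\alpha)$ is $G$-growing with the set $\mathcal E_0$, that is: * $\mathcal E_0$ is Borel, $\boldsymbol\Xi(\mathcal E\setminus\mathcal E_0)=0$, and $G_x(\mathcal E_0)\subset\mathcal E_0$ for all $x>0$; * $G_1=\mathrm{Id}$ and $G_x\circ G_{x'}=G_{xx'}$ on $\mathcal E$ for all $x,x'>0$; * $\int\phi(G_x(\mathbf y))\,\boldsymbol\Xi(\mathrm d\mathbf y)=x^{-\alpha}\int\phi\,\mathrm d\boldsymbol\Xi$ (in $[0,\infty]$) for all $x>0$ and all bounded continuous $\phi:\mathcal E\to\mathbb R_+$; * for $\mathbf y\in\mathcal E_0$, every coordinate of $x\mapsto x\,G_x(\mathbf y)$ is non-decreasing on $(0,\infty)$;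 * for every compact $K\subset(0,\infty)$ there is $C_K>0$ such that, for all $x,x'\in K$, $\int\bigl(x(G_x(\mathbf y)_0-1)-x'(G_{x'}(\mathbf y)_0-1)\bigr)^2\boldsymbol\Xi(\mathrm d\mathbf y)\le C_K(x-x')^2$; * $(x,\mathbf y)\mapsto G_x(\mathbf y)$ is continuous from $(0,\infty)\times\mathcal E_0$ to $\mathcal E_0$, where $\mathcal E_0$ carries the $\ell_q$-topology. If $q=\infty$, or more generally if the product topology and the $\ell_q$-topology coincide on $\mathcal E_0$, this last continuity also holds with $\mathcal E_0$ carrying the product topology. -/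

import Mathlib

open MeasureTheory Filter Topology Set
open scoped ENNReal NNReal ContDiff BoundedContinuousFunction

/-- The space `𝓔` of sequences `(y₀, y₁, y₂, …)` with `y₀ > 0`, `y₁ ≥ y₂ ≥ … ≥ 0` and `yᵢ → 0`.
It carries the product topology (which on `𝓔` is the topology of the supremum distance, see
`SplitSeq.tendsto_iff_uniform`) and the corresponding Borel sets. -/
abbrev SplitSeq : Type :=
  {y : ℕ → ℝ // 0 < y 0 ∧ (∀ i, 0 ≤ y i) ∧ (∀ i, 1 ≤ i → y (i + 1) ≤ y i) ∧
    Tendsto y atTop (𝓝 0)}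

/-- On `𝓔`, coordinatewise convergence is the same as uniform convergence. -/
theorem SplitSeq.tendsto_iff_uniform {ι : Type*} {l : Filter ι} {u : ι → SplitSeq}
    {y : SplitSeq} :
    Tendsto u l (𝓝 y) ↔ ∀ ε : ℝ, 0 < ε → ∀ᶠ n in l, ∀ i, |(u n).1 i - y.1 i| ≤ ε := by
  have anti : ∀ (z : SplitSeq) (k i : ℕ), 1 ≤ k → k ≤ i → z.1 i ≤ z.1 k := by
    intro z k i hk hki
    induction i, hki using Nat.le_induction with
    | base => exact le_rfl
    | succ j hj ih => exact (z.2.2.2.1 j (hk.trans hj)).trans ih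
  rw [tendsto_subtype_rng, tendsto_pi_nhds]
  constructor
  · intro h ε hε
    obtain ⟨k, hk1, hk⟩ : ∃ k, 1 ≤ k ∧ y.1 k < ε / 2 :=
      ((eventually_ge_atTop 1).and (y.2.2.2.2.eventually_lt_const (half_pos hε))).exists
    have hfin : ∀ᶠ n in l, ∀ i ∈ Finset.range (k + 1), |(u n).1 i - y.1 i| < ε / 2 := by
      rw [Filter.eventually_all_finset]
      intro i _
      have := (Metric.tendsto_nhds.1 (h i)) (ε / 2) (half_pos hε)
      simpa [Real.dist_eq] using this
    filter_upwards [hfin] with n hn i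
    rcases le_total i k with hik | hik
    · have := hn i (Finset.mem_range.2 (by omega))
      linarith
    · have h1 := abs_lt.1 (hn k (Finset.mem_range.2 (by omega)))
      have h2 := anti (u n) k i hk1 hik
      have h3 := anti y k i hk1 hik
      have h4 := (u n).2.2.1 i
      have h5 := y.2.2.1 i
      rw [abs_le]
      constructor <;> linarith [h1.1, h1.2]
  · intro h i
    rw [Metric.tendsto_nhds]
    intro ε hε
    filter_upwards [h (ε / 2) (half_pos hε)] with n hn
    have := hn i
    rw [Real.dist_eq]
    linarith

/-- The conditions on a splitting measure `Ξ` on `𝓔` (no killing is built in: `y₀ > 0` on `𝓔`). -/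
structure IsSplittingMeasure (Ξ : Measure SplitSeq) : Prop where
  levy : ∫⁻ y, ENNReal.ofReal (min 1 (Real.log (y.1 0) ^ 2)) ∂Ξ < ⊤
  offspring_finite : ∀ ε : ℝ, 0 < ε → Ξ {y | ε < y.1 1} < ⊤
  compensated : ∫⁻ y, ENNReal.ofReal ((y.1 0 - 1) ^ 2) ∂Ξ < ⊤

/-- The space `ℓ_q` of real sequences, with its norm. -/
abbrev Lq (q : ℝ≥0∞) : Type := lp (fun _ : ℕ => ℝ) q

open Classical in
/-- A `q`-summable sequence seen as a point of `ℓ_q` (and `0` for the other sequences). -/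
noncomputable def toLq (q : ℝ≥0∞) (y : ℕ → ℝ) : Lq q :=
  if h : Memℓp y q then ⟨y, h⟩ else 0

/-- The trace `𝓔 ∩ U` on `𝓔` of a subset `U` of `ℓ_q`. -/
def traceLq (q : ℝ≥0∞) (U : Set (Lq q)) : Set SplitSeq :=
  {y | Memℓp y.1 q ∧ toLq q y.1 ∈ U}

/-- The support of `Ξ` for the `ℓ_q`-topology: the points of `𝓔 ∩ ℓ_q` all of whose
`ℓ_q`-neighbourhoods are charged by `Ξ`. -/
def suppLq (q : ℝ≥0∞) [Fact (1 ≤ q)] (Ξ : Measure SplitSeq) : Set SplitSeq :=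
  {y | Memℓp y.1 q ∧ ∀ U ∈ 𝓝 (toLq q y.1), 0 < Ξ (traceLq q U)}

/-- The topology on `𝓔 ∩ ℓ_q` given by the `ℓ_q`-norm. It is only ever used on
subsets of `𝓔 ∩ ℓ_q`. -/
@[reducible] noncomputable def topLq (q : ℝ≥0∞) [Fact (1 ≤ q)] : TopologicalSpace SplitSeq :=
  TopologicalSpace.induced (fun y => toLq q y.1) inferInstance

/-- The first `n` coordinates of a sequence. -/
def firstCoords (n : ℕ) (y : ℕ → ℝ) : Fin n → ℝ := fun i => y i

/-- `V : 𝓞 ⊆ ℓ_q → ℓ_q` is a generator witnessing that `(Ξ; α)` is nicely growing. -/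
structure IsNiceGenerator (q : ℝ≥0∞) [Fact (1 ≤ q)] (Ξ : Measure SplitSeq) (α : ℝ)
    (O : Set (Lq q)) (V : Lq q → Lq q) : Prop where
  isOpen : IsOpen O
  concentrated : Ξ (traceLq q O)ᶜ = 0
  inequalities : ∀ y ∈ traceLq q O ∩ suppLq q Ξ, ∀ i, V (toLq q y.1) i ≤ y.1 i
  /-- `div (V Ξ) = -α Ξ`, tested against the nonnegative `Ξ`-integrable cylindrical test functions
  `F(y) = f(y₀, …, y_{n-1})`, for which `⟨V, ∇F⟩` is the derivative of `f` in the direction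
  `(V₀, …, V_{n-1})`. -/
  divergence : ∀ (n : ℕ) (f : (Fin n → ℝ) → ℝ), ContDiff ℝ ∞ f → HasCompactSupport f →
    (∀ u, 0 ≤ f u) → Integrable (fun y : SplitSeq => f (firstCoords n y.1)) Ξ →
    ∫ y, fderiv ℝ f (firstCoords n y.1) (firstCoords n (V (toLq q y.1))) ∂Ξ =
      α * ∫ y, f (firstCoords n y.1) ∂Ξ
  sq_integrable : ∫⁻ y, ENNReal.ofReal (‖V (toLq q y.1)‖ ^ 2) ∂Ξ < ⊤
  lipschitz : ∃ L : ℝ≥0, LipschitzOnWith L V O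
  contDiff : ContDiffOn ℝ 1 V O
  no_escape : ∃ ε : ℝ, 0 < ε ∧ ∀ z ∈ O, ∀ t : ℝ, |t| < ε → z + t • V z ∈ O

/-- `(Ξ; α)` is growing for the family `G = (G_x : x > 0)` of mappings `𝓔 → 𝓔` and the set
`𝓔₀ ⊆ 𝓔`, the joint continuity of `(x, y) ↦ G_x(y)` on `(0, ∞) × 𝓔₀` being understood with the
topology `τ` on `𝓔₀`. Only the values of `G` at `x > 0` matter. -/
structure IsGrowing (τ : TopologicalSpace SplitSeq) (Ξ : Measure SplitSeq) (α : ℝ)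
    (E₀ : Set SplitSeq) (G : ℝ → SplitSeq → SplitSeq) : Prop where
  measurable : MeasurableSet E₀
  concentrated : Ξ E₀ᶜ = 0
  one : ∀ y, G 1 y = y
  semigroup : ∀ x, 0 < x → ∀ x', 0 < x' → ∀ y, G x (G x' y) = G (x * x') y
  quasi_preservation : ∀ (φ : SplitSeq →ᵇ ℝ≥0) (x : ℝ), 0 < x →
    ∫⁻ y, (φ (G x y) : ℝ≥0∞) ∂Ξ = ENNReal.ofReal (x ^ (-α)) * ∫⁻ y, (φ y : ℝ≥0∞) ∂Ξ
  monotone : ∀ y ∈ E₀, ∀ i, MonotoneOn (fun x : ℝ => x * (G x y).1 i) (Ioi 0)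
  mapsTo : ∀ x, 0 < x → MapsTo (G x) E₀ E₀
  continuous : @ContinuousOn (ℝ × SplitSeq) SplitSeq (@instTopologicalSpaceProd _ _ _ τ) τ
    (fun p => G p.1 p.2) (Ioi 0 ×ˢ E₀)
  integrated_lipschitz : ∀ K : Set ℝ, IsCompact K → K ⊆ Ioi 0 → ∃ C : ℝ, 0 < C ∧
    ∀ x ∈ K, ∀ x' ∈ K,
      ∫⁻ y, ENNReal.ofReal ((x * ((G x y).1 0 - 1) - x' * ((G x' y).1 0 - 1)) ^ 2) ∂Ξ ≤
        ENNReal.ofReal (C * (x - x') ^ 2)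

/-- `c : (0, ∞) → 𝓞` solves `c'(x) = -(1/x) V(c(x))` in `ℓ_q`, with `c(1) = z`. -/
def IsFlowLine (q : ℝ≥0∞) [Fact (1 ≤ q)] (O : Set (Lq q)) (V : Lq q → Lq q) (z : Lq q)
    (c : ℝ → Lq q) : Prop :=
  c 1 = z ∧ ∀ x, 0 < x → c x ∈ O ∧ HasDerivAt c (-(1 / x) • V (c x)) x

/-- The set `𝓔₀` of the points of `𝓞 ∩ Supp Ξ` whose orbit keeps a positive coordinate of
index `0`. -/
def growingSet (q : ℝ≥0∞) [Fact (1 ≤ q)] (Ξ : Measure SplitSeq) (O : Set (Lq q))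
    (G : ℝ → Lq q → Lq q) : Set SplitSeq :=
  {y | y ∈ traceLq q O ∩ suppLq q Ξ ∧ ∀ x, 0 < x → 0 < G x (toLq q y.1) 0}

/-! Let `m` be the image of `Ξ` in `ℓ_q` and `e = (1, 0, …)`. In the time `s = log x` the curves
solve `∂ₛΦₛ = -V(Φₛ)`, and the heart of the matter is the scaling `m(Φₛ⁻¹ B) = exp(-αs) m(B)`.

The flow is global in `O`: for small `t` the map `id + tV` sends a ball of radius `r` onto a set
containing a ball of radius `(1 - |t|L) r`, so along a solution the distance to the complement of
`O` decays at most like `exp(-Lt)`, and the solution cannot leave `O` in finite time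
(`IsSolutionOn.ball_subset`).

Formally `d/ds ∫ k∘Φₛ dm = -∫ ⟨V, ∇(k∘Φₛ)⟩ dm = -α ∫ k∘Φₛ dm`, but the divergence identity is given
only for smooth cylindrical functions of compact support. It is applied instead to the time average
`H = ∫₀^ε k∘Φₛ ds`, whose derivative along `V` is `k - k∘Φ_ε` although `k` is merely Lipschitz
(`average_strict_deriv`). Restricting `H` to `ℝⁿ`, mollifying and letting `n → ∞` extends the
identity to `H` (`exists_integral_eq_of_strict_deriv`). With `u(s) = ∫ k∘Φₛ dm` this reads `u(0) -
u(ε) = α ∫₀^ε u`, so `u` is exponential. For `q = ∞` the passage to the limit needs the truncations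
of `V z` to converge to `V z`; this follows from the divergence identity tested on one extra
coordinate (`mem_approxLq_of_mem_support`).

All this is local, at points other than `e`, since `m` is only known to be finite away from `e`. It
propagates along orbits that avoid `e`, and Borel–Cantelli then shows that almost every orbit
avoiding `e` in the future converges to `e` with speed tending to `0`. If `e ∈ O` and `V(e) ≠ 0`
this is absurd, so almost every point lies on the past orbit of `e`; that orbit has finite measure,
hence `m` is finite, and the divergence identity for a constant gives `m = 0`
(`eq_zero_of_ne_zero`). Thus, unless `m = 0`, the flow fixes `e` and the scaling holds for all Borel
sets that do not contain `e` (`measure_preimage`).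

A possible atom at `e` is not scaled but fixed. This is harmless: when the atom is finite and `m ≠
0`, every neighbourhood of `e` has infinite measure outside `e`, so both sides of the integral
identity are infinite for a function positive near `e` (`lintegral_comp_flow`). The other properties
come from `V(y) ≤ y`, carried along orbits in the support, and from `V ∈ L²`. -/

/-! ### Solutions of an autonomous Lipschitz equation in an open set -/

section Flow

open Metric

variable {E : Type*} [NormedAddCommGroup E] [NormedSpace ℝ E]

/-- `V` is Lipschitz on the open set `O`, which is preserved by the Euler steps of `V`. -/
structure IsEulerInvariant (L : ℝ≥0) (O : Set E) (V : E → E) : Prop where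
  isOpen : IsOpen O
  lipschitz : LipschitzOnWith L V O
  no_escape : ∃ ε : ℝ, 0 < ε ∧ ∀ z ∈ O, ∀ t : ℝ, |t| < ε → z + t • V z ∈ O

theorem IsEulerInvariant.neg {L : ℝ≥0} {O : Set E} {V : E → E} (h : IsEulerInvariant L O V) :
    IsEulerInvariant L O (fun z => -V z) where
  isOpen := h.isOpen
  lipschitz := by
    intro x hx y hy
    simpa [edist_neg_neg] using h.lipschitz hx hy
  no_escape := by
    obtain ⟨ε, hε, hO⟩ := h.no_escape
    refine ⟨ε, hε, fun z hz t ht => ?_⟩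
    have := hO z hz (-t) (by simpa using ht)
    simpa using this

/-- `c` is a solution of `c' = V c` on `[0, T]` with values in `O`. -/
def IsSolutionOn (O : Set E) (V : E → E) (T : ℝ) (c : ℝ → E) : Prop :=
  ∀ t ∈ Icc 0 T, c t ∈ O ∧ HasDerivWithinAt c (V (c t)) (Icc 0 T) t

namespace IsSolutionOn

variable {O : Set E} {V : E → E} {T : ℝ} {c : ℝ → E} {L : ℝ≥0}

theorem continuousOn (h : IsSolutionOn O V T c) : ContinuousOn c (Icc 0 T) :=
  fun t ht => (h t ht).2.continuousWithinAt

theorem hasDerivWithinAt_Ici (h : IsSolutionOn O V T c) {t : ℝ} (ht : t ∈ Ico 0 T) :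
    HasDerivWithinAt c (V (c t)) (Ici t) t := by
  have h1 := ((h t ⟨ht.1, ht.2.le⟩).2).mono (s := Icc t T) (Icc_subset_Icc_left ht.1)
  exact h1.mono_of_mem_nhdsWithin (Icc_mem_nhdsGE ht.2)

/-- Since `V` is Lipschitz, the speed is at most `L` times the displacement plus the initial speed,
and Grönwall bounds the displacement. Having only the initial speed on the right is what later makes
displacements square integrable. -/
theorem norm_le (h : IsSolutionOn O V T c) (hL : LipschitzOnWith L V O) {t : ℝ}
    (ht : t ∈ Icc 0 T) : ‖V (c t)‖ ≤ ‖V (c 0)‖ * Real.exp (L * t) := by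
  have h0 : (0 : ℝ) ∈ Icc 0 T := ⟨le_rfl, ht.1.trans ht.2⟩
  have hVc : ∀ s ∈ Icc (0 : ℝ) T, ‖V (c s)‖ ≤ L * ‖c s - c 0‖ + ‖V (c 0)‖ := by
    intro s hs
    have h1 := hL.dist_le_mul _ (h s hs).1 _ (h 0 h0).1
    rw [dist_eq_norm, dist_eq_norm] at h1
    have h2 : ‖V (c s)‖ ≤ ‖V (c s) - V (c 0)‖ + ‖V (c 0)‖ := by
      simpa using norm_add_le (V (c s) - V (c 0)) (V (c 0))
    linarith
  have h3 := norm_le_gronwallBound_of_norm_deriv_right_le (f := fun s => c s - c 0)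
    (f' := fun s => V (c s)) (δ := 0) (K := L) (ε := ‖V (c 0)‖) (a := 0) (b := T)
    (h.continuousOn.sub continuousOn_const)
    (fun s hs => (h.hasDerivWithinAt_Ici hs).sub_const _) (by simp)
    (fun s hs => hVc s ⟨hs.1, hs.2.le⟩) t ht
  have h4 := hVc t ht
  rw [sub_zero] at h3
  have h5 : L * gronwallBound 0 L ‖V (c 0)‖ t + ‖V (c 0)‖ = ‖V (c 0)‖ * Real.exp (L * t) := by
    by_cases hL0 : (L : ℝ) = 0
    · simp [hL0]
    · rw [gronwallBound_of_K_ne_0 hL0]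
      field_simp
      ring
  calc ‖V (c t)‖ ≤ L * ‖c t - c 0‖ + ‖V (c 0)‖ := h4
    _ ≤ L * gronwallBound 0 L ‖V (c 0)‖ t + ‖V (c 0)‖ := by gcongr
    _ = _ := h5

end IsSolutionOn

theorem IsSolutionOn.mono {O : Set E} {V : E → E} {T T' : ℝ} {c : ℝ → E}
    (h : IsSolutionOn O V T c) (hT : T' ≤ T) : IsSolutionOn O V T' c :=
  fun t ht => ⟨(h t ⟨ht.1, ht.2.trans hT⟩).1,
    (h t ⟨ht.1, ht.2.trans hT⟩).2.mono (Icc_subset_Icc_right hT)⟩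

theorem IsSolutionOn.glue {O : Set E} {V : E → E} {s δ : ℝ} {c α : ℝ → E} (hs : 0 ≤ s)
    (hδ : 0 ≤ δ) (h : IsSolutionOn O V s c) (hα : α s = c s)
    (h' : ∀ t ∈ Icc s (s + δ), α t ∈ O ∧ HasDerivWithinAt α (V (α t)) (Icc s (s + δ)) t) :
    IsSolutionOn O V (s + δ) (fun t => if t ≤ s then c t else α t) := by
  have e1 : EqOn (fun t => if t ≤ s then c t else α t) c (Icc 0 s) := fun t ht => if_pos ht.2
  have e2 : EqOn (fun t => if t ≤ s then c t else α t) α (Icc s (s + δ)) := by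
    intro t ht
    rcases ht.1.eq_or_lt with rfl | hlt
    · simp [hα]
    · exact if_neg (not_le.2 hlt)
  have hun : Icc 0 (s + δ) = Icc 0 s ∪ Icc s (s + δ) :=
    (Icc_union_Icc_eq_Icc hs (by linarith)).symm
  intro t ht
  rw [hun]
  rcases lt_trichotomy t s with hlt | rfl | hlt
  · have ht' : t ∈ Icc 0 s := ⟨ht.1, hlt.le⟩
    rw [e1 ht']
    refine ⟨(h t ht').1, ((h t ht').2.congr_of_mem e1 ht').union ?_⟩
    apply HasFDerivWithinAt.of_notMem_closure
    rw [closure_Icc]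
    exact fun hh => absurd hh.1 (not_le.2 hlt)
  · have ht' : t ∈ Icc 0 t := ⟨ht.1, le_rfl⟩
    have ht'' : t ∈ Icc t (t + δ) := ⟨le_rfl, ht.2⟩
    refine ⟨by rw [e1 ht']; exact (h t ht').1, ?_⟩
    refine HasDerivWithinAt.union ?_ ?_
    · rw [e1 ht']; exact (h t ht').2.congr_of_mem e1 ht'
    · rw [e2 ht'']; exact (h' t ht'').2.congr_of_mem e2 ht''
  · have ht' : t ∈ Icc s (s + δ) := ⟨hlt.le, ht.2⟩
    rw [e2 ht']
    refine ⟨(h' t ht').1, HasDerivWithinAt.union ?_ ((h' t ht').2.congr_of_mem e2 ht')⟩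
    apply HasFDerivWithinAt.of_notMem_closure
    rw [closure_Icc]
    exact fun hh => absurd hh.2 (not_le.2 hlt)

theorem IsSolutionOn.eqOn {O : Set E} {V : E → E} {T : ℝ} {c c' : ℝ → E} {L : ℝ≥0}
    (h : IsSolutionOn O V T c) (h' : IsSolutionOn O V T c') (hL : LipschitzOnWith L V O)
    (h0 : c 0 = c' 0) : EqOn c c' (Icc 0 T) :=
  ODE_solution_unique_of_mem_Icc_right (v := fun _ => V) (s := fun _ => O) (K := L)
    (fun _ _ => hL) h.continuousOn (fun _ ht => h.hasDerivWithinAt_Ici ht)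
    (fun t ht => (h t ⟨ht.1, ht.2.le⟩).1) h'.continuousOn
    (fun _ ht => h'.hasDerivWithinAt_Ici ht) (fun t ht => (h' t ⟨ht.1, ht.2.le⟩).1) h0

/-! ### Global existence: solutions do not leave `O` in finite time -/

section Existence

variable [CompleteSpace E]

/-- The image of a ball under an Euler step contains a ball of comparable radius. -/
theorem IsEulerInvariant.ball_subset {L : ℝ≥0} {O : Set E} {V : E → E}
    (h : IsEulerInvariant L O V) :
    ∃ ε : ℝ, 0 < ε ∧ ∀ t : ℝ, |t| < ε → ∀ z r, ball z r ⊆ O →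
      ball (z + t • V z) ((1 - |t| * L) * r) ⊆ O := by
  obtain ⟨ε, hε, hO⟩ := h.no_escape
  -- The bound `(L + 1)⁻¹` forces `|t| L < 1`, so that the Euler step is a perturbation of the
  -- identity by a contraction.
  refine ⟨min ε (L + 1)⁻¹, by positivity, fun t ht z r hr w hw => ?_⟩
  have ht1 : |t| < ε := ht.trans_le (min_le_left _ _)
  have ht2 : |t| * L < 1 := by
    have h1 : |t| < ((L : ℝ) + 1)⁻¹ := ht.trans_le (min_le_right _ _)
    have h2 : |t| * (L + 1) < 1 := (lt_div_iff₀ (by positivity)).1 (by rwa [one_div])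
    nlinarith [abs_nonneg t]
  have hpos : 0 < 1 - |t| * L := by linarith
  obtain ⟨r', hr'1, hr'2⟩ : ∃ r', dist w (z + t • V z) ≤ (1 - |t| * L) * r' ∧ r' < r := by
    refine ⟨dist w (z + t • V z) / (1 - |t| * L), ?_, ?_⟩
    · rw [mul_div_cancel₀ _ hpos.ne']
    · rw [div_lt_iff₀ hpos, mul_comm]; exact hw
  have hr'0 : 0 ≤ r' := by
    by_contra hneg
    have := (dist_nonneg (x := w) (y := z + t • V z)).trans hr'1
    nlinarith
  -- The quantitative inverse function theorem gives each `w` of the smaller ball as an Euler step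
  -- from a point of `O`; the no-escape condition then puts `w` itself in `O`.
  have happ : ApproximatesLinearOn (fun y => y + t • V y) (ContinuousLinearMap.id ℝ E) O
      (Real.nnabs t * L) := by
    intro x hx y hy
    have := h.lipschitz.dist_le_mul _ hx _ hy
    rw [dist_eq_norm, dist_eq_norm] at this
    have h1 : x + t • V x - (y + t • V y) - (ContinuousLinearMap.id ℝ E) (x - y)
        = t • (V x - V y) := by
      simp only [ContinuousLinearMap.id_apply, smul_sub]; abel
    rw [h1, norm_smul, Real.norm_eq_abs]
    push_cast
    rw [mul_assoc]
    gcongr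
  have hsub : closedBall z r' ⊆ O := (closedBall_subset_ball hr'2).trans hr
  let g : (ContinuousLinearMap.id ℝ E).NonlinearRightInverse :=
    ⟨id, 1, by simp, fun _ => rfl⟩
  have hsurj := happ.surjOn_closedBall_of_nonlinearRightInverse g hr'0 hsub
  have hg : ((g.nnnorm : ℝ)⁻¹ - (Real.nnabs t * L : ℝ≥0)) * r' = (1 - |t| * L) * r' := by
    simp [g]
  rw [hg] at hsurj
  obtain ⟨y, hy, rfl⟩ := hsurj (mem_closedBall.2 hr'1)
  exact hO y (hsub hy) t ht1

/-- Along a solution, the distance to the complement of `O` decays at most exponentially. -/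
theorem IsSolutionOn.ball_subset {L : ℝ≥0} {O : Set E} {V : E → E} {T : ℝ} {c : ℝ → E}
    (h : IsSolutionOn O V T c) (hV : IsEulerInvariant L O V) {r : ℝ} (hr : ball (c 0) r ⊆ O)
    {t : ℝ} (ht : t ∈ Icc 0 T) : ball (c t) (r * Real.exp (-(L * t))) ⊆ O := by
  rcases (Oᶜ).eq_empty_or_nonempty with hO | hO
  · rw [compl_empty_iff.1 hO]; exact subset_univ _
  obtain ⟨ε, hε, hball⟩ := hV.ball_subset
  have hD : r ≤ infDist (c 0) Oᶜ := by
    refine (le_infDist hO).2 fun w hw => ?_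
    by_contra hlt
    exact hw (hr (by rw [mem_ball, dist_comm]; linarith))
  have hstep : ∀ x ∈ Ico (0 : ℝ) T, ∀ s, |s| < ε →
      (1 - |s| * L) * infDist (c x) Oᶜ ≤ infDist (c x + s • V (c x)) Oᶜ := by
    intro x hx s hs
    refine (le_infDist hO).2 fun w hw => ?_
    by_contra hlt
    exact hw (hball s hs _ _ ball_infDist_compl_subset (by rw [mem_ball, dist_comm]; linarith))
  -- The distance to the complement need not be differentiable, so Grönwall is used with a lower
  -- right Dini derivative; the step inequality `hstep` bounds the difference quotients, up to the
  -- `o` term of the derivative of `c`.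
  have key := le_gronwallBound_of_liminf_deriv_right_le (f := fun s => -infDist (c s) Oᶜ)
    (f' := fun s => L * infDist (c s) Oᶜ) (δ := -r) (K := -L) (ε := 0) (a := 0) (b := T)
    ((continuous_infDist_pt _).comp_continuousOn h.continuousOn).neg ?_ (by linarith)
    (fun x _ => by simp) t ht
  · rw [gronwallBound_ε0, sub_zero] at key
    refine Subset.trans (ball_subset_ball ?_) (ball_infDist_compl_subset (x := c t))
    have h1 : -(L : ℝ) * t = -(L * t) := by ring
    rw [h1] at key
    linarith
  · intro x hx ρ hρ
    refine Eventually.frequently ?_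
    have hder := (h.hasDerivWithinAt_Ici hx).Ioi_of_Ici
    rw [hasDerivWithinAt_iff_isLittleO] at hder
    have h1 := hder.def (c := (ρ - L * infDist (c x) Oᶜ) / 2) (by linarith)
    have h2 : ∀ᶠ z in 𝓝[>] x, z < x + ε := nhdsWithin_le_nhds (Iio_mem_nhds (by linarith))
    filter_upwards [h1, h2, self_mem_nhdsWithin] with z hz1 hz2 hz3
    have hz3' : 0 < z - x := sub_pos.2 hz3
    have h3 := hstep x hx (z - x) (by rw [abs_of_pos hz3']; linarith)
    rw [abs_of_pos hz3'] at h3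
    have h4 := infDist_le_infDist_add_dist (s := Oᶜ) (x := c x + (z - x) • V (c x)) (y := c z)
    rw [dist_comm, dist_eq_norm, ← sub_sub] at h4
    rw [Real.norm_of_nonneg hz3'.le] at hz1
    rw [inv_mul_lt_iff₀ hz3']
    nlinarith

theorem exists_local_solution {L : ℝ≥0} {V : E → E} {x : E} {a M δ s : ℝ} (ha : 0 ≤ a)
    (hL : LipschitzOnWith L V (closedBall x a)) (hM0 : 0 ≤ M)
    (hM : ∀ y ∈ closedBall x a, ‖V y‖ ≤ M) (hδ : 0 ≤ δ) (hMδ : M * δ ≤ a) :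
    ∃ α : ℝ → E, α s = x ∧ ∀ t ∈ Icc s (s + δ), α t ∈ closedBall x a ∧
      HasDerivWithinAt α (V (α t)) (Icc s (s + δ)) t := by
  lift a to ℝ≥0 using ha
  lift M to ℝ≥0 using hM0
  have hs : s ∈ Icc s (s + δ) := ⟨le_rfl, by linarith⟩
  have hf : IsPicardLindelof (fun _ => V) (tmin := s) (tmax := s + δ) ⟨s, hs⟩ x a 0 M L :=
    { lipschitzOnWith := fun _ _ => hL
      continuousOn := fun _ _ => continuousOn_const
      norm_le := fun _ _ => hM
      mul_max_le := by simpa [hδ] using hMδ }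
  have hx : x ∈ closedBall x (0 : ℝ≥0) := mem_closedBall_self le_rfl
  obtain ⟨α, hα⟩ := ODE.FunSpace.exists_isFixedPt_next hf hx
  refine ⟨α.compProj, ?_, fun t ht => ⟨α.compProj_mem_closedBall hf.mul_max_le, ?_⟩⟩
  · have := ODE.FunSpace.compProj_val (α := α) (t := ⟨s, hs⟩)
    rw [this, ← hα, ODE.FunSpace.next_apply₀]
  · apply ODE.hasDerivWithinAt_picard_Icc hs hf.continuousOn_uncurry
      α.continuous_compProj.continuousOn (fun _ _ => α.compProj_mem_closedBall hf.mul_max_le)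
      x ht |>.congr_of_mem _ ht
    intro t' ht'
    nth_rw 1 [← hα]
    rw [ODE.FunSpace.compProj_of_mem ht', ODE.FunSpace.next_apply]

/-- Up to time `T`, any solution from `z` keeps a ball of radius `2a` around it in `O` and has speed
at most `‖V z‖ exp(LT)`. Picard–Lindelöf on the ball of radius `a` therefore works with the same
step `δ` from every time, and finitely many steps reach `T`. -/
theorem IsEulerInvariant.exists_isSolutionOn {L : ℝ≥0} {O : Set E} {V : E → E}
    (hV : IsEulerInvariant L O V) {z : E} (hz : z ∈ O) {T : ℝ} (hT : 0 ≤ T) :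
    ∃ c : ℝ → E, c 0 = z ∧ IsSolutionOn O V T c := by
  obtain ⟨r, hr, hball⟩ := Metric.isOpen_iff.1 hV.isOpen z hz
  set a : ℝ := r * Real.exp (-(L * T)) / 2 with ha
  have ha0 : 0 < a := by positivity
  set M : ℝ := ‖V z‖ * Real.exp (L * T) + L * a with hM
  have hM0 : 0 ≤ M := by positivity
  set δ : ℝ := a / (M + 1) with hδ
  have hδ0 : 0 < δ := by positivity
  have hMδ : M * δ ≤ a := by
    rw [hδ, mul_div_assoc', div_le_iff₀ (by positivity)]
    nlinarith
  have step : ∀ s ∈ Icc 0 T, ∀ c : ℝ → E, c 0 = z → IsSolutionOn O V s c →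
      ∃ c' : ℝ → E, c' 0 = z ∧ IsSolutionOn O V (s + δ) c' := by
    intro s hs c hc0 hc
    have hss : s ∈ Icc 0 s := ⟨hs.1, le_rfl⟩
    have hsub : closedBall (c s) a ⊆ O := by
      refine Subset.trans ?_ (hc.ball_subset hV (hc0 ▸ hball) hss)
      refine closedBall_subset_ball ?_
      have : Real.exp (-(L * T)) ≤ Real.exp (-(L * s)) := by
        have := hs.2
        gcongr
      have h2 : 0 < r * Real.exp (-(L * T)) := by positivity
      calc a < r * Real.exp (-(L * T)) := by rw [ha]; linarith
        _ ≤ _ := by gcongr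
    have hbd : ∀ y ∈ closedBall (c s) a, ‖V y‖ ≤ M := by
      intro y hy
      have h1 := hV.lipschitz.dist_le_mul _ (hsub hy) _ (hc s hss).1
      have h2 := hc.norm_le hV.lipschitz hss
      rw [hc0] at h2
      have h3 : ‖V y‖ ≤ dist (V y) (V (c s)) + ‖V (c s)‖ := by
        rw [dist_eq_norm]
        simpa using norm_add_le (V y - V (c s)) (V (c s))
      have h4 : Real.exp (L * s) ≤ Real.exp (L * T) := by
        have := hs.2
        gcongr
      have h5 : (L : ℝ) * dist y (c s) ≤ L * a := by gcongr; exact hy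
      have h6 : ‖V z‖ * Real.exp (L * s) ≤ ‖V z‖ * Real.exp (L * T) := by gcongr
      linarith
    obtain ⟨α, hα, hα'⟩ := exists_local_solution (s := s) ha0.le (hV.lipschitz.mono hsub) hM0
      hbd hδ0.le hMδ
    refine ⟨_, ?_, hc.glue hs.1 hδ0.le hα fun t ht => ⟨hsub (hα' t ht).1, (hα' t ht).2⟩⟩
    simpa [hs.1] using hc0
  have iter : ∀ n : ℕ, ∃ c : ℝ → E, c 0 = z ∧ IsSolutionOn O V (min (n * δ) T) c := by
    intro n
    induction n with
    | zero =>
      refine ⟨fun _ => z, rfl, fun t ht => ⟨hz, ?_⟩⟩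
      have h0 : min (((0 : ℕ) : ℝ) * δ) T = 0 := by simp [hT]
      rw [h0, Icc_self] at ht ⊢
      rw [mem_singleton_iff.1 ht]
      exact HasFDerivWithinAt.of_subsingleton subsingleton_singleton
    | succ n ih =>
      obtain ⟨c, hc0, hc⟩ := ih
      obtain ⟨c', hc'0, hc'⟩ := step _ ⟨le_min (by positivity) hT, min_le_right _ _⟩ c hc0 hc
      refine ⟨c', hc'0, hc'.mono ?_⟩
      rw [← min_add_add_right]
      refine min_le_min ?_ (by linarith)
      push_cast
      linarith
  obtain ⟨n, hn⟩ := exists_nat_gt (T / δ)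
  obtain ⟨c, hc0, hc⟩ := iter n
  refine ⟨c, hc0, ?_⟩
  rwa [min_eq_right] at hc
  rw [div_lt_iff₀ hδ0] at hn
  exact hn.le

theorem IsEulerInvariant.exists_forward {L : ℝ≥0} {O : Set E} {V : E → E}
    (hV : IsEulerInvariant L O V) {z : E} (hz : z ∈ O) :
    ∃ c : ℝ → E, c 0 = z ∧ ∀ T, IsSolutionOn O V T c := by
  choose c hc0 hc using fun n : ℕ => hV.exists_isSolutionOn hz (T := n) n.cast_nonneg
  have hcompat : ∀ m n : ℕ, m ≤ n → EqOn (c m) (c n) (Icc 0 m) := fun m n hmn =>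
    (hc m).eqOn ((hc n).mono (by exact_mod_cast hmn)) hV.lipschitz ((hc0 m).trans (hc0 n).symm)
  have heq : ∀ n : ℕ, EqOn (fun t => c ⌈t⌉₊ t) (c n) (Icc 0 n) := by
    intro n t ht
    exact hcompat _ _ (Nat.ceil_le.2 ht.2) ⟨ht.1, Nat.le_ceil t⟩
  refine ⟨fun t => c ⌈t⌉₊ t, by simp [hc0], fun T => ?_⟩
  obtain ⟨n, hn⟩ := exists_nat_gt T
  refine IsSolutionOn.mono (fun t ht => ?_) hn.le
  have h1 := heq n ht
  simp only at h1
  refine ⟨by rw [h1]; exact (hc n t ht).1, ?_⟩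
  rw [h1]
  exact (hc n t ht).2.congr_of_mem (heq n) ht

theorem IsEulerInvariant.exists_global {L : ℝ≥0} {O : Set E} {V : E → E}
    (hV : IsEulerInvariant L O V) {z : E} (hz : z ∈ O) :
    ∃ c : ℝ → E, c 0 = z ∧ ∀ t, c t ∈ O ∧ HasDerivAt c (V (c t)) t := by
  obtain ⟨a, ha0, ha⟩ := hV.exists_forward hz
  obtain ⟨b, hb0, hb⟩ := hV.neg.exists_forward hz
  have ha' : ∀ t, 0 ≤ t → a t ∈ O ∧ HasDerivWithinAt a (V (a t)) (Ici 0) t := by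
    intro t ht
    obtain ⟨h1, h2⟩ := ha (t + 1) t ⟨ht, by linarith⟩
    refine ⟨h1, h2.mono_of_mem_nhdsWithin ?_⟩
    exact mem_nhdsWithin.2 ⟨Iio (t + 1), isOpen_Iio, by simp, fun x hx => ⟨hx.2, hx.1.le⟩⟩
  have hb' : ∀ t, t ≤ 0 → b (-t) ∈ O ∧
      HasDerivWithinAt (fun s => b (-s)) (V (b (-t))) (Iic 0) t := by
    intro t ht
    obtain ⟨h1, h2⟩ := hb (-t + 1) (-t) ⟨by linarith, by linarith⟩
    refine ⟨h1, ?_⟩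
    have h3 : HasDerivWithinAt b (-V (b (-t))) (Ici 0) (-t) := by
      refine h2.mono_of_mem_nhdsWithin ?_
      exact mem_nhdsWithin.2 ⟨Iio (-t + 1), isOpen_Iio, by simp, fun x hx => ⟨hx.2, hx.1.le⟩⟩
    have h4 := h3.scomp t (hasDerivAt_neg t).hasDerivWithinAt
      (s := Iic 0) (fun x hx => by simpa using hx)
    simpa [Function.comp_def] using h4
  have e1 : EqOn (fun t => if 0 ≤ t then a t else b (-t)) a (Ici 0) := fun t ht => if_pos ht
  have e2 : EqOn (fun t => if 0 ≤ t then a t else b (-t)) (fun t => b (-t)) (Iic 0) := by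
    intro t ht
    rcases (mem_Iic.1 ht).eq_or_lt with rfl | hlt
    · simp [ha0, hb0]
    · exact if_neg (not_le.2 hlt)
  refine ⟨fun t => if 0 ≤ t then a t else b (-t), by simp [ha0], fun t => ?_⟩
  rcases lt_trichotomy t 0 with ht | rfl | ht
  · rw [e2 ht.le]
    exact ⟨(hb' t ht.le).1,
      ((hb' t ht.le).2.congr_of_mem e2 ht.le).hasDerivAt (Iic_mem_nhds ht)⟩
  · have h1 := (ha' 0 le_rfl).2.congr_of_mem e1 self_mem_Ici
    have h2 := (hb' 0 le_rfl).2.congr_of_mem e2 self_mem_Iic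
    have h3 := e1 (self_mem_Ici (a := (0:ℝ)))
    simp only [le_refl, if_true] at h3 ⊢
    rw [neg_zero, hb0] at h2
    rw [ha0] at h1
    refine ⟨(ha' 0 le_rfl).1, ?_⟩
    rw [ha0, ← hasDerivWithinAt_univ, ← Iic_union_Ici (a := (0 : ℝ))]
    exact h2.union h1
  · rw [e1 ht.le]
    exact ⟨(ha' t ht.le).1,
      ((ha' t ht.le).2.congr_of_mem e1 ht.le).hasDerivAt (Ici_mem_nhds ht)⟩

end Existence

/-! ### The flow as a one-parameter group, with its growth and continuity -/

/-- `Φ` is the flow of `-V` on `O`, extended by the identity outside of `O`. -/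
structure IsBackwardFlow (O : Set E) (V : E → E) (Φ : ℝ → E → E) : Prop where
  zero : ∀ z, Φ 0 z = z
  off : ∀ t, ∀ z ∉ O, Φ t z = z
  mem : ∀ t, ∀ z ∈ O, Φ t z ∈ O
  hasDerivAt : ∀ z ∈ O, ∀ t, HasDerivAt (fun s => Φ s z) (-V (Φ t z)) t

theorem IsEulerInvariant.exists_isBackwardFlow [CompleteSpace E] {L : ℝ≥0} {O : Set E}
    {V : E → E} (hV : IsEulerInvariant L O V) : ∃ Φ : ℝ → E → E, IsBackwardFlow O V Φ := by
  classical
  choose c hc0 hc using fun z : O => hV.neg.exists_global z.2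
  refine ⟨fun t z => if h : z ∈ O then c ⟨z, h⟩ t else z, ⟨fun z => ?_, fun t z hz => ?_,
    fun t z hz => ?_, fun z hz t => ?_⟩⟩
  · by_cases h : z ∈ O <;> simp [h, hc0]
  · simp [hz]
  · simpa [hz] using (hc ⟨z, hz⟩ t).1
  · simpa [hz] using (hc ⟨z, hz⟩ t).2

namespace IsBackwardFlow

variable {O : Set E} {V : E → E} {Φ : ℝ → E → E} {L : ℝ≥0}

theorem lipschitzOn_neg (hL : LipschitzOnWith L V O) : LipschitzOnWith L (fun z => -V z) O := by
  intro x hx y hy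
  simpa [edist_neg_neg] using hL hx hy

theorem reverse (h : IsBackwardFlow O V Φ) :
    IsBackwardFlow O (fun z => -V z) (fun t => Φ (-t)) where
  zero z := by simpa using h.zero z
  off t := h.off (-t)
  mem t := h.mem (-t)
  hasDerivAt z hz t := by
    simpa [Function.comp_def] using
      (h.hasDerivAt z hz (-t)).scomp t (hasDerivAt_neg t)

theorem isSolutionOn (h : IsBackwardFlow O V Φ) {z : E} (hz : z ∈ O) (T : ℝ) :
    IsSolutionOn O (fun z => -V z) T (fun t => Φ t z) :=
  fun t _ => ⟨h.mem t z hz, (h.hasDerivAt z hz t).hasDerivWithinAt⟩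

theorem mem_iff (h : IsBackwardFlow O V Φ) {t : ℝ} {z : E} : Φ t z ∈ O ↔ z ∈ O := by
  refine ⟨fun hz => ?_, h.mem t z⟩
  by_contra hn
  exact hn (h.off t z hn ▸ hz)

theorem unique (h : IsBackwardFlow O V Φ) (hL : LipschitzOnWith L V O) {c : ℝ → E} {z : E}
    (hc0 : c 0 = z) (hc : ∀ t, c t ∈ O ∧ HasDerivAt c (-V (c t)) t) (t : ℝ) : c t = Φ t z := by
  have hz : z ∈ O := hc0 ▸ (hc 0).1
  exact congrFun (ODE_solution_unique_univ (v := fun _ z => -V z) (s := fun _ => O) (K := L)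
    (t₀ := 0) (fun _ => (lipschitzOn_neg hL)) (fun t => ⟨(hc t).2, (hc t).1⟩)
    (fun t => ⟨h.hasDerivAt z hz t, h.mem t z hz⟩) (by rw [hc0, h.zero])) t

theorem add (h : IsBackwardFlow O V Φ) (hL : LipschitzOnWith L V O) (s t : ℝ) (z : E) :
    Φ (s + t) z = Φ s (Φ t z) := by
  by_cases hz : z ∈ O
  · refine h.unique hL (c := fun s => Φ (s + t) z) (by simp) (fun s => ⟨h.mem _ _ hz, ?_⟩) s
    exact (h.hasDerivAt z hz (s + t)).comp_add_const s t
  · simp [h.off _ z hz]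

theorem neg_apply (h : IsBackwardFlow O V Φ) (hL : LipschitzOnWith L V O) (t : ℝ) (z : E) :
    Φ (-t) (Φ t z) = z := by
  rw [← h.add hL, neg_add_cancel, h.zero]

theorem apply_neg (h : IsBackwardFlow O V Φ) (hL : LipschitzOnWith L V O) (t : ℝ) (z : E) :
    Φ t (Φ (-t) z) = z := by
  rw [← h.add hL, add_neg_cancel, h.zero]

theorem norm_le_of_nonneg (h : IsBackwardFlow O V Φ) (hL : LipschitzOnWith L V O) {z : E}
    (hz : z ∈ O) {t : ℝ} (ht : 0 ≤ t) : ‖V (Φ t z)‖ ≤ ‖V z‖ * Real.exp (L * t) := by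
  simpa [h.zero] using (h.isSolutionOn hz t).norm_le (lipschitzOn_neg hL) ⟨ht, le_rfl⟩

theorem dist_le_of_nonneg (h : IsBackwardFlow O V Φ) (hL : LipschitzOnWith L V O) {z w : E}
    (hz : z ∈ O) (hw : w ∈ O) {t : ℝ} (ht : 0 ≤ t) :
    dist (Φ t z) (Φ t w) ≤ dist z w * Real.exp (L * t) := by
  have h1 := h.isSolutionOn hz t
  have h2 := h.isSolutionOn hw t
  simpa using dist_le_of_trajectories_ODE_of_mem (v := fun _ z => -V z) (s := fun _ => O)
    (K := L) (δ := dist z w) (fun _ _ => (lipschitzOn_neg hL)) h1.continuousOn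
    (fun _ ht => h1.hasDerivWithinAt_Ici ht) (fun _ _ => h.mem _ _ hz) h2.continuousOn
    (fun _ ht => h2.hasDerivWithinAt_Ici ht) (fun _ _ => h.mem _ _ hw)
    (by simp [h.zero]) t ⟨ht, le_rfl⟩

theorem norm_le (h : IsBackwardFlow O V Φ) (hL : LipschitzOnWith L V O) {z : E}
    (hz : z ∈ O) (t : ℝ) : ‖V (Φ t z)‖ ≤ ‖V z‖ * Real.exp (L * |t|) := by
  rcases le_total 0 t with ht | ht
  · simpa [abs_of_nonneg ht] using h.norm_le_of_nonneg hL hz ht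
  · simpa [abs_of_nonpos ht] using
      h.reverse.norm_le_of_nonneg (lipschitzOn_neg hL) hz (neg_nonneg.2 ht)

theorem dist_le (h : IsBackwardFlow O V Φ) (hL : LipschitzOnWith L V O) {z w : E}
    (hz : z ∈ O) (hw : w ∈ O) (t : ℝ) :
    dist (Φ t z) (Φ t w) ≤ dist z w * Real.exp (L * |t|) := by
  rcases le_total 0 t with ht | ht
  · simpa [abs_of_nonneg ht] using h.dist_le_of_nonneg hL hz hw ht
  · simpa [abs_of_nonpos ht] using
      h.reverse.dist_le_of_nonneg (lipschitzOn_neg hL) hz hw (neg_nonneg.2 ht)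

/-- Along an orbit the displacement is controlled by the speed at the starting point. -/
theorem dist_apply_le (h : IsBackwardFlow O V Φ) (hL : LipschitzOnWith L V O) {z : E}
    (hz : z ∈ O) {s t T : ℝ} (hs : |s| ≤ T) (ht : |t| ≤ T) :
    dist (Φ s z) (Φ t z) ≤ ‖V z‖ * Real.exp (L * T) * |s - t| := by
  rw [dist_eq_norm, ← Real.norm_eq_abs]
  refine Convex.norm_image_sub_le_of_norm_hasDerivWithin_le (s := Icc (-T) T)
    (f := fun s => Φ s z) (f' := fun s => -V (Φ s z))
    (fun x _ => (h.hasDerivAt z hz x).hasDerivWithinAt) (fun x hx => ?_) (convex_Icc _ _)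
    (abs_le.1 ht) (abs_le.1 hs)
  rw [norm_neg]
  refine (h.norm_le hL hz x).trans ?_
  have := abs_le.2 hx
  gcongr

theorem continuous_time (h : IsBackwardFlow O V Φ) (z : E) : Continuous fun t => Φ t z := by
  by_cases hz : z ∈ O
  · exact continuous_iff_continuousAt.2 fun t => (h.hasDerivAt z hz t).continuousAt
  · simpa [h.off _ z hz] using continuous_const

theorem continuousOn (h : IsBackwardFlow O V Φ) (hL : LipschitzOnWith L V O) :
    ContinuousOn (fun p : ℝ × E => Φ p.1 p.2) (univ ×ˢ O) := by
  rintro ⟨t, z⟩ ⟨-, hz⟩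
  simp only at hz
  have h1 : Tendsto (fun p : ℝ × E => dist p.2 z * Real.exp (L * |p.1|) + dist (Φ p.1 z) (Φ t z))
      (𝓝[univ ×ˢ O] (t, z)) (𝓝 0) := by
    have hc : Continuous fun p : ℝ × E =>
        dist p.2 z * Real.exp (L * |p.1|) + dist (Φ p.1 z) (Φ t z) := by
      have h2 : Continuous fun p : ℝ × E => Φ p.1 z := (h.continuous_time z).comp continuous_fst
      exact ((continuous_snd.dist continuous_const).mul (by fun_prop)).add
        (h2.dist continuous_const)
    have := hc.tendsto (t, z)
    simp only [dist_self, zero_mul, add_zero] at this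
    exact this.mono_left nhdsWithin_le_nhds
  refine tendsto_iff_dist_tendsto_zero.2 (squeeze_zero' (Eventually.of_forall fun _ =>
    dist_nonneg) ?_ h1)
  filter_upwards [self_mem_nhdsWithin] with p hp
  exact (dist_triangle _ (Φ p.1 z) _).trans (by gcongr; exact h.dist_le hL hp.2 hz _)

theorem continuousOn_apply (h : IsBackwardFlow O V Φ) (hL : LipschitzOnWith L V O) (t : ℝ) :
    ContinuousOn (Φ t) O :=
  (h.continuousOn hL).comp (f := fun z => (t, z)) (by fun_prop) fun _ hz => ⟨mem_univ _, hz⟩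

theorem measurable [MeasurableSpace E] [BorelSpace E] (h : IsBackwardFlow O V Φ)
    (hL : LipschitzOnWith L V O) (hO : IsOpen O) (t : ℝ) : Measurable (Φ t) := by
  classical
  refine measurable_of_isOpen fun U hU => ?_
  have : Φ t ⁻¹' U = (O ∩ Φ t ⁻¹' U) ∪ (Oᶜ ∩ U) := by
    ext z
    by_cases hz : z ∈ O
    · simp [hz]
    · simp [hz, h.off t z hz]
  rw [this]
  exact ((h.continuousOn_apply hL t).isOpen_inter_preimage hO hU).measurableSet.union
    (hO.measurableSet.compl.inter hU.measurableSet)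

theorem isOpen_preimage (h : IsBackwardFlow O V Φ) (hL : LipschitzOnWith L V O) (hO : IsOpen O)
    {U : Set E} (hU : IsOpen U) (hUO : U ⊆ O) (t : ℝ) : IsOpen (Φ t ⁻¹' U) := by
  have : Φ t ⁻¹' U = O ∩ Φ t ⁻¹' U := by
    ext z
    simp only [mem_preimage, mem_inter_iff, iff_and_self]
    exact fun hz => h.mem_iff.1 (hUO hz)
  rw [this]
  exact (h.continuousOn_apply hL t).isOpen_inter_preimage hO hU

end IsBackwardFlow

end Flow

/-! ### Truncations, the cone and measurability in `ℓ_q` -/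

section SequenceSpace

variable (q : ℝ≥0∞)

/-- The sequences `z` with `z₁ ≥ z₂ ≥ … ≥ 0`, `z₀ ≥ 0` and `zᵢ → 0`. -/
def coneLq : Set (Lq q) :=
  {z | (∀ i, 0 ≤ z i) ∧ (∀ i, 1 ≤ i → z (i + 1) ≤ z i) ∧ Tendsto (fun i => z i) atTop (𝓝 0)}

variable {q}

theorem coneLq_antitone {z : Lq q} (hz : z ∈ coneLq q) {k i : ℕ} (hk : 1 ≤ k) (hi : k ≤ i) :
    z i ≤ z k := by
  induction i, hi using Nat.le_induction with
  | base => exact le_rfl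
  | succ j hj ih => exact (hz.2.1 j (hk.trans hj)).trans ih

theorem toLq_apply {y : ℕ → ℝ} (hy : Memℓp y q) (i : ℕ) : toLq q y i = y i := by
  rw [toLq, dif_pos hy]

theorem coe_toLq {y : ℕ → ℝ} (hy : Memℓp y q) : (toLq q y : ℕ → ℝ) = y := by
  rw [toLq, dif_pos hy]

theorem toLq_mem_coneLq {y : SplitSeq} (hy : Memℓp y.1 q) : toLq q y.1 ∈ coneLq q := by
  simp only [coneLq, mem_ofPred_eq, toLq_apply hy]
  exact y.2.2

variable (q) [Fact (1 ≤ q)]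

noncomputable instance instMeasurableSpaceLq : MeasurableSpace (Lq q) := borel _

instance instBorelSpaceLq : BorelSpace (Lq q) := ⟨rfl⟩

/-- The first `n` coordinates, as a continuous linear map on `ℓ_q`. -/
noncomputable def coordsLq (n : ℕ) : Lq q →L[ℝ] (Fin n → ℝ) :=
  ContinuousLinearMap.pi fun i => lp.evalCLM ℝ (fun _ : ℕ => ℝ) q (i : ℕ)

/-- The embedding of `ℝⁿ` in `ℓ_q` as the sequences supported in `{0, …, n - 1}`. -/
noncomputable def embedLq (n : ℕ) : (Fin n → ℝ) →L[ℝ] Lq q :=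
  ∑ i : Fin n, (lp.singleContinuousLinearMap ℝ (fun _ : ℕ => ℝ) q (i : ℕ)).comp
    (ContinuousLinearMap.proj i)

/-- The point `(1, 0, 0, …)`. -/
noncomputable def unitLq : Lq q := lp.single q 0 1

/-- The sequences that are the limits in `ℓ_q` of their truncations. -/
def approxLq : Set (Lq q) :=
  {z | Tendsto (fun n => embedLq q n (coordsLq q n z)) atTop (𝓝 z)}

variable {q}

theorem pos_exponent : 0 < q := zero_lt_one.trans_le Fact.out

theorem abs_apply_le_norm (z : Lq q) (i : ℕ) : |z i| ≤ ‖z‖ :=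
  lp.norm_apply_le_norm pos_exponent.ne' z i

theorem continuous_apply_Lq (i : ℕ) : Continuous fun z : Lq q => z i :=
  (lp.evalCLM ℝ (fun _ : ℕ => ℝ) q i).continuous

theorem coordsLq_apply (n : ℕ) (z : Lq q) : coordsLq q n z = firstCoords n z := rfl

theorem embedLq_apply (n : ℕ) (u : Fin n → ℝ) (j : ℕ) :
    embedLq q n u j = if h : j < n then u ⟨j, h⟩ else 0 := by
  have h1 : embedLq q n u j = ∑ i : Fin n, (lp.single q (i : ℕ) (u i) : Lq q) j := by
    simp only [embedLq, sum_apply]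
    rw [lp.coeFn_sum, Finset.sum_apply]
    rfl
  rw [h1]
  simp only [lp.single_apply]
  split_ifs with h
  · rw [Finset.sum_eq_single (⟨j, h⟩ : Fin n)]
    · simp
    · intro b _ hb
      refine Pi.single_eq_of_ne (fun hh => hb (Fin.ext hh.symm)) _
    · simp
  · refine Finset.sum_eq_zero fun i _ => Pi.single_eq_of_ne (fun hh => h (by omega)) _

theorem embedLq_firstCoords_apply (n : ℕ) (y : ℕ → ℝ) (j : ℕ) :
    embedLq q n (firstCoords n y) j = if j < n then y j else 0 := by
  rw [embedLq_apply]
  split_ifs <;> rfl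

theorem norm_embedLq_coordsLq_le (n : ℕ) (z : Lq q) : ‖embedLq q n (coordsLq q n z)‖ ≤ ‖z‖ := by
  refine lp.norm_mono pos_exponent.ne' fun i => ?_
  rw [coordsLq_apply, embedLq_firstCoords_apply]
  split_ifs <;> simp

theorem norm_le_norm_embedLq (n : ℕ) (u : Fin n → ℝ) : ‖u‖ ≤ ‖embedLq q n u‖ := by
  refine (pi_norm_le_iff_of_nonneg (norm_nonneg _)).2 fun i => ?_
  have := abs_apply_le_norm (embedLq q n u) i
  rwa [embedLq_apply, dif_pos i.2] at this

theorem embedLq_firstCoords_eq_sum (n : ℕ) (z : Lq q) :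
    embedLq q n (coordsLq q n z) = ∑ i ∈ Finset.range n, lp.single q i (z i) := by
  ext j
  rw [coordsLq_apply, embedLq_firstCoords_apply, lp.coeFn_sum, Finset.sum_apply]
  simp only [lp.single_apply, Finset.sum_pi_single, Finset.mem_range]

theorem approxLq_eq_univ (hq : q ≠ ⊤) : approxLq q = univ := by
  refine eq_univ_of_forall fun z => ?_
  simp only [approxLq, mem_ofPred_eq, embedLq_firstCoords_eq_sum]
  exact (lp.hasSum_single hq z).tendsto_sum_nat

theorem mem_approxLq_of_tendsto {z : Lq q} (hz : Tendsto (fun i => z i) atTop (𝓝 0)) :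
    z ∈ approxLq q := by
  rcases eq_or_ne q ⊤ with rfl | hq
  · refine Metric.tendsto_atTop.2 fun ε hε => ?_
    obtain ⟨N, hN⟩ := (Metric.tendsto_atTop.1 hz) (ε / 2) (half_pos hε)
    refine ⟨N, fun n hn => ?_⟩
    rw [dist_eq_norm]
    refine (lp.norm_le_of_forall_le (half_pos hε).le fun i => ?_).trans_lt (half_lt_self hε)
    rw [lp.coeFn_sub, Pi.sub_apply, coordsLq_apply, embedLq_firstCoords_apply]
    split_ifs with h
    · simpa using (half_pos hε).le
    · have := hN i (by omega)
      rw [Real.dist_eq, sub_zero] at this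
      simpa using this.le
  · rw [approxLq_eq_univ hq]; trivial

/-- The finite sequences are dense in this set. It replaces separability of the whole space, which
fails for `q = ∞`, in all countable covering arguments. -/
theorem isSeparable_approxLq : TopologicalSpace.IsSeparable (approxLq q) := by
  have h : TopologicalSpace.IsSeparable (⋃ n, range (embedLq q n)) :=
    TopologicalSpace.IsSeparable.iUnion fun n =>
      TopologicalSpace.isSeparable_range (embedLq q n).continuous
  refine h.closure.mono fun z hz => ?_
  exact mem_closure_of_tendsto hz (Eventually.of_forall fun n =>
    mem_iUnion.2 ⟨n, mem_range_self _⟩)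

theorem coneLq_subset_approxLq : coneLq q ⊆ approxLq q := fun _ hz => mem_approxLq_of_tendsto hz.2.2

theorem isClosed_coneLq : IsClosed (coneLq q) := by
  have h3 : IsClosed {z : Lq q | Tendsto (fun i => z i) atTop (𝓝 0)} := by
    refine isClosed_of_closure_subset fun z hz => Metric.tendsto_atTop.2 fun ε hε => ?_
    obtain ⟨w, hw, hzw⟩ := Metric.mem_closure_iff.1 hz (ε / 2) (half_pos hε)
    obtain ⟨N, hN⟩ := (Metric.tendsto_atTop.1 hw) (ε / 2) (half_pos hε)
    refine ⟨N, fun n hn => ?_⟩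
    have h1 := hN n hn
    have h2 := abs_apply_le_norm (z - w) n
    rw [lp.coeFn_sub, Pi.sub_apply] at h2
    rw [dist_eq_norm] at hzw
    rw [Real.dist_eq, sub_zero] at h1 ⊢
    calc |z n| = |(z n - w n) + w n| := by ring_nf
      _ ≤ |z n - w n| + |w n| := abs_add_le _ _
      _ < ε := by linarith
  have h1 : IsClosed {z : Lq q | ∀ i, 0 ≤ z i} := by
    simp only [ofPred_forall]
    exact isClosed_iInter fun i => isClosed_le continuous_const (continuous_apply_Lq i)
  have h2 : IsClosed {z : Lq q | ∀ i, 1 ≤ i → z (i + 1) ≤ z i} := by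
    simp only [ofPred_forall]
    exact isClosed_iInter fun i => isClosed_iInter fun _ =>
      isClosed_le (continuous_apply_Lq _) (continuous_apply_Lq i)
  exact h1.inter (h2.inter h3)

variable (q) in
theorem measurableSet_memℓp : MeasurableSet {y : SplitSeq | Memℓp y.1 q} := by
  rcases eq_or_ne q ⊤ with rfl | hq
  · convert MeasurableSet.univ
    refine eq_univ_of_forall fun y => memℓp_infty_iff.2 ?_
    exact y.2.2.2.2.norm.bddAbove_range
  · have hp : 0 < q.toReal := ENNReal.toReal_pos pos_exponent.ne' hq
    have h : {y : SplitSeq | Memℓp y.1 q} =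
        {y : SplitSeq | ∑' i, ((‖y.1 i‖₊ ^ q.toReal : ℝ≥0) : ℝ≥0∞) < ⊤} := by
      ext y
      simp only [mem_ofPred_eq, lt_top_iff_ne_top, ENNReal.tsum_coe_ne_top_iff_summable,
        memℓp_gen_iff hp, ← NNReal.summable_coe, NNReal.coe_rpow, coe_nnnorm]
    rw [h]
    refine measurableSet_lt ?_ measurable_const
    refine Measurable.tsum fun i => ?_
    have : Measurable fun y : SplitSeq => y.1 i :=
      (measurable_pi_apply i).comp measurable_subtype_coe
    exact (this.nnnorm.pow_const _).coe_nnreal_ennreal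

-- `toLq` is continuous for the product topology only in special cases, but on the summable
-- sequences it is the pointwise limit of the truncations, which are continuous. Convergence of the
-- truncations for `q = ∞` uses `yᵢ → 0`.
variable (q) in
theorem measurable_toLq : Measurable fun y : SplitSeq => toLq q y.1 := by
  set D := {y : SplitSeq | Memℓp y.1 q} with hD
  refine measurable_of_tendsto_metrizable
    (f := fun n => D.indicator fun y => embedLq q n (firstCoords n y.1)) (fun n => ?_) ?_
  · have hc : Continuous fun y : SplitSeq => embedLq q n (firstCoords n y.1) := by
      refine (embedLq q n).continuous.comp (continuous_pi fun i => ?_)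
      exact (continuous_apply (i : ℕ)).comp continuous_subtype_val
    exact hc.measurable.indicator (measurableSet_memℓp q)
  · refine tendsto_pi_nhds.2 fun y => ?_
    by_cases hy : Memℓp y.1 q
    · have h1 := coneLq_subset_approxLq (toLq_mem_coneLq hy)
      simp only [approxLq, mem_ofPred_eq, coordsLq_apply, coe_toLq hy] at h1
      simpa [indicator_of_mem (show y ∈ D from hy)] using h1
    · simp [indicator_of_notMem (show y ∉ D from hy), toLq, hy]

end SequenceSpace

/-! ### Transport of the hypotheses to a measure on `ℓ_q` -/

section GrowthMeasure

/-- The image in `ℓ_q` of a splitting measure with a nice generator `V`. -/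
structure IsGrowthMeasure (q : ℝ≥0∞) [Fact (1 ≤ q)] (m : Measure (Lq q)) (α : ℝ) (L : ℝ≥0)
    (O : Set (Lq q)) (V : Lq q → Lq q) : Prop where
  pos : 0 < α
  euler : IsEulerInvariant L O V
  ae_mem : ∀ᵐ z ∂m, z ∈ O
  ae_cone : ∀ᵐ z ∂m, z ∈ coneLq q
  ae_pos : ∀ᵐ z ∂m, 0 < z 0
  finite_away : ∀ κ : ℝ, 0 < κ → m {z | κ ≤ |z 0 - 1| ∨ κ ≤ z 1} < ⊤
  sq_integrable : ∫⁻ z, ENNReal.ofReal (‖V z‖ ^ 2) ∂m < ⊤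
  divergence : ∀ (n : ℕ) (f : (Fin n → ℝ) → ℝ), ContDiff ℝ ∞ f → HasCompactSupport f →
    (∀ u, 0 ≤ f u) → Integrable (fun z => f (coordsLq q n z)) m →
    ∫ z, fderiv ℝ f (coordsLq q n z) (coordsLq q n (V z)) ∂m = α * ∫ z, f (coordsLq q n z) ∂m

variable {q : ℝ≥0∞} [Fact (1 ≤ q)]

theorem aemeasurable_of_continuousOn {m : Measure (Lq q)} {O : Set (Lq q)} {V : Lq q → Lq q}
    (hO : IsOpen O) (hm : ∀ᵐ z ∂m, z ∈ O) (hV : ContinuousOn V O) : AEMeasurable V m := by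
  have := hV.aemeasurable (μ := m) hO.measurableSet
  rwa [Measure.restrict_eq_self_of_ae_mem hm] at this

theorem aestronglyMeasurable_fderiv {m : Measure (Lq q)} {V : Lq q → Lq q}
    (hV : AEMeasurable V m) {n : ℕ} {f : (Fin n → ℝ) → ℝ} (hf : ContDiff ℝ ∞ f) :
    AEStronglyMeasurable (fun z => fderiv ℝ f (coordsLq q n z) (coordsLq q n (V z))) m := by
  have h1 : Continuous fun p : (Fin n → ℝ) × (Fin n → ℝ) => fderiv ℝ f p.1 p.2 :=
    ((hf.continuous_fderiv (by simp)).comp continuous_fst).clm_apply continuous_snd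
  refine (h1.measurable.comp_aemeasurable (AEMeasurable.prodMk ?_ ?_)).aestronglyMeasurable
  · exact (coordsLq q n).continuous.measurable.aemeasurable
  · exact (coordsLq q n).continuous.measurable.comp_aemeasurable hV

theorem ae_mem_traceLq {Ξ : Measure SplitSeq} {O : Set (Lq q)} (h : Ξ (traceLq q O)ᶜ = 0) :
    ∀ᵐ y ∂Ξ, Memℓp y.1 q ∧ toLq q y.1 ∈ O :=
  mem_ae_iff.2 h

theorem map_toLq_apply {Ξ : Measure SplitSeq} (h : ∀ᵐ y ∂Ξ, Memℓp y.1 q) {U : Set (Lq q)}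
    (hU : MeasurableSet U) : Ξ.map (fun y => toLq q y.1) U = Ξ (traceLq q U) := by
  rw [Measure.map_apply (measurable_toLq q) hU]
  refine measure_congr ?_
  filter_upwards [h] with y hy
  exact propext ⟨fun hh => ⟨hy, hh⟩, fun hh => hh.2⟩

theorem mem_suppLq_iff {Ξ : Measure SplitSeq} (h : ∀ᵐ y ∂Ξ, Memℓp y.1 q) {y : SplitSeq} :
    y ∈ suppLq q Ξ ↔ Memℓp y.1 q ∧ toLq q y.1 ∈ (Ξ.map (fun y => toLq q y.1)).support := by
  refine and_congr_right fun _ => ?_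
  rw [Measure.mem_support_iff_forall]
  refine ⟨fun hh U hU => ?_, fun hh U hU => ?_⟩
  · obtain ⟨W, hWU, hW, hyW⟩ := mem_nhds_iff.1 hU
    refine lt_of_lt_of_le ?_ (measure_mono hWU)
    rw [map_toLq_apply h hW.measurableSet]
    exact hh W (hW.mem_nhds hyW)
  · obtain ⟨W, hWU, hW, hyW⟩ := mem_nhds_iff.1 hU
    refine lt_of_lt_of_le (b := Ξ (traceLq q W)) ?_ (measure_mono fun x hx => ⟨hx.1, hWU hx.2⟩)
    rw [← map_toLq_apply h hW.measurableSet]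
    exact hh W (hW.mem_nhds hyW)

/-- Chebyshev with the square integrability of `y₀ - 1` handles the coordinate `0`; the offspring
condition handles the coordinate `1`. -/
theorem IsSplittingMeasure.finite_away {Ξ : Measure SplitSeq} (hΞ : IsSplittingMeasure Ξ) {κ : ℝ}
    (hκ : 0 < κ) : Ξ {y | κ ≤ |y.1 0 - 1| ∨ κ ≤ y.1 1} < ⊤ := by
  have h1 : Ξ {y | κ ≤ |y.1 0 - 1|} < ⊤ := by
    have hmeas : Measurable fun y : SplitSeq => ENNReal.ofReal ((y.1 0 - 1) ^ 2) := by
      have : Measurable fun y : SplitSeq => y.1 0 :=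
        (measurable_pi_apply 0).comp measurable_subtype_coe
      exact ((this.sub_const 1).pow_const 2).ennreal_ofReal
    have hpos : ENNReal.ofReal (κ ^ 2) ≠ 0 := by
      simpa using hκ.ne'
    have := meas_ge_le_lintegral_div hmeas.aemeasurable (μ := Ξ) hpos ENNReal.ofReal_ne_top
    refine lt_of_le_of_lt (measure_mono fun y hy => ?_)
      (this.trans_lt (ENNReal.div_lt_top hΞ.compensated.ne hpos))
    rw [mem_ofPred_eq] at hy ⊢
    refine ENNReal.ofReal_le_ofReal ?_
    rw [← sq_abs (y.1 0 - 1)]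
    gcongr
  have h2 := hΞ.offspring_finite (κ / 2) (half_pos hκ)
  refine lt_of_le_of_lt (measure_mono (t := {y | κ ≤ |y.1 0 - 1|} ∪ {y | κ / 2 < y.1 1}) ?_)
    ((measure_union_le _ _).trans_lt (ENNReal.add_lt_top.2 ⟨h1, h2⟩))
  rintro y (hy | hy)
  · exact Or.inl hy
  · exact Or.inr ((half_lt_self hκ).trans_le hy)

theorem IsNiceGenerator.isGrowthMeasure {Ξ : Measure SplitSeq} (hΞ : IsSplittingMeasure Ξ) {α : ℝ}
    (hα : 0 < α) {O : Set (Lq q)} {V : Lq q → Lq q} (hV : IsNiceGenerator q Ξ α O V) :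
    ∃ L, IsGrowthMeasure q (Ξ.map fun y => toLq q y.1) α L O V := by
  obtain ⟨L, hL⟩ := hV.lipschitz
  have htr := ae_mem_traceLq hV.concentrated
  have hmeas := measurable_toLq q
  have hmem : ∀ᵐ z ∂(Ξ.map fun y => toLq q y.1), z ∈ O := by
    refine (ae_map_iff (p := fun z => z ∈ O) hmeas.aemeasurable hV.isOpen.measurableSet).2 ?_
    exact htr.mono fun y hy => hy.2
  have hVm := aemeasurable_of_continuousOn hV.isOpen hmem hL.continuousOn
  refine ⟨L, ⟨hα, ⟨hV.isOpen, hL, hV.no_escape⟩, hmem, ?_, ?_, fun κ hκ => ?_, ?_,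
    fun n f hf hfc hf0 hint => ?_⟩⟩
  · refine (ae_map_iff (p := fun z => z ∈ coneLq q) hmeas.aemeasurable
      isClosed_coneLq.measurableSet).2 ?_
    exact htr.mono fun y hy => toLq_mem_coneLq hy.1
  · rw [ae_map_iff hmeas.aemeasurable
      (isOpen_lt continuous_const (continuous_apply_Lq 0)).measurableSet]
    filter_upwards [htr] with y hy
    rw [toLq_apply hy.1]
    exact y.2.1
  · rw [map_toLq_apply (htr.mono fun y hy => hy.1)]
    · refine lt_of_le_of_lt (measure_mono fun y hy => ?_) (hΞ.finite_away hκ)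
      simpa [toLq_apply hy.1] using hy.2
    · exact ((isClosed_le continuous_const ((continuous_apply_Lq 0).sub
        continuous_const).abs).union (isClosed_le continuous_const
        (continuous_apply_Lq 1))).measurableSet
  · rw [lintegral_map' ?_ hmeas.aemeasurable]
    · exact hV.sq_integrable
    · exact (hVm.norm.pow_const 2).ennreal_ofReal
  · have hfm : AEStronglyMeasurable (fun z => f (coordsLq q n z)) (Ξ.map fun y => toLq q y.1) :=
      (hf.continuous.comp (coordsLq q n).continuous).measurable.aestronglyMeasurable
    have hcoord : ∀ᵐ y ∂Ξ, coordsLq q n (toLq q y.1) = firstCoords n y.1 := by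
      filter_upwards [htr] with y hy
      rw [coordsLq_apply, coe_toLq hy.1]
    rw [integral_map hmeas.aemeasurable hfm,
      integral_map hmeas.aemeasurable (aestronglyMeasurable_fderiv hVm hf)]
    have hint' : Integrable (fun y : SplitSeq => f (firstCoords n y.1)) Ξ := by
      refine (hint.comp_measurable hmeas).congr ?_
      filter_upwards [hcoord] with y hy
      simp [hy]
    have := hV.divergence n f hf hfc hf0 hint'
    convert this using 1
    · refine integral_congr_ae ?_
      filter_upwards [hcoord] with y hy
      rw [hy, coordsLq_apply]
    · congr 1
      refine integral_congr_ae ?_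
      filter_upwards [hcoord] with y hy
      rw [hy]

theorem isLindelof_of_subset_approxLq {s : Set (Lq q)} (hs : s ⊆ approxLq q) : IsLindelof s := by
  have h := (isSeparable_approxLq (q := q)).mono hs
  have := h.separableSpace
  have : SecondCountableTopology s := UniformSpace.secondCountable_of_separable s
  rw [isLindelof_iff_lindelofSpace]
  infer_instance

namespace IsGrowthMeasure

variable {m : Measure (Lq q)} {α : ℝ} {L : ℝ≥0} {O : Set (Lq q)} {V : Lq q → Lq q}

theorem ae_approx (h : IsGrowthMeasure q m α L O V) : ∀ᵐ z ∂m, z ∈ approxLq q :=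
  h.ae_cone.mono fun _ hz => coneLq_subset_approxLq hz

theorem aemeasurable (h : IsGrowthMeasure q m α L O V) : AEMeasurable V m :=
  aemeasurable_of_continuousOn h.euler.isOpen h.ae_mem h.euler.lipschitz.continuousOn

/-- The complement of the support is locally null, and inside the separable set of limits of
truncations countably many null neighbourhoods cover it. -/
theorem ae_support (h : IsGrowthMeasure q m α L O V) : ∀ᵐ z ∂m, z ∈ m.support := by
  have hl : IsLindelof (m.supportᶜ ∩ approxLq q) := isLindelof_of_subset_approxLq inter_subset_right
  have h0 : m (m.supportᶜ ∩ approxLq q) = 0 := by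
    have := hl.compl_mem_sets_of_nhdsWithin (f := ae m) fun z hz => by
      obtain ⟨U, hU, hmU⟩ := Measure.notMem_support_iff_exists.1 hz.1
      exact ⟨U, mem_nhdsWithin_of_mem_nhds hU, by simpa [mem_ae_iff] using hmU⟩
    simpa [mem_ae_iff] using this
  have h1 : ∀ᵐ z ∂m, z ∉ m.supportᶜ ∩ approxLq q := measure_eq_zero_iff_ae_notMem.1 h0
  filter_upwards [h1, h.ae_approx] with z hz1 hz2
  by_contra hz
  exact hz1 ⟨hz, hz2⟩

theorem support_subset_coneLq (h : IsGrowthMeasure q m α L O V) : m.support ⊆ coneLq q :=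
  Measure.support_subset_of_isClosed isClosed_coneLq h.ae_cone

theorem eq_zero_of_isFiniteMeasure (h : IsGrowthMeasure q m α L O V) [IsFiniteMeasure m] :
    m = 0 := by
  -- With no coordinate at all, `ℝ⁰` is a point, so the constant `1` is an admissible test function;
  -- it is integrable because `m` is finite. The identity becomes `0 = α m(univ)`.
  have h1 := h.divergence 0 (fun _ => 1) contDiff_const
    (HasCompactSupport.of_compactSpace _) (fun _ => zero_le_one) (integrable_const _)
  simp only [fderiv_fun_const, Pi.zero_apply, zero_apply, integral_zero,
    integral_const, smul_eq_mul, mul_one, zero_eq_mul, h.pos.ne', false_or] at h1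
  rwa [Measure.real_def, ENNReal.toReal_eq_zero_iff, or_iff_left (measure_ne_top _ _),
    Measure.measure_univ_eq_zero] at h1

end IsGrowthMeasure

end GrowthMeasure

/-! ### Mollification of functions on `ℝⁿ` -/

section Mollification

open scoped Convolution

variable {n : ℕ} (φ : ContDiffBump (0 : Fin n → ℝ)) {k : (Fin n → ℝ) → ℝ}

/-- The mollification of `k` by the normalized bump function `φ`. -/
noncomputable def mollify (k : (Fin n → ℝ) → ℝ) : (Fin n → ℝ) → ℝ :=
  φ.normed volume ⋆[ContinuousLinearMap.lsmul ℝ ℝ, volume] k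

theorem contDiff_mollify (hk : Continuous k) : ContDiff ℝ ∞ (mollify φ k) :=
  φ.hasCompactSupport_normed.contDiff_convolution_left (n := ⊤) _ φ.contDiff_normed
    hk.locallyIntegrable

theorem mollify_nonneg (hk : ∀ u, 0 ≤ k u) (u : Fin n → ℝ) : 0 ≤ mollify φ k u := by
  rw [mollify, convolution_def]
  exact integral_nonneg fun t => mul_nonneg (φ.nonneg_normed t) (hk _)

theorem hasCompactSupport_mollify (hk : HasCompactSupport k) :
    HasCompactSupport (mollify φ k) :=
  φ.hasCompactSupport_normed.convolution _ hk

theorem abs_mollify_sub_le (hk : Continuous k) {u : Fin n → ℝ} {a η : ℝ} (hη : 0 ≤ η)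
    (h : ∀ x ∈ Metric.ball u φ.rOut, |k x - a| ≤ η) : |mollify φ k u - a| ≤ η :=
  dist_convolution_le hη φ.support_normed_eq.subset φ.nonneg_normed φ.integral_normed
    hk.aestronglyMeasurable h

theorem mollify_add_sub (hk : Continuous k) (u w : Fin n → ℝ) :
    mollify φ k (u + w) - mollify φ k u = mollify φ (fun x => k (x + w) - k x) u := by
  have hex : ∀ u, ConvolutionExistsAt (φ.normed volume) k u (ContinuousLinearMap.lsmul ℝ ℝ)
      volume := fun u => φ.hasCompactSupport_normed.convolutionExists_left _
        φ.continuous_normed hk.locallyIntegrable u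
  simp only [mollify, convolution_def]
  rw [← integral_sub (hex (u + w)) (hex u)]
  refine integral_congr_ae (Eventually.of_forall fun t => ?_)
  change φ.normed volume t * k (u + w - t) - φ.normed volume t * k (u - t)
    = φ.normed volume t * (k (u - t + w) - k (u - t))
  rw [← mul_sub, sub_add_eq_add_sub]

/-- Mollification commutes with translations, so an increment of the mollified function is an
average of increments of `k`. A bound on the latter, uniform near `u`, passes to the derivative; `k`
itself need not be differentiable, and only the direction `v` is involved. -/
theorem abs_fderiv_mollify_sub_le (hk : Continuous k) {u v : Fin n → ℝ} {a η r : ℝ}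
    (hη : 0 ≤ η) (hr : 0 < r) (h : ∀ x ∈ Metric.ball u φ.rOut, ∀ σ : ℝ, |σ| < r →
      |k (x + σ • v) - k x - σ * a| ≤ η * |σ|) : |fderiv ℝ (mollify φ k) u v - a| ≤ η := by
  have hd : DifferentiableAt ℝ (mollify φ k) u :=
    (contDiff_mollify φ hk).differentiable (by simp) u
  have h1 := (hd.hasFDerivAt.hasLineDerivAt v).tendsto_slope_zero
  refine le_of_tendsto ((h1.sub_const a).abs) ?_
  have hball : ∀ᶠ σ : ℝ in 𝓝[≠] 0, |σ| < r := by
    refine nhdsWithin_le_nhds ?_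
    filter_upwards [Metric.ball_mem_nhds (0 : ℝ) hr] with σ hσ
    simpa using hσ
  filter_upwards [hball, self_mem_nhdsWithin] with σ hσ hσ0
  have hσ0' : 0 < |σ| := abs_pos.2 hσ0
  rw [mollify_add_sub φ hk]
  have hk' : Continuous fun x => k (x + σ • v) - k x := by fun_prop
  have h2 := abs_mollify_sub_le φ hk' (a := σ * a) (η := η * |σ|) (by positivity)
    (fun x hx => h x hx σ hσ)
  have h3 : σ⁻¹ • mollify φ (fun x => k (x + σ • v) - k x) u - a
      = σ⁻¹ * (mollify φ (fun x => k (x + σ • v) - k x) u - σ * a) := by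
    rw [smul_eq_mul, mul_sub, inv_mul_cancel_left₀ hσ0]
  rw [h3, abs_mul, abs_inv, inv_mul_le_iff₀ hσ0', mul_comm |σ|]
  exact h2

end Mollification

/-! ### The divergence identity beyond smooth cylindrical functions -/

section Core

variable {q : ℝ≥0∞} [Fact (1 ≤ q)]

theorem unitLq_apply (i : ℕ) : (unitLq q) i = if i = 0 then 1 else 0 := by
  simp [unitLq, Pi.single_apply]

/-- Points of the cone close to `y ≠ (1, 0, …)` in one well-chosen coordinate are far from
`(1, 0, …)`. -/
theorem exists_coord_away {y : Lq q} (hy : y ≠ unitLq q) : ∃ (i : ℕ) (κ : ℝ), 0 < κ ∧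
    ∀ z ∈ coneLq q, |z i - y i| ≤ κ → κ ≤ |z 0 - 1| ∨ κ ≤ z 1 := by
  obtain ⟨i, hi⟩ : ∃ i, y i ≠ unitLq q i := by
    by_contra! hcon
    exact hy (lp.ext (funext hcon))
  refine ⟨i, |y i - unitLq q i| / 2, half_pos (abs_pos.2 (sub_ne_zero.2 hi)), fun z hz hzi => ?_⟩
  have h1 : |y i - unitLq q i| / 2 ≤ |z i - unitLq q i| := by
    have := abs_sub_abs_le_abs_sub (y i - unitLq q i) (z i - unitLq q i)
    have h2 : y i - unitLq q i - (z i - unitLq q i) = -(z i - y i) := by ring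
    rw [h2, abs_neg] at this
    linarith
  rcases Nat.eq_zero_or_pos i with rfl | hpos
  · left
    simpa [unitLq_apply] using h1
  · right
    simp only [unitLq_apply, hpos.ne', if_false, sub_zero, abs_of_nonneg (hz.1 i)] at h1 ⊢
    exact h1.trans (coneLq_antitone hz le_rfl hpos)

namespace IsGrowthMeasure

variable {m : Measure (Lq q)} {α : ℝ} {L : ℝ≥0} {O : Set (Lq q)} {V : Lq q → Lq q}

variable (q) in
/-- The points whose first coordinates differ by at least `κ` from those of `(1, 0, …)`. -/
def awayLq (κ : ℝ) : Set (Lq q) := {z | κ ≤ |z 0 - 1| ∨ κ ≤ z 1}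

theorem measurableSet_awayLq (κ : ℝ) : MeasurableSet (awayLq q κ) :=
  ((isClosed_le continuous_const ((continuous_apply_Lq 0).sub continuous_const).abs).union
    (isClosed_le continuous_const (continuous_apply_Lq 1))).measurableSet

theorem integrableOn_norm (h : IsGrowthMeasure q m α L O V) {D : Set (Lq q)} (hD : m D < ⊤) :
    IntegrableOn (fun z => ‖V z‖) D m := by
  have : IsFiniteMeasure (m.restrict D) := ⟨by simpa using hD⟩
  have h2 : Integrable (fun z => 1 + ‖V z‖ ^ 2) (m.restrict D) := by
    refine (integrable_const 1).add ⟨?_, ?_⟩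
    · exact (h.aemeasurable.norm.pow_const 2).aestronglyMeasurable.restrict
    · rw [hasFiniteIntegral_iff_ofReal (Eventually.of_forall fun z => by positivity)]
      exact (setLIntegral_le_lintegral _ _).trans_lt h.sq_integrable
  refine h2.mono' h.aemeasurable.norm.aestronglyMeasurable.restrict
    (Eventually.of_forall fun z => ?_)
  rw [norm_norm]
  nlinarith [sq_nonneg (‖V z‖ - 1), norm_nonneg (V z)]

theorem unitLq_notMem_awayLq {κ : ℝ} (hκ : 0 < κ) : unitLq q ∉ awayLq q κ := by
  simp [awayLq, unitLq_apply, hκ]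

/-- The divergence identity for a Lipschitz function `H` supported near a point other than
`(1, 0, …)`, with strict directional derivative `g` along `V`. -/
theorem exists_integral_eq_of_strict_deriv (h : IsGrowthMeasure q m α L O V) {y : Lq q}
    (hy : y ≠ unitLq q)
    (hVapprox : ∀ z ∈ O, z ∈ m.support → z ≠ unitLq q → V z ∈ approxLq q) :
    ∃ ρ κ : ℝ, 0 < ρ ∧ 0 < κ ∧ (∀ z ∈ coneLq q, z ∈ Metric.ball y ρ → z ∈ awayLq q κ) ∧
      ∀ (H g : Lq q → ℝ) (K : ℝ≥0) (M : ℝ), LipschitzWith K H →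
      (∀ z, 0 ≤ H z) → (∀ z, H z ≤ M) → (∀ z ∉ Metric.ball y ρ, H z = 0) →
      (∀ z ∉ Metric.ball y ρ, g z = 0) →
      (∀ z ∈ O, ∀ η > 0, ∃ r > 0, ∀ z' ∈ Metric.ball z r, ∀ v ∈ Metric.ball (V z) r, ∀ σ : ℝ,
        |σ| < r → |H (z' + σ • v) - H z' - σ * g z| ≤ η * |σ|) →
      ∫ z, g z ∂m = α * ∫ z, H z ∂m := by
  obtain ⟨i, κ, hκ, hi⟩ := exists_coord_away hy
  refine ⟨κ / 2, κ, half_pos hκ, hκ, fun z hz hzy => hi z hz ?_, ?_⟩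
  · have := abs_apply_le_norm (z - y) i
    rw [lp.coeFn_sub, Pi.sub_apply] at this
    rw [mem_ball_iff_norm] at hzy
    linarith
  intro H g K M hHL hH0 hHM hHsupp hgsupp hder
  have hDfin : m (awayLq q κ) < ⊤ := h.finite_away κ hκ
  -- radii of the mollifiers
  set δ : ℕ → ℝ := fun n => min (κ / 4) (1 / ((n : ℝ) + 1)) / (‖embedLq q n‖ + 1) with hδ
  have hδ0 : ∀ n, 0 < δ n := fun n => by
    have : (0 : ℝ) < 1 / ((n : ℝ) + 1) := by positivity
    positivity
  let φ : ∀ n, ContDiffBump (0 : Fin n → ℝ) := fun n =>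
    ⟨δ n / 2, δ n, half_pos (hδ0 n), half_lt_self (hδ0 n)⟩
  have hball : ∀ (n : ℕ) (u x : Fin n → ℝ), x ∈ Metric.ball u (φ n).rOut →
      ‖embedLq q n x - embedLq q n u‖ ≤ min (κ / 4) (1 / ((n : ℝ) + 1)) := by
    intro n u x hx
    have hx' : ‖x - u‖ < δ n := by simpa [dist_eq_norm] using hx
    rw [← map_sub]
    have h1 : (0 : ℝ) ≤ min (κ / 4) (1 / ((n : ℝ) + 1)) := le_min (by positivity) (by positivity)
    calc ‖embedLq q n (x - u)‖ ≤ ‖embedLq q n‖ * ‖x - u‖ := (embedLq q n).le_opNorm _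
      _ ≤ (‖embedLq q n‖ + 1) * δ n := by gcongr; linarith
      _ = _ := by rw [hδ]; field_simp
  have hk : ∀ n, Continuous fun u => H (embedLq q n u) := fun n =>
    hHL.continuous.comp (embedLq q n).continuous
  have hzero : ∀ z, κ / 2 ≤ |z i - y i| → H z = 0 := by
    intro z hz
    refine hHsupp z fun hzy => ?_
    have := abs_apply_le_norm (z - y) i
    rw [lp.coeFn_sub, Pi.sub_apply] at this
    rw [mem_ball_iff_norm] at hzy
    linarith
  have hcpt : ∀ n, HasCompactSupport fun u => H (embedLq q n u) := by
    intro n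
    refine HasCompactSupport.intro (isCompact_closedBall (0 : Fin n → ℝ) (‖y‖ + κ)) fun u hu => ?_
    refine hHsupp _ fun hzy => hu ?_
    rw [mem_closedBall_zero_iff]
    refine (norm_le_norm_embedLq (q := q) n u).trans ?_
    rw [mem_ball_iff_norm] at hzy
    have := norm_le_norm_add_norm_sub' (embedLq q n u) y
    linarith
  set F : ∀ n, (Fin n → ℝ) → ℝ := fun n => mollify (φ n) fun u => H (embedLq q n u) with hF
  -- vanishing away from `y`
  have hfar : ∀ n, i < n → ∀ z ∈ coneLq q, z ∉ awayLq q κ →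
      ∀ x ∈ Metric.ball (coordsLq q n z) (φ n).rOut, 3 * κ / 4 ≤ |embedLq q n x i - y i| := by
    intro n hin z hz hzD x hx
    have h1 : κ < |z i - y i| := by
      by_contra hcon
      exact hzD (hi z hz (not_lt.1 hcon))
    have h2 := (abs_apply_le_norm (embedLq q n x - embedLq q n (coordsLq q n z)) i).trans
      ((hball n _ x hx).trans (min_le_left _ _))
    rw [lp.coeFn_sub, Pi.sub_apply, coordsLq_apply, embedLq_firstCoords_apply, if_pos hin] at h2
    have h3 := abs_sub_abs_le_abs_sub (z i - y i) (embedLq q n x i - y i)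
    have h4 : z i - y i - (embedLq q n x i - y i) = -(embedLq q n x i - z i) := by ring
    rw [h4, abs_neg] at h3
    linarith
  have hFfar : ∀ n, i < n → ∀ z ∈ coneLq q, z ∉ awayLq q κ → F n (coordsLq q n z) = 0 := by
    intro n hin z hz hzD
    have := abs_mollify_sub_le (φ n) (hk n) (u := coordsLq q n z) (a := 0) le_rfl
      fun x hx => by rw [hzero _ (by linarith [hfar n hin z hz hzD x hx])]; simp
    simpa using this
  have hF'far : ∀ n, i < n → ∀ z ∈ coneLq q, z ∉ awayLq q κ →
      fderiv ℝ (F n) (coordsLq q n z) (coordsLq q n (V z)) = 0 := by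
    intro n hin z hz hzD
    have := abs_fderiv_mollify_sub_le (φ n) (hk n) (u := coordsLq q n z)
      (v := coordsLq q n (V z)) (a := 0) (η := 0) (r := κ / 4 / (‖V z‖ + 1)) le_rfl
      (by positivity) fun x hx σ hσ => ?_
    · simpa using this
    · have h1 := hfar n hin z hz hzD x hx
      rw [lt_div_iff₀ (by positivity)] at hσ
      have h2 : |σ * V z i| ≤ κ / 4 := by
        rw [abs_mul]
        have := abs_apply_le_norm (V z) i
        nlinarith [abs_nonneg σ]
      have h3 : embedLq q n (x + σ • coordsLq q n (V z)) i = embedLq q n x i + σ * V z i := by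
        rw [map_add, map_smul, lp.coeFn_add, Pi.add_apply, lp.coeFn_smul, Pi.smul_apply,
          coordsLq_apply, embedLq_firstCoords_apply, if_pos hin, smul_eq_mul]
      have h4 : κ / 2 ≤ |embedLq q n (x + σ • coordsLq q n (V z)) i - y i| := by
        rw [h3]
        have h5 := abs_sub_abs_le_abs_sub (embedLq q n x i - y i) (-(σ * V z i))
        rw [abs_neg] at h5
        have h6 : embedLq q n x i - y i - -(σ * V z i) = embedLq q n x i + σ * V z i - y i := by
          ring
        rw [h6] at h5
        linarith
      rw [hzero _ h4, hzero _ (by linarith)]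
      simp
  -- Truncation does not increase the norm, so the Lipschitz constant of `H` serves for all `n`. The
  -- dominating function `K ‖V‖` is integrable on the set of finite measure away from `(1, 0, …)`,
  -- because `V ∈ L²`.
  have hF'le : ∀ n z, |fderiv ℝ (F n) (coordsLq q n z) (coordsLq q n (V z))| ≤ K * ‖V z‖ := by
    intro n z
    have := abs_fderiv_mollify_sub_le (φ n) (hk n) (u := coordsLq q n z)
      (v := coordsLq q n (V z)) (a := 0) (η := K * ‖V z‖) (r := 1) (by positivity)
      zero_lt_one fun x _ σ _ => ?_
    · simpa using this
    · have h1 := hHL.dist_le_mul (embedLq q n (x + σ • coordsLq q n (V z))) (embedLq q n x)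
      rw [Real.dist_eq, dist_eq_norm, map_add, add_sub_cancel_left, map_smul, norm_smul,
        Real.norm_eq_abs] at h1
      rw [mul_zero, sub_zero, map_add, map_smul]
      refine h1.trans ?_
      have := norm_embedLq_coordsLq_le n (V z)
      calc (K : ℝ) * (|σ| * ‖embedLq q n (coordsLq q n (V z))‖) ≤ K * (|σ| * ‖V z‖) := by gcongr
        _ = _ := by ring
  have hM : 0 ≤ M := (hH0 0).trans (hHM 0)
  have hFle : ∀ n u, |F n u| ≤ M := by
    intro n u
    have := abs_mollify_sub_le (φ n) (hk n) (u := u) (a := 0) hM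
      fun x _ => by rw [sub_zero, abs_of_nonneg (hH0 _)]; exact hHM _
    simpa using this
  have hFsmooth : ∀ n, ContDiff ℝ ∞ (F n) := fun n => contDiff_mollify (φ n) (hk n)
  have hFmeas : ∀ n, AEStronglyMeasurable (fun z => F n (coordsLq q n z)) m := fun n =>
    ((hFsmooth n).continuous.comp (coordsLq q n).continuous).measurable.aestronglyMeasurable
  have hbd : Integrable ((awayLq q κ).indicator fun _ => M) m := by
    rw [integrable_indicator_iff (measurableSet_awayLq κ)]
    exact integrableOn_const hDfin.ne
  have hbd' : Integrable ((awayLq q κ).indicator fun z => K * ‖V z‖) m := by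
    rw [integrable_indicator_iff (measurableSet_awayLq κ)]
    exact (h.integrableOn_norm hDfin).const_mul _
  have hdom : ∀ n, i < n → ∀ᵐ z ∂m, ‖F n (coordsLq q n z)‖ ≤
      (awayLq q κ).indicator (fun _ => M) z := by
    intro n hin
    filter_upwards [h.ae_cone] with z hz
    by_cases hzD : z ∈ awayLq q κ
    · rw [indicator_of_mem hzD]; exact hFle n _
    · rw [indicator_of_notMem hzD, hFfar n hin z hz hzD, norm_zero]
  have hdom' : ∀ n, i < n → ∀ᵐ z ∂m,
      ‖fderiv ℝ (F n) (coordsLq q n z) (coordsLq q n (V z))‖ ≤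
      (awayLq q κ).indicator (fun z => K * ‖V z‖) z := by
    intro n hin
    filter_upwards [h.ae_cone] with z hz
    by_cases hzD : z ∈ awayLq q κ
    · rw [indicator_of_mem hzD]; exact hF'le n _
    · rw [indicator_of_notMem hzD, hF'far n hin z hz hzD, norm_zero]
  have hident : ∀ n, i < n → ∫ z, fderiv ℝ (F n) (coordsLq q n z) (coordsLq q n (V z)) ∂m
      = α * ∫ z, F n (coordsLq q n z) ∂m := fun n hin =>
    h.divergence n (F n) (hFsmooth n) (hasCompactSupport_mollify (φ n) (hcpt n))
      (mollify_nonneg (φ n) fun u => hH0 _) (hbd.mono' (hFmeas n) (hdom n hin))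
  have hclose : ∀ z ∈ approxLq q, ∀ r > 0, ∀ᶠ n in atTop,
      ∀ x ∈ Metric.ball (coordsLq q n z) (φ n).rOut, embedLq q n x ∈ Metric.ball z r := by
    intro z hz r hr
    have h1 := (Metric.tendsto_nhds.1 hz) (r / 2) (half_pos hr)
    have h2 := (Metric.tendsto_nhds.1 (tendsto_one_div_add_atTop_nhds_zero_nat (𝕜 := ℝ))) (r / 2) (half_pos hr)
    filter_upwards [h1, h2] with n hn1 hn2 x hx
    have h3 := (hball n _ x hx).trans (min_le_right _ _)
    rw [Real.dist_eq, sub_zero, abs_of_pos (by positivity)] at hn2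
    rw [Metric.mem_ball]
    calc dist (embedLq q n x) z ≤ dist (embedLq q n x) (embedLq q n (coordsLq q n z))
          + dist (embedLq q n (coordsLq q n z)) z := dist_triangle _ _ _
      _ < r := by rw [dist_eq_norm (embedLq q n x)]; linarith
  have hlim : ∀ᵐ z ∂m, Tendsto (fun n => F n (coordsLq q n z)) atTop (𝓝 (H z)) := by
    filter_upwards [h.ae_approx] with z hz
    refine Metric.tendsto_nhds.2 fun η hη => ?_
    have hcont := Metric.continuous_iff.1 hHL.continuous z (η / 2) (half_pos hη)
    obtain ⟨r, hr, hr'⟩ := hcont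
    filter_upwards [hclose z hz r hr] with n hn
    exact (abs_mollify_sub_le (φ n) (hk n) (half_pos hη).le
      fun x hx => (hr' _ (hn x hx)).le).trans_lt (half_lt_self hη)
  -- The direction seen by `F n` is the truncation of `V z`. The derivative hypothesis is uniform
  -- over base points and directions near `(z, V z)`, so it is enough that these truncations
  -- converge, which is `hVapprox`.
  have hlim' : ∀ᵐ z ∂m, Tendsto (fun n => fderiv ℝ (F n) (coordsLq q n z)
      (coordsLq q n (V z))) atTop (𝓝 (g z)) := by
    filter_upwards [h.ae_approx, h.ae_cone, h.ae_mem, h.ae_support] with z hz hzc hzO hzs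
    by_cases hzD : z ∈ awayLq q κ
    · have hzu : z ≠ unitLq q := fun hh => unitLq_notMem_awayLq hκ (hh ▸ hzD)
      refine Metric.tendsto_nhds.2 fun η hη => ?_
      obtain ⟨r, hr, hr'⟩ := hder z hzO (η / 2) (half_pos hη)
      have h1 := (Metric.tendsto_nhds.1 (hVapprox z hzO hzs hzu)) r hr
      filter_upwards [hclose z hz r hr, h1] with n hn hn1
      refine (abs_fderiv_mollify_sub_le (φ n) (hk n) (half_pos hη).le hr
        fun x hx σ hσ => ?_).trans_lt (half_lt_self hη)
      rw [map_add, map_smul]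
      exact hr' _ (hn x hx) _ hn1 σ hσ
    · refine tendsto_const_nhds.congr' ?_
      filter_upwards [eventually_gt_atTop i] with n hn
      rw [hF'far n hn z hzc hzD, hgsupp z]
      exact fun hzy => hzD (hi z hzc (by
        have := abs_apply_le_norm (z - y) i
        rw [lp.coeFn_sub, Pi.sub_apply] at this
        rw [mem_ball_iff_norm] at hzy
        linarith))
  have hgt := eventually_gt_atTop i
  have t1 := tendsto_integral_filter_of_dominated_convergence _
    (Eventually.of_forall hFmeas) (hgt.mono hdom) hbd hlim
  have t2 := tendsto_integral_filter_of_dominated_convergence _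
    (Eventually.of_forall fun n => aestronglyMeasurable_fderiv h.aemeasurable (hFsmooth n))
    (hgt.mono hdom') hbd' hlim'
  refine tendsto_nhds_unique t2 ((t1.const_mul α).congr' ?_)
  filter_upwards [hgt] with n hn
  exact (hident n hn).symm

end IsGrowthMeasure

end Core

/-! ### For `q = ∞`, the coordinates of `V` vanish at infinity on the support -/

section Vanishing

variable {q : ℝ≥0∞} [Fact (1 ≤ q)]

namespace IsGrowthMeasure

variable {m : Measure (Lq q)} {α : ℝ} {L : ℝ≥0} {O : Set (Lq q)} {V : Lq q → Lq q}

/-- The restriction of the coordinates from `ℝᵖ` to `ℝⁿ`. -/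
noncomputable def restrictCoords {n p : ℕ} (hnp : n ≤ p) : (Fin p → ℝ) →L[ℝ] (Fin n → ℝ) :=
  ContinuousLinearMap.pi fun j => ContinuousLinearMap.proj (Fin.castLE hnp j)

theorem restrictCoords_coordsLq {n p : ℕ} (hnp : n ≤ p) (z : Lq q) :
    restrictCoords hnp (coordsLq q p z) = coordsLq q n z := rfl

theorem integrable_of_le (h : IsGrowthMeasure q m α L O V) {D : Set (Lq q)} (hD : m D < ⊤)
    (hDm : MeasurableSet D) {k : Lq q → ℝ} (hk : AEStronglyMeasurable k m) {C : ℝ}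
    (hle : ∀ᵐ z ∂m, |k z| ≤ C * (‖V z‖ + 1)) (hzero : ∀ᵐ z ∂m, z ∉ D → k z = 0) :
    Integrable k m := by
  have hbd : Integrable (D.indicator fun z => C * (‖V z‖ + 1)) m := by
    rw [integrable_indicator_iff hDm]
    exact ((h.integrableOn_norm hD).add (integrableOn_const hD.ne)).const_mul _
  refine hbd.mono' hk ?_
  filter_upwards [hle, hzero] with z h1 h2
  by_cases hz : z ∈ D
  · rwa [indicator_of_mem hz]
  · rw [indicator_of_notMem hz, h2 hz, norm_zero]

theorem exists_abs_fderiv_le {n : ℕ} {f : (Fin n → ℝ) → ℝ} (hf : ContDiff ℝ ∞ f)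
    (hfc : HasCompactSupport f) (V : Lq q → Lq q) : ∃ C : ℝ, 0 ≤ C ∧
    (∀ u, |f u| ≤ C) ∧ ∀ z, |fderiv ℝ f (coordsLq q n z) (coordsLq q n (V z))| ≤ C * ‖V z‖ := by
  obtain ⟨C, hC⟩ := (hfc.fderiv (𝕜 := ℝ)).exists_bound_of_continuous
    (hf.continuous_fderiv (by simp))
  obtain ⟨C', hC'⟩ := hfc.exists_bound_of_continuous hf.continuous
  have hCnn : 0 ≤ C := (norm_nonneg _).trans (hC 0)
  refine ⟨max C C', le_max_of_le_left hCnn, fun u => (hC' u).trans (le_max_right _ _),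
    fun z => ?_⟩
  have h1 : ‖coordsLq q n (V z)‖ ≤ ‖V z‖ :=
    (pi_norm_le_iff_of_nonneg (norm_nonneg _)).2 fun i => abs_apply_le_norm (V z) i
  calc |fderiv ℝ f (coordsLq q n z) (coordsLq q n (V z))|
      ≤ ‖fderiv ℝ f (coordsLq q n z)‖ * ‖coordsLq q n (V z)‖ :=
        (fderiv ℝ f (coordsLq q n z)).le_opNorm (coordsLq q n (V z))
    _ ≤ max C C' * ‖V z‖ := by
        gcongr
        exact (hC _).trans (le_max_left _ _)

/-- The divergence identity tested against `f(y₀, …, y_{n-1}) (R - y_i)`. -/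
theorem integral_mul_coord_eq (h : IsGrowthMeasure q m α L O V) {n : ℕ} {f : (Fin n → ℝ) → ℝ}
    (hf : ContDiff ℝ ∞ f) (hfc : HasCompactSupport f) (hf0 : ∀ u, 0 ≤ f u) {R : ℝ} (hR : 0 < R)
    {D : Set (Lq q)} (hD : m D < ⊤) (hDm : MeasurableSet D)
    (hfD : ∀ z ∈ coneLq q, coordsLq q n z ∈ tsupport f → z ∈ D)
    (hfR : ∀ z ∈ coneLq q, coordsLq q n z ∈ tsupport f → ∀ j, z j < R) {i : ℕ} (hi : n ≤ i) :
    ∫ z, f (coordsLq q n z) * V z i ∂m =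
      ∫ z, z i * (α * f (coordsLq q n z)
        - fderiv ℝ f (coordsLq q n z) (coordsLq q n (V z))) ∂m := by
  have hni : n ≤ i + 1 := by omega
  -- The cut-off gives the test function compact support without changing it near the relevant
  -- points of the cone. Since `X` vanishes outside the ball of radius `R + 1`, the factor `R + 1 -
  -- uᵢ` is nonnegative wherever `X` is not zero.
  let X : ContDiffBump (0 : Fin (i + 1) → ℝ) := ⟨R, R + 1, hR, by linarith⟩
  set r := restrictCoords hni with hr
  set F : (Fin (i + 1) → ℝ) → ℝ := fun u => f (r u) * X u * (R + 1 - u (Fin.last i)) with hF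
  set G : (Fin (i + 1) → ℝ) → ℝ := fun u => f (r u) * (R + 1 - u (Fin.last i)) with hG
  obtain ⟨C, hC0, hfC, hAC⟩ := exists_abs_fderiv_le hf hfc V
  set A : Lq q → ℝ := fun z => fderiv ℝ f (coordsLq q n z) (coordsLq q n (V z)) with hA
  have hFG : ∀ᵐ z ∂m, F =ᶠ[𝓝 (coordsLq q (i + 1) z)] G := by
    filter_upwards [h.ae_cone] with z hz
    by_cases hzf : coordsLq q n z ∈ tsupport f
    · have hzX : coordsLq q (i + 1) z ∈ Metric.ball 0 R := by
        rw [mem_ball_zero_iff, pi_norm_lt_iff hR]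
        intro j
        have := hfR z hz hzf j
        rwa [coordsLq_apply, firstCoords, Real.norm_of_nonneg (hz.1 _)]
      filter_upwards [Metric.isOpen_ball.mem_nhds hzX] with u hu
      have : X u = 1 := X.one_of_mem_closedBall (Metric.ball_subset_closedBall hu)
      simp [hF, hG, this]
    · have h1 : f =ᶠ[𝓝 (r (coordsLq q (i + 1) z))] 0 := notMem_tsupport_iff_eventuallyEq.1 hzf
      filter_upwards [r.continuous.continuousAt.eventually h1] with u hu
      simp only [hF, hG]
      rw [hu]
      simp
  have hder : ∀ z, fderiv ℝ G (coordsLq q (i + 1) z) (coordsLq q (i + 1) (V z))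
      = A z * (R + 1 - z i) - f (coordsLq q n z) * V z i := by
    intro z
    have h1 : HasFDerivAt (fun u => f (r u)) _ (coordsLq q (i + 1) z) :=
      ((hf.differentiable (by simp) _).hasFDerivAt).comp _ r.hasFDerivAt
    have h2 : HasFDerivAt (fun u : Fin (i + 1) → ℝ => R + 1 - u (Fin.last i)) _
        (coordsLq q (i + 1) z) :=
      ((ContinuousLinearMap.proj (R := ℝ) (φ := fun _ : Fin (i + 1) => ℝ)
        (Fin.last i)).hasFDerivAt).const_sub (R + 1)
    rw [show G = (fun u => f (r u)) * fun u => R + 1 - u (Fin.last i) from rfl, (h1.mul h2).fderiv]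
    have h3 : coordsLq q (i + 1) z (Fin.last i) = z i := rfl
    have h4 : coordsLq q (i + 1) (V z) (Fin.last i) = V z i := rfl
    simp only [add_apply, smul_apply, neg_apply,
      ContinuousLinearMap.comp_apply, ContinuousLinearMap.proj_apply, smul_eq_mul, h3, h4, hA,
      hr, restrictCoords_coordsLq]
    ring
  have hFc : HasCompactSupport F := (X.hasCompactSupport.mul_left).mul_right
  have hFs : ContDiff ℝ ∞ F := by
    have h1 : ContDiff ℝ ∞ fun u : Fin (i + 1) → ℝ => u (Fin.last i) := contDiff_apply _ _ _
    exact ((hf.comp r.contDiff).mul X.contDiff).mul (contDiff_const.sub h1)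
  have hF0 : ∀ u, 0 ≤ F u := by
    intro u
    by_cases hu : u ∈ Metric.ball (0 : Fin (i + 1) → ℝ) (R + 1)
    · refine mul_nonneg (mul_nonneg (hf0 _) X.nonneg) ?_
      have h1 := norm_le_pi_norm u (Fin.last i)
      rw [mem_ball_zero_iff] at hu
      have := (le_abs_self _).trans h1
      linarith
    · have : X u = 0 := X.zero_of_le_dist (by simpa [Metric.mem_ball] using hu)
      simp [hF, this]
  have hVm : ∀ j, AEMeasurable (fun z => V z j) m := fun j =>
    (continuous_apply_Lq j).measurable.comp_aemeasurable h.aemeasurable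
  have hfm : Measurable fun z => f (coordsLq q n z) :=
    (hf.continuous.comp (coordsLq q n).continuous).measurable
  have hAm : AEStronglyMeasurable A m := aestronglyMeasurable_fderiv h.aemeasurable hf
  have hzm : Measurable fun z : Lq q => z i := (continuous_apply_Lq i).measurable
  have hout : ∀ᵐ z ∂m, z ∉ D → f (coordsLq q n z) = 0 ∧ A z = 0 := by
    filter_upwards [h.ae_cone] with z hz hzD
    have h1 : coordsLq q n z ∉ tsupport f := fun hh => hzD (hfD z hz hh)
    refine ⟨image_eq_zero_of_notMem_tsupport h1, ?_⟩
    have h2 : fderiv ℝ f (coordsLq q n z) = 0 :=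
      image_eq_zero_of_notMem_tsupport fun hh => h1 (tsupport_fderiv_subset ℝ hh)
    simp only [hA, h2, zero_apply]
  have hzle : ∀ᵐ z ∂m, z ∈ D → (f (coordsLq q n z) = 0 ∧ A z = 0) ∨ |z i| ≤ R := by
    filter_upwards [h.ae_cone] with z hz _
    by_cases h1 : coordsLq q n z ∈ tsupport f
    · right
      rw [abs_of_nonneg (hz.1 i)]
      exact (hfR z hz h1 i).le
    · left
      refine ⟨image_eq_zero_of_notMem_tsupport h1, ?_⟩
      have h2 : fderiv ℝ f (coordsLq q n z) = 0 :=
        image_eq_zero_of_notMem_tsupport fun hh => h1 (tsupport_fderiv_subset ℝ hh)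
      simp only [hA, h2, zero_apply]
  set B : Lq q → ℝ := fun z => A z - α * f (coordsLq q n z) with hB
  have hBm : AEStronglyMeasurable B m := hAm.sub (hfm.const_mul α).aestronglyMeasurable
  have hfi : Integrable (fun z => f (coordsLq q n z)) m := by
    refine h.integrable_of_le hD hDm hfm.aestronglyMeasurable (C := C)
      (Eventually.of_forall fun z => ?_) (hout.mono fun z hz hzD => (hz hzD).1)
    have := hfC (coordsLq q n z)
    nlinarith [norm_nonneg (V z)]
  have hAi : Integrable A m := by
    refine h.integrable_of_le hD hDm hAm (C := C)
      (Eventually.of_forall fun z => ?_) (hout.mono fun z hz hzD => (hz hzD).2)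
    have := hAC z
    nlinarith [norm_nonneg (V z)]
  have hBi : Integrable B m := hAi.sub (hfi.const_mul α)
  have hBle : ∀ z, |B z| ≤ (C + |α| * C) * (‖V z‖ + 1) := by
    intro z
    have h1 := abs_sub (A z) (α * f (coordsLq q n z))
    rw [abs_mul] at h1
    have h2 := hAC z
    have h3 : |α| * |f (coordsLq q n z)| ≤ |α| * C := by gcongr; exact hfC _
    have h4 : 0 ≤ |α| * C := by positivity
    nlinarith [norm_nonneg (V z)]
  have hBzi : Integrable (fun z => B z * z i) m := by
    refine h.integrable_of_le hD hDm (hBm.mul hzm.aestronglyMeasurable)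
      (C := (C + |α| * C) * R) ?_ (hout.mono fun z hz hzD => ?_)
    · filter_upwards [hout, hzle] with z h1 h2
      by_cases hzD : z ∈ D
      · rcases h2 hzD with h3 | h3
        · rw [hB]
          simp only [h3.1, h3.2]
          simp only [mul_zero, sub_zero, zero_mul, abs_zero]
          positivity
        · rw [abs_mul]
          calc |B z| * |z i| ≤ ((C + |α| * C) * (‖V z‖ + 1)) * R :=
                mul_le_mul (hBle z) h3 (abs_nonneg _) (by positivity)
            _ = _ := by ring
      · rw [hB]
        simp only [h1 hzD]
        simp only [mul_zero, sub_zero, zero_mul, abs_zero]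
        positivity
    · rw [hB]
      simp [hz hzD]
  have hfVi : Integrable (fun z => f (coordsLq q n z) * V z i) m := by
    refine h.integrable_of_le hD hDm (hfm.aestronglyMeasurable.mul (hVm i).aestronglyMeasurable)
      (C := C) (Eventually.of_forall fun z => ?_) (hout.mono fun z hz hzD => ?_)
    · rw [abs_mul]
      calc |f (coordsLq q n z)| * |V z i| ≤ C * ‖V z‖ :=
            mul_le_mul (hfC _) (abs_apply_le_norm _ i) (abs_nonneg _) hC0
        _ ≤ C * (‖V z‖ + 1) := by gcongr; linarith
    · rw [(hz hzD).1, zero_mul]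
  have hFi : Integrable (fun z => F (coordsLq q (i + 1) z)) m := by
    have h1 : Integrable (fun z => (R + 1) * f (coordsLq q n z)
        - f (coordsLq q n z) * z i) m := by
      refine (hfi.const_mul _).sub ?_
      refine h.integrable_of_le hD hDm (hfm.aestronglyMeasurable.mul hzm.aestronglyMeasurable)
        (C := C * R) ?_ (hout.mono fun z hz hzD => by rw [(hz hzD).1, zero_mul])
      filter_upwards [hout, hzle] with z h1 h2
      by_cases hzD : z ∈ D
      · rcases h2 hzD with h3 | h3
        · rw [h3.1, zero_mul, abs_zero]; positivity
        · rw [abs_mul]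
          calc |f (coordsLq q n z)| * |z i| ≤ C * R :=
                mul_le_mul (hfC _) h3 (abs_nonneg _) hC0
            _ ≤ C * R * (‖V z‖ + 1) := le_mul_of_one_le_right (by positivity) (by simp)
      · rw [(h1 hzD).1, zero_mul, abs_zero]; positivity
    refine h1.congr ?_
    filter_upwards [hFG] with z hz
    rw [hz.eq_of_nhds]
    change _ = f (coordsLq q n z) * (R + 1 - z i)
    ring
  -- Subtracting `R + 1` times the identity for `f` removes the constant and leaves the terms in
  -- `zᵢ` and `Vᵢ` only.
  have key := h.divergence (i + 1) F hFs hFc hF0 hFi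
  have key0 := h.divergence n f hf hfc hf0 hfi
  have hEi : Integrable (fun z => (R + 1) * B z - B z * z i - f (coordsLq q n z) * V z i) m :=
    ((hBi.const_mul (R + 1)).sub hBzi).sub hfVi
  have e1 : ∫ z, fderiv ℝ F (coordsLq q (i + 1) z) (coordsLq q (i + 1) (V z)) ∂m
      = ∫ z, (((R + 1) * B z - B z * z i - f (coordsLq q n z) * V z i)
        + α * F (coordsLq q (i + 1) z)) ∂m := by
    refine integral_congr_ae ?_
    filter_upwards [hFG] with z hz
    rw [hz.fderiv_eq, hz.eq_of_nhds, hder]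
    change _ = _ + α * (f (coordsLq q n z) * (R + 1 - z i))
    simp only [hB]
    ring
  have hsub : Integrable (fun z => (R + 1) * B z - B z * z i) m := (hBi.const_mul (R + 1)).sub hBzi
  rw [e1, integral_add hEi (hFi.const_mul α), integral_const_mul, add_eq_right,
    integral_sub hsub hfVi, integral_sub (hBi.const_mul (R + 1)) hBzi,
    integral_const_mul] at key
  have hB0 : ∫ z, B z ∂m = 0 := by
    rw [hB, integral_sub hAi (hfi.const_mul α), integral_const_mul, sub_eq_zero]
    exact key0
  rw [hB0, mul_zero, zero_sub] at key
  have e2 : ∫ z, z i * (α * f (coordsLq q n z) - A z) ∂m = -∫ z, B z * z i ∂m := by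
    rw [← integral_neg]
    refine integral_congr_ae (Eventually.of_forall fun z => ?_)
    simp only [hB]
    ring
  change _ = ∫ z, z i * (α * f (coordsLq q n z) - A z) ∂m
  rw [e2]
  linarith

/-- Near `y`, `Vᵢ` is uniformly within `c/3` of `Vᵢ(y)`, so `Vᵢ(y)` is close to its mean against a
bump `f` at `y`. By `integral_mul_coord_eq` that mean is an integral of `zᵢ` against a fixed
integrable function, which tends to `0` by dominated convergence since `zᵢ → 0` on the cone. The
bump has positive mass because `y` is in the support. -/
theorem mem_approxLq_of_mem_support (h : IsGrowthMeasure q m α L O V) {y : Lq q} (hyO : y ∈ O)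
    (hys : y ∈ m.support) (hyu : y ≠ unitLq q) : V y ∈ approxLq q := by
  rcases ne_or_eq q ⊤ with hq | rfl
  · rw [approxLq_eq_univ hq]; trivial
  refine mem_approxLq_of_tendsto (Metric.tendsto_atTop.2 fun c hc => ?_)
  have hyc := h.support_subset_coneLq hys
  obtain ⟨i₀, κ, hκ, hi₀⟩ := exists_coord_away hyu
  obtain ⟨r, hr, hrV⟩ : ∃ r > 0, ∀ z ∈ Metric.ball y r, ‖V z - V y‖ ≤ c / 3 := by
    have h1 := (h.euler.lipschitz.continuousOn.continuousAt (h.euler.isOpen.mem_nhds hyO))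
    obtain ⟨r, hr, hr'⟩ := Metric.continuousAt_iff.1 h1 (c / 3) (by positivity)
    exact ⟨r, hr, fun z hz => by rw [← dist_eq_norm]; exact (hr' hz).le⟩
  -- On the cone a small coordinate `n ≥ 1` bounds all the later ones, so finitely many coordinates
  -- control the supremum norm. This makes a cylindrical bump supported, within the cone, in the
  -- ball of radius `r`. Taking `n ≥ i₀` also keeps that support away from `(1, 0, …)`.
  obtain ⟨N₀, hN₀⟩ := (Metric.tendsto_atTop.1 hyc.2.2) (r / 4) (by positivity)
  obtain ⟨n, hn1, hn2, hn3⟩ : ∃ n, N₀ ≤ n ∧ 1 ≤ n ∧ i₀ ≤ n :=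
    ⟨N₀ + 1 + i₀, by omega, by omega, by omega⟩
  set ρ := min (r / 4) κ with hρ
  have hρ0 : 0 < ρ := by positivity
  let f : ContDiffBump (coordsLq ⊤ (n + 1) y) := ⟨ρ / 2, ρ, half_pos hρ0, half_lt_self hρ0⟩
  have hcoord : ∀ z : Lq ⊤, coordsLq ⊤ (n + 1) z ∈ tsupport f → ∀ j ≤ n, |z j - y j| ≤ ρ := by
    intro z hz j hj
    rw [f.tsupport_eq, mem_closedBall_iff_norm] at hz
    exact (norm_le_pi_norm (coordsLq ⊤ (n + 1) z - coordsLq ⊤ (n + 1) y)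
      ⟨j, by omega⟩).trans hz
  have hall : ∀ z ∈ coneLq ⊤, coordsLq ⊤ (n + 1) z ∈ tsupport f → ∀ j, |z j - y j| ≤ r / 2 := by
    intro z hz hzf j
    have hρr : ρ ≤ r / 4 := min_le_left _ _
    rcases le_or_gt j n with hj | hj
    · exact (hcoord z hzf j hj).trans (by linarith)
    · have h1 := coneLq_antitone hz hn2 hj.le
      have h2 := coneLq_antitone hyc hn2 hj.le
      have h3 := (abs_le.1 (hcoord z hzf n le_rfl)).2
      have h4 := hN₀ n hn1
      rw [Real.dist_eq, sub_zero, abs_of_nonneg (hyc.1 n)] at h4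
      have h5 := hz.1 j
      have h6 := hyc.1 j
      rw [abs_le]
      constructor <;> linarith
  have hball : ∀ z ∈ coneLq ⊤, coordsLq ⊤ (n + 1) z ∈ tsupport f → z ∈ Metric.ball y r := by
    intro z hz hzf
    rw [mem_ball_iff_norm]
    exact (lp.norm_le_of_forall_le (half_pos hr).le (hall z hz hzf)).trans_lt (half_lt_self hr)
  have hD : m (awayLq ⊤ κ) < ⊤ := h.finite_away κ hκ
  have hDm := measurableSet_awayLq (q := ⊤) κ
  have hfD : ∀ z ∈ coneLq ⊤, coordsLq ⊤ (n + 1) z ∈ tsupport f → z ∈ awayLq ⊤ κ :=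
    fun z hz hzf => hi₀ z hz ((hcoord z hzf i₀ hn3).trans (min_le_right _ _))
  have hfR : ∀ z ∈ coneLq ⊤, coordsLq ⊤ (n + 1) z ∈ tsupport f → ∀ j, z j < ‖y‖ + r := by
    intro z hz hzf j
    have h1 := (abs_le.1 (hall z hz hzf j)).2
    have h2 := (le_abs_self _).trans (abs_apply_le_norm y j)
    linarith
  have hR : 0 < ‖y‖ + r := by positivity
  have hfs : ContDiff ℝ ∞ f := f.contDiff
  obtain ⟨C, hC0, hfC, hAC⟩ := exists_abs_fderiv_le hfs f.hasCompactSupport V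
  have hfm : Measurable fun z => f (coordsLq ⊤ (n + 1) z) :=
    (hfs.continuous.comp (coordsLq ⊤ (n + 1)).continuous).measurable
  have hf0 : ∀ z ∈ coneLq ⊤, z ∉ awayLq ⊤ κ → coordsLq ⊤ (n + 1) z ∉ tsupport f :=
    fun z hz hzD hh => hzD (hfD z hz hh)
  have hfder : ∀ z, coordsLq ⊤ (n + 1) z ∉ tsupport f →
      fderiv ℝ f (coordsLq ⊤ (n + 1) z) = 0 := fun z hz =>
    image_eq_zero_of_notMem_tsupport fun hh => hz (tsupport_fderiv_subset ℝ hh)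
  have hfi : Integrable (fun z => f (coordsLq ⊤ (n + 1) z)) m := by
    refine h.integrable_of_le hD hDm hfm.aestronglyMeasurable (C := C)
      (Eventually.of_forall fun z => ?_)
      (h.ae_cone.mono fun z hz hzD => image_eq_zero_of_notMem_tsupport (hf0 z hz hzD))
    have := hfC (coordsLq ⊤ (n + 1) z)
    nlinarith [norm_nonneg (V z)]
  have hfVi : ∀ i, Integrable (fun z => f (coordsLq ⊤ (n + 1) z) * V z i) m := by
    intro i
    refine h.integrable_of_le hD hDm (hfm.aestronglyMeasurable.mul
      ((continuous_apply_Lq i).measurable.comp_aemeasurable h.aemeasurable).aestronglyMeasurable)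
      (C := C) (Eventually.of_forall fun z => ?_) (h.ae_cone.mono fun z hz hzD => ?_)
    · rw [abs_mul]
      calc |f (coordsLq ⊤ (n + 1) z)| * |V z i| ≤ C * ‖V z‖ :=
            mul_le_mul (hfC _) (abs_apply_le_norm _ i) (abs_nonneg _) hC0
        _ ≤ C * (‖V z‖ + 1) := by gcongr; linarith
    · rw [image_eq_zero_of_notMem_tsupport (hf0 z hz hzD), zero_mul]
  set B : Lq ⊤ → ℝ := fun z => α * f (coordsLq ⊤ (n + 1) z)
    - fderiv ℝ f (coordsLq ⊤ (n + 1) z) (coordsLq ⊤ (n + 1) (V z)) with hB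
  have hBi : Integrable B m := by
    refine (hfi.const_mul α).sub ?_
    refine h.integrable_of_le hD hDm (aestronglyMeasurable_fderiv h.aemeasurable hfs) (C := C)
      (Eventually.of_forall fun z => ?_)
      (h.ae_cone.mono fun z hz hzD => by rw [hfder z (hf0 z hz hzD), zero_apply])
    have := hAC z
    nlinarith [norm_nonneg (V z)]
  have hident : ∀ i, n + 1 ≤ i →
      ∫ z, f (coordsLq ⊤ (n + 1) z) * V z i ∂m = ∫ z, z i * B z ∂m := fun i hi =>
    h.integral_mul_coord_eq hfs f.hasCompactSupport (fun _ => f.nonneg) hR hD hDm hfD hfR hi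
  have hlim : Tendsto (fun i => ∫ z, z i * B z ∂m) atTop (𝓝 0) := by
    have := tendsto_integral_of_dominated_convergence (F := fun i (z : Lq ⊤) => z i * B z)
      (f := fun _ => (0 : ℝ)) (fun z => (‖y‖ + r) * ‖B z‖) (μ := m)
      (fun i => (continuous_apply_Lq i).measurable.aestronglyMeasurable.mul
        hBi.aestronglyMeasurable) (hBi.norm.const_mul _) (fun i => ?_) ?_
    · simpa using this
    · filter_upwards [h.ae_cone] with z hz
      by_cases hzf : coordsLq ⊤ (n + 1) z ∈ tsupport f
      · rw [norm_mul, Real.norm_of_nonneg (hz.1 i)]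
        gcongr
        exact (hfR z hz hzf i).le
      · have : B z = 0 := by
          rw [hB]
          simp only [image_eq_zero_of_notMem_tsupport hzf, hfder z hzf, zero_apply]
          simp
        simp [this]
    · filter_upwards [h.ae_cone] with z hz
      simpa using hz.2.2.mul_const (B z)
  set I : ℝ := ∫ z, f (coordsLq ⊤ (n + 1) z) ∂m with hI
  have hI0 : 0 < I := by
    rw [hI, integral_pos_iff_support_of_nonneg (fun z => f.nonneg) hfi]
    refine (Measure.mem_support_iff_forall y).1 hys _ ?_
    have hc : Continuous fun z : Lq ⊤ => f (coordsLq ⊤ (n + 1) z) :=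
      hfs.continuous.comp (coordsLq ⊤ (n + 1)).continuous
    refine hc.isOpen_support.mem_nhds ?_
    rw [Function.mem_support]
    have : f (coordsLq ⊤ (n + 1) y) = 1 :=
      f.one_of_mem_closedBall (Metric.mem_closedBall_self (half_pos hρ0).le)
    rw [this]
    exact one_ne_zero
  obtain ⟨N₁, hN₁⟩ := (Metric.tendsto_atTop.1 hlim) (c / 3 * I) (by positivity)
  refine ⟨max N₁ (n + 1), fun i hi => ?_⟩
  have h1 := hN₁ i (le_of_max_le_left hi)
  rw [← hident i (le_of_max_le_right hi), Real.dist_eq, sub_zero] at h1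
  have h2 : |(∫ z, f (coordsLq ⊤ (n + 1) z) * V z i ∂m) - V y i * I| ≤ c / 3 * I := by
    rw [hI, ← integral_const_mul, ← integral_const_mul, ← integral_sub (hfVi i) (hfi.const_mul _),
      ← Real.norm_eq_abs]
    refine norm_integral_le_of_norm_le (hfi.const_mul _) ?_
    filter_upwards [h.ae_cone] with z hz
    have h3 : f (coordsLq ⊤ (n + 1) z) * V z i - V y i * f (coordsLq ⊤ (n + 1) z)
        = (V z i - V y i) * f (coordsLq ⊤ (n + 1) z) := by ring
    rw [h3, norm_mul, Real.norm_of_nonneg f.nonneg]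
    by_cases hzf : coordsLq ⊤ (n + 1) z ∈ tsupport f
    · gcongr
      · exact f.nonneg
      · exact (abs_apply_le_norm (V z - V y) i).trans (hrV z (hball z hz hzf))
    · rw [image_eq_zero_of_notMem_tsupport hzf]; simp
  rw [Real.dist_eq, sub_zero]
  have h4 : |V y i * I| < c * I := by
    have h5 := abs_sub_abs_le_abs_sub (V y i * I) (∫ z, f (coordsLq ⊤ (n + 1) z) * V z i ∂m)
    rw [abs_sub_comm (V y i * I)] at h5
    nlinarith
  rw [abs_mul, abs_of_pos hI0] at h4
  exact lt_of_mul_lt_mul_right h4 hI0.le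

end IsGrowthMeasure

end Vanishing

/-! ### Time averages along the flow -/

section Averaging

theorem norm_sub_smul_le_of_hasDerivAt {F : Type*} [NormedAddCommGroup F] [NormedSpace ℝ F]
    {f f' : ℝ → F} {a : F} {r η σ : ℝ} (hf : ∀ τ, HasDerivAt f (f' τ) τ)
    (hf' : ∀ τ, |τ| < r → ‖f' τ - a‖ ≤ η) (hσ : |σ| < r) :
    ‖f σ - f 0 - σ • a‖ ≤ η * |σ| := by
  have h1 := Convex.norm_image_sub_le_of_norm_hasDerivWithin_le (s := Metric.ball (0 : ℝ) r)
    (f := fun τ => f τ - τ • a) (f' := fun τ => f' τ - a) (C := η) (x := 0) (y := σ)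
    (fun τ _ => ((hf τ).sub (by simpa using (hasDerivAt_id τ).smul_const a)).hasDerivWithinAt)
    (fun τ hτ => hf' τ (by simpa using hτ)) (convex_ball _ _)
    (by simpa using (abs_nonneg σ).trans_lt hσ) (by simpa using hσ)
  simp only [zero_smul, sub_zero, Real.norm_eq_abs] at h1
  rwa [sub_right_comm] at h1

/-- The integral equation `u(0) - u(t) = α ∫₀ᵗ u` characterizes exponential decay. -/
theorem eq_exp_of_integral_eq {u : ℝ → ℝ} {α T : ℝ} (hu : ContinuousOn u (Icc 0 T))
    (h : ∀ t ∈ Icc 0 T, u 0 - u t = α * ∫ s in 0..t, u s) {t : ℝ} (ht : t ∈ Icc 0 T) :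
    u t = Real.exp (-(α * t)) * u 0 := by
  have hT : 0 ≤ T := ht.1.trans ht.2
  -- Extending `u` by constants makes its primitive differentiable at the end points too.
  set w : ℝ → ℝ := IccExtend hT ((Icc 0 T).domRestrict u) with hw
  have hwc : Continuous w := (continuousOn_iff_continuous_domRestrict.1 hu).Icc_extend'
  have hwu : EqOn w u (Icc 0 T) := fun s hs => IccExtend_of_mem hT _ hs
  have hder : ∀ s, HasDerivAt (fun s => ∫ x in 0..s, w x) (w s) s := fun s =>
    intervalIntegral.integral_hasDerivAt_right (hwc.intervalIntegrable _ _)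
      (hwc.stronglyMeasurableAtFilter _ _) hwc.continuousAt
  have hint : ∀ s ∈ Icc 0 T, w s = u 0 - α * ∫ x in 0..s, w x := by
    intro s hs
    have h1 : ∫ x in 0..s, w x = ∫ x in 0..s, u x := by
      refine intervalIntegral.integral_congr fun x hx => hwu ?_
      rw [uIcc_of_le hs.1] at hx
      exact ⟨hx.1, hx.2.trans hs.2⟩
    rw [h1, hwu hs, ← h s hs]
    ring
  have hder2 : ∀ s, HasDerivAt (fun s => Real.exp (α * s) * (u 0 - α * ∫ x in 0..s, w x))
      (Real.exp (α * s) * (α * 1) * (u 0 - α * ∫ x in 0..s, w x)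
        + Real.exp (α * s) * (-(α * w s))) s := fun s =>
    (((hasDerivAt_id s).const_mul α).exp).mul (((hder s).const_mul α).const_sub _)
  have hconst := constant_of_has_deriv_right_zero (a := 0) (b := T)
    (f := fun s => Real.exp (α * s) * (u 0 - α * ∫ x in 0..s, w x))
    (fun s _ => (hder2 s).continuousAt.continuousWithinAt) (fun s hs => by
      have := (hder2 s).hasDerivWithinAt (s := Ici s)
      rw [← hint s ⟨hs.1, hs.2.le⟩] at this
      convert this using 1
      ring) t ht
  simp only [mul_zero, Real.exp_zero, intervalIntegral.integral_same, sub_zero, one_mul] at hconst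
  rw [← hint t ht, hwu ht] at hconst
  rw [← hconst, ← mul_assoc, ← Real.exp_add]
  simp

variable {E : Type*} [NormedAddCommGroup E] [NormedSpace ℝ E] {L : ℝ≥0} {O : Set E} {V : E → E}
  {Φ : ℝ → E → E}

namespace IsBackwardFlow

/-- The time average of `k` along the orbits. -/
noncomputable def average (Φ : ℝ → E → E) (k : E → ℝ) (ε : ℝ) (z : E) : ℝ :=
  ∫ s in 0..ε, k (Φ s z)

theorem continuousAt_comp (h : IsBackwardFlow O V Φ) (hV : IsEulerInvariant L O V)
    {X : Type*} [TopologicalSpace X] {k : E → X} (hk : ContinuousOn k O) {z : E} (hz : z ∈ O)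
    (t : ℝ) : ContinuousAt (fun p : ℝ × E => k (Φ p.1 p.2)) (t, z) := by
  have hO : univ ×ˢ O ∈ 𝓝 (t, z) := (isOpen_univ.prod hV.isOpen).mem_nhds ⟨mem_univ _, hz⟩
  have h1 := (h.continuousOn hV.lipschitz).continuousAt hO
  exact ContinuousAt.comp (f := fun p : ℝ × E => Φ p.1 p.2) (g := k)
    (hk.continuousAt (hV.isOpen.mem_nhds (h.mem t z hz))) h1

/-- Moving the starting point along `V` is running `Φ` backwards, which shifts the averaging window;
by the fundamental theorem of calculus the derivative is `k - k∘Φ_ε`, for `k` only continuous. The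
straight step `z' + σv` differs from the orbit by a small multiple of `σ`, and the Lipschitz bound
on the average absorbs this difference. -/
theorem average_strict_deriv (h : IsBackwardFlow O V Φ) (hV : IsEulerInvariant L O V) {k : E → ℝ}
    {ε : ℝ} (hk : Continuous k) {K : ℝ≥0} (hK : LipschitzWith K (average Φ k ε)) {z : E}
    (hz : z ∈ O) {η : ℝ} (hη : 0 < η) : ∃ r > 0, ∀ z' ∈ Metric.ball z r,
      ∀ v ∈ Metric.ball (V z) r, ∀ σ : ℝ, |σ| < r →
        |average Φ k ε (z' + σ • v) - average Φ k ε z' - σ * (k z - k (Φ ε z))| ≤ η * |σ| := by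
  have hη' : 0 < η / (4 * (K + 1)) := by positivity
  obtain ⟨r₁, hr₁, h₁⟩ := Metric.continuousAt_iff.1
    (h.continuousAt_comp hV hV.lipschitz.continuousOn hz 0) _ hη'
  obtain ⟨r₂, hr₂, h₂⟩ := Metric.continuousAt_iff.1
    (h.continuousAt_comp hV hk.continuousOn hz 0) (η / 4) (by positivity)
  obtain ⟨r₃, hr₃, h₃⟩ := Metric.continuousAt_iff.1
    (h.continuousAt_comp hV hk.continuousOn hz ε) (η / 4) (by positivity)
  obtain ⟨r₄, hr₄, h₄⟩ := Metric.isOpen_iff.1 hV.isOpen z hz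
  set r := min (min r₁ r₂) (min (min r₃ r₄) (η / (4 * (K + 1)))) with hr
  have hr0 : 0 < r := by positivity
  have e1 : r ≤ r₁ := (min_le_left _ _).trans (min_le_left _ _)
  have e2 : r ≤ r₂ := (min_le_left _ _).trans (min_le_right _ _)
  have e3 : r ≤ r₃ := (min_le_right _ _).trans ((min_le_left _ _).trans (min_le_left _ _))
  have e4 : r ≤ r₄ := (min_le_right _ _).trans ((min_le_left _ _).trans (min_le_right _ _))
  have e5 : r ≤ η / (4 * (K + 1)) := (min_le_right _ _).trans (min_le_right _ _)
  refine ⟨r, hr0, fun z' hz' v hv σ hσ => ?_⟩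
  have hz'O : z' ∈ O := h₄ (Metric.ball_subset_ball e4 hz')
  have hdist : ∀ t₀ τ : ℝ, |τ| < r → ∀ r' ≥ r, dist (t₀ - τ, z') (t₀, z) < r' := by
    intro t₀ τ hτ r' hr'
    rw [Prod.dist_eq, max_lt_iff]
    refine ⟨?_, lt_of_lt_of_le hz' hr'⟩
    rw [Real.dist_eq]
    simpa using hτ.trans_le hr'
  -- displacement along the flow
  have hA : ‖Φ (-σ) z' - z' - σ • v‖ ≤ (η / (2 * (K + 1))) * |σ| := by
    have hd : ∀ τ, HasDerivAt (fun τ => Φ (-τ) z') (V (Φ (-τ) z')) τ := fun τ => by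
      simpa using h.reverse.hasDerivAt z' hz'O τ
    have := norm_sub_smul_le_of_hasDerivAt (a := v) (r := r) (η := η / (2 * (K + 1))) hd
      (fun τ hτ => ?_) hσ
    · simpa [h.zero] using this
    · have h5 := h₁ (by simpa using hdist 0 τ hτ r₁ e1 : dist ((-τ : ℝ), z') ((0 : ℝ), z) < r₁)
      simp only [h.zero] at h5
      rw [← dist_eq_norm]
      have h6 : dist (V z) v < η / (4 * (K + 1)) := by
        rw [dist_comm]; exact lt_of_lt_of_le hv e5
      have h7 : η / (2 * (K + 1)) = η / (4 * (K + 1)) + η / (4 * (K + 1)) := by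
        field_simp; norm_num
      rw [h7]
      exact (dist_triangle _ (V z) _).trans (add_le_add h5.le h6.le)
  have hA' : |average Φ k ε (z' + σ • v) - average Φ k ε (Φ (-σ) z')| ≤ η / 2 * |σ| := by
    have h5 := hK.dist_le_mul (z' + σ • v) (Φ (-σ) z')
    rw [Real.dist_eq, dist_comm (z' + σ • v), dist_eq_norm, ← sub_sub] at h5
    refine h5.trans ?_
    calc (K : ℝ) * ‖Φ (-σ) z' - z' - σ • v‖ ≤ K * ((η / (2 * (K + 1))) * |σ|) := by gcongr
      _ = (K / (K + 1)) * (η / 2 * |σ|) := by field_simp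
      _ ≤ 1 * (η / 2 * |σ|) := by
        gcongr
        rw [div_le_one (by positivity)]
        linarith
      _ = _ := one_mul _
  -- the average at the displaced point
  have hB : |average Φ k ε (Φ (-σ) z') - average Φ k ε z' - σ * (k z - k (Φ ε z))|
      ≤ η / 2 * |σ| := by
    set p : ℝ → ℝ := fun t => k (Φ t z') with hp
    have hpc : Continuous p := hk.comp (h.continuous_time z')
    have hQ : ∀ s, HasDerivAt (fun s => ∫ x in 0..s, p x) (p s) s := fun s =>
      intervalIntegral.integral_hasDerivAt_right (hpc.intervalIntegrable _ _)
        (hpc.stronglyMeasurableAtFilter _ _) hpc.continuousAt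
    -- By the group law, the average from the displaced point is the integral along the same orbit
    -- over the window from `-τ` to `ε - τ`.
    have hshift : ∀ τ, average Φ k ε (Φ (-τ) z')
        = (∫ x in 0..(ε - τ), p x) - ∫ x in 0..(-τ), p x := by
      intro τ
      rw [intervalIntegral.integral_interval_sub_left (hpc.intervalIntegrable _ _)
        (hpc.intervalIntegrable _ _)]
      have := intervalIntegral.integral_comp_add_right (a := 0) (b := ε) p (-τ)
      rw [zero_add, ← sub_eq_add_neg] at this
      rw [← this, average]
      refine intervalIntegral.integral_congr fun s _ => ?_
      simp only [hp, h.add hV.lipschitz]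
    have hd : ∀ τ, HasDerivAt (fun τ => average Φ k ε (Φ (-τ) z')) (p (-τ) - p (ε - τ)) τ := by
      intro τ
      have h5 := (hQ (ε - τ)).comp τ ((hasDerivAt_id τ).const_sub ε)
      have h6 := (hQ (-τ)).comp τ (hasDerivAt_neg τ)
      have h7 := h5.sub h6
      rw [funext hshift]
      exact h7.congr_deriv (by ring)
    have := norm_sub_smul_le_of_hasDerivAt (a := k z - k (Φ ε z)) (r := r) (η := η / 2) hd
      (fun τ hτ => ?_) hσ
    · simpa [h.zero] using this
    · have h5 := h₂ (by simpa using hdist 0 τ hτ r₂ e2 : dist ((-τ : ℝ), z') ((0 : ℝ), z) < r₂)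
      have h6 := h₃ (hdist ε τ hτ r₃ e3)
      simp only [h.zero, Real.dist_eq] at h5 h6
      rw [Real.norm_eq_abs]
      have h7 : p (-τ) - p (ε - τ) - (k z - k (Φ ε z))
          = (p (-τ) - k z) - (p (ε - τ) - k (Φ ε z)) := by ring
      rw [h7]
      refine (abs_sub _ _).trans ?_
      have h8 : |p (-τ) - k z| < η / 4 := h5
      have h9 : |p (ε - τ) - k (Φ ε z)| < η / 4 := h6
      linarith
  calc |average Φ k ε (z' + σ • v) - average Φ k ε z' - σ * (k z - k (Φ ε z))|
      = |(average Φ k ε (z' + σ • v) - average Φ k ε (Φ (-σ) z'))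
        + (average Φ k ε (Φ (-σ) z') - average Φ k ε z' - σ * (k z - k (Φ ε z)))| := by
        congr 1; ring
    _ ≤ _ := abs_add_le _ _
    _ ≤ η / 2 * |σ| + η / 2 * |σ| := add_le_add hA' hB
    _ = η * |σ| := by ring

/-- Near a point of `O`, the orbits are uniformly controlled for a short time. -/
theorem exists_local_control (h : IsBackwardFlow O V Φ) (hV : IsEulerInvariant L O V) {y : E}
    (hy : y ∈ O) {ρ : ℝ} (hρ : 0 < ρ) : ∃ R T : ℝ, 0 < R ∧ 0 < T ∧ 2 * R ≤ ρ ∧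
      Metric.ball y (4 * R) ⊆ O ∧
      ∀ s, |s| ≤ T → ∀ w, Φ s w ∈ Metric.ball y R → w ∈ Metric.ball y (2 * R) := by
  obtain ⟨r, hr, hball⟩ := Metric.isOpen_iff.1 hV.isOpen y hy
  set R := min (r / 4) (ρ / 2) with hR
  have hR0 : 0 < R := by positivity
  have hR1 : R ≤ r / 4 := min_le_left _ _
  have hR2 : R ≤ ρ / 2 := min_le_right _ _
  have h4R : Metric.ball y (4 * R) ⊆ O := (Metric.ball_subset_ball (by linarith)).trans hball
  -- `M` bounds the speed on the ball of radius `R`; within time `T ≤ 1`, an orbit through that ball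
  -- has speed at most `M exp(L)` and so moves by at most `R`.
  set M := ‖V y‖ + L * R with hM
  have hM0 : 0 ≤ M := by positivity
  set T := min 1 (R / (M * Real.exp L + 1)) with hT
  have hT0 : 0 < T := by positivity
  refine ⟨R, T, hR0, hT0, by linarith, h4R, fun s hs w hw => ?_⟩
  have hwO : Φ s w ∈ O := h4R (Metric.ball_subset_ball (by linarith) hw)
  have hVw : ‖V (Φ s w)‖ ≤ M := by
    have h1 := hV.lipschitz.dist_le_mul _ hwO _ hy
    rw [dist_eq_norm] at h1
    have h2 : (L : ℝ) * dist (Φ s w) y ≤ L * R := by gcongr; exact (Metric.mem_ball.1 hw).le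
    have h3 := norm_le_norm_add_norm_sub' (V (Φ s w)) (V y)
    linarith
  have h1 := h.dist_apply_le hV.lipschitz hwO (s := -s) (t := 0) (T := 1)
    (by rw [abs_neg]; exact hs.trans (min_le_left _ _)) (by simp)
  rw [h.neg_apply hV.lipschitz, h.zero, sub_zero, abs_neg, mul_one] at h1
  have h2 : ‖V (Φ s w)‖ * Real.exp L * |s| ≤ R := by
    have h3 : |s| ≤ R / (M * Real.exp L + 1) := hs.trans (min_le_right _ _)
    rw [le_div_iff₀ (by positivity)] at h3
    have h4 : ‖V (Φ s w)‖ * Real.exp L * |s| ≤ M * Real.exp L * |s| := by gcongr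
    nlinarith [abs_nonneg s]
  have h5 := dist_triangle w (Φ s w) y
  rw [Metric.mem_ball] at hw ⊢
  linarith

theorem lipschitzWith_average (h : IsBackwardFlow O V Φ) (hV : IsEulerInvariant L O V) {y : E}
    {R T : ℝ} (hR : 0 < R) (hO : Metric.ball y (4 * R) ⊆ O)
    (hctl : ∀ s, |s| ≤ T → ∀ w, Φ s w ∈ Metric.ball y R → w ∈ Metric.ball y (2 * R))
    {k : E → ℝ} {K : ℝ≥0} (hkL : LipschitzWith K k) (hk0 : ∀ w, 0 ≤ k w) (hk1 : ∀ w, k w ≤ 1)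
    (hk : ∀ w ∉ Metric.ball y R, k w = 0) {ε : ℝ} (hε : ε ∈ Icc 0 T) :
    ∃ K', LipschitzWith K' (average Φ k ε) := by
  have hzero : ∀ z ∉ Metric.ball y (2 * R), average Φ k ε z = 0 := by
    intro z hz
    rw [average, intervalIntegral.integral_congr (g := fun _ => 0), intervalIntegral.integral_zero]
    intro s hs
    rw [uIcc_of_le hε.1] at hs
    exact hk _ fun hh => hz (hctl s (by rw [abs_of_nonneg hs.1]; exact hs.2.trans hε.2) z hh)
  have hle : ∀ z, |average Φ k ε z| ≤ ε := by
    intro z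
    have := intervalIntegral.norm_integral_le_of_norm_le_const (a := 0) (b := ε) (C := 1)
      (f := fun s => k (Φ s z)) fun s _ => by
        rw [Real.norm_of_nonneg (hk0 _)]; exact hk1 _
    simpa [average, abs_of_nonneg hε.1] using this
  have hOlip : ∀ z ∈ O, ∀ w ∈ O,
      |average Φ k ε z - average Φ k ε w| ≤ K * Real.exp (L * ε) * ε * dist z w := by
    intro z hz w hw
    have hint : ∀ z, IntervalIntegrable (fun s => k (Φ s z)) volume 0 ε := fun z =>
      (hkL.continuous.comp (h.continuous_time z)).intervalIntegrable _ _
    rw [average, average, ← intervalIntegral.integral_sub (hint z) (hint w)]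
    have := intervalIntegral.norm_integral_le_of_norm_le_const (a := 0) (b := ε)
      (C := K * Real.exp (L * ε) * dist z w) (f := fun s => k (Φ s z) - k (Φ s w)) fun s hs => ?_
    · rw [sub_zero, abs_of_nonneg hε.1, Real.norm_eq_abs] at this
      linarith
    · rw [uIoc_of_le hε.1] at hs
      have h1 := hkL.dist_le_mul (Φ s z) (Φ s w)
      have h2 := h.dist_le hV.lipschitz hz hw s
      rw [abs_of_nonneg hs.1.le] at h2
      have h3 : Real.exp (L * s) ≤ Real.exp (L * ε) := by
        have := hs.2
        gcongr
      rw [← dist_eq_norm]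
      calc dist (k (Φ s z)) (k (Φ s w)) ≤ K * dist (Φ s z) (Φ s w) := h1
        _ ≤ K * (dist z w * Real.exp (L * ε)) := by
          gcongr
          exact h2.trans (by gcongr)
        _ = _ := by ring
  -- The flow is Lipschitz only inside `O`, whence the first term. For the second, a point outside
  -- the ball of radius `4R` is at distance at least `2R` from the ball of radius `2R` outside which
  -- the average vanishes, and the average is at most `ε`.
  set C : ℝ := K * Real.exp (L * ε) * ε + ε / (2 * R) with hC
  have hε0 := hε.1
  have hC0 : 0 ≤ C := by positivity
  have hC1 : K * Real.exp (L * ε) * ε ≤ C := by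
    have : 0 ≤ ε / (2 * R) := by positivity
    linarith
  have hC2 : ε / (2 * R) ≤ C := by
    have : 0 ≤ K * Real.exp (L * ε) * ε := by positivity
    linarith
  have main : ∀ z ∈ Metric.ball y (2 * R), ∀ w,
      dist (average Φ k ε z) (average Φ k ε w) ≤ C * dist z w := by
    intro z hz w
    rw [Real.dist_eq]
    have hzO : z ∈ O := hO (Metric.ball_subset_ball (by linarith) hz)
    by_cases hw : w ∈ Metric.ball y (4 * R)
    · refine (hOlip z hzO w (hO hw)).trans ?_
      gcongr
    · rw [hzero w fun hh => hw (Metric.ball_subset_ball (by linarith) hh), sub_zero]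
      have h1 : 2 * R ≤ dist z w := by
        have := dist_triangle w z y
        rw [Metric.mem_ball] at hz hw
        rw [dist_comm z w]
        linarith
      calc |average Φ k ε z| ≤ ε := hle z
        _ = ε / (2 * R) * (2 * R) := by field_simp
        _ ≤ C * dist z w := by gcongr
  refine ⟨⟨C, hC0⟩, LipschitzWith.of_dist_le_mul fun z w => ?_⟩
  by_cases hz : z ∈ Metric.ball y (2 * R)
  · exact main z hz w
  · by_cases hw : w ∈ Metric.ball y (2 * R)
    · rw [dist_comm, dist_comm z w]; exact main w hw z
    · rw [hzero z hz, hzero w hw, dist_self]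
      exact mul_nonneg hC0 dist_nonneg

end IsBackwardFlow

end Averaging

/-! ### Short-time scaling of the measure near a point other than `(1, 0, …)` -/

section LocalScaling

theorem IsBackwardFlow.measurable_comp {E : Type*} [NormedAddCommGroup E] [NormedSpace ℝ E]
    [MeasurableSpace E] [BorelSpace E] {L : ℝ≥0} {O : Set E} {V : E → E} {Φ : ℝ → E → E}
    (h : IsBackwardFlow O V Φ) (hL : LipschitzOnWith L V O) (hO : IsOpen O) {k : E → ℝ}
    (hk : Continuous k) : Measurable fun p : ℝ × E => k (Φ p.1 p.2) := by
  classical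
  have h1 := ContinuousOn.measurable_piecewise (s := (univ ×ˢ O : Set (ℝ × E)))
    (f := fun p => k (Φ p.1 p.2)) (g := fun p => k p.2) (hk.comp_continuousOn (h.continuousOn hL))
    (by fun_prop) (isOpen_univ.prod hO).measurableSet
  convert h1 using 1
  funext p
  by_cases hp : p.2 ∈ O
  · simp [Set.piecewise, hp]
  · simp [Set.piecewise, hp, h.off _ _ hp]

variable {q : ℝ≥0∞} [Fact (1 ≤ q)]

theorem unitLq_mem_coneLq : unitLq q ∈ coneLq q := by
  refine ⟨fun i => ?_, fun i hi => ?_, ?_⟩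
  · rw [unitLq_apply]; split_ifs <;> norm_num
  · rw [unitLq_apply, unitLq_apply, if_neg (by omega), if_neg (by omega)]
  · refine tendsto_const_nhds.congr' ?_
    filter_upwards [eventually_ge_atTop 1] with i hi
    rw [unitLq_apply, if_neg (by omega)]

/-- The tent functions approximating the indicator of the open set `W` from below. -/
noncomputable def tent {X : Type*} [PseudoMetricSpace X] (W : Set X) (j : ℕ) (z : X) : ℝ :=
  min 1 (j * Metric.infDist z Wᶜ)

section Tent

variable {X : Type*} [PseudoMetricSpace X] {W : Set X}

theorem tent_nonneg (j : ℕ) (z : X) : 0 ≤ tent W j z :=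
  le_min zero_le_one (mul_nonneg j.cast_nonneg Metric.infDist_nonneg)

theorem tent_le_one (j : ℕ) (z : X) : tent W j z ≤ 1 := min_le_left _ _

theorem tent_of_notMem (j : ℕ) {z : X} (hz : z ∉ W) : tent W j z = 0 := by
  rw [tent, Metric.infDist_zero_of_mem hz, mul_zero, min_eq_right zero_le_one]

theorem lipschitzWith_tent (j : ℕ) : LipschitzWith j (tent W j) := by
  have h1 : LipschitzWith j fun z => (j : ℝ) * Metric.infDist z Wᶜ := by
    refine LipschitzWith.of_dist_le_mul fun a b => ?_
    have := (Metric.lipschitz_infDist_pt Wᶜ).dist_le_mul a b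
    rw [Real.dist_eq, ← mul_sub, abs_mul, ← Real.dist_eq, Nat.abs_cast]
    simpa using mul_le_mul_of_nonneg_left this j.cast_nonneg
  exact h1.const_min 1

theorem tendsto_tent (hW : IsOpen W) (hne : Wᶜ.Nonempty) (z : X) :
    Tendsto (fun j => tent W j z) atTop (𝓝 (W.indicator (fun _ => 1) z)) := by
  by_cases hz : z ∈ W
  · rw [indicator_of_mem hz]
    have hpos : 0 < Metric.infDist z Wᶜ :=
      (hW.isClosed_compl.notMem_iff_infDist_pos hne).1 (fun h => h hz)
    refine tendsto_const_nhds.congr' ?_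
    filter_upwards [(tendsto_natCast_atTop_atTop (R := ℝ)).eventually_ge_atTop
      (1 / Metric.infDist z Wᶜ)] with j hj
    rw [tent, min_eq_left]
    rwa [div_le_iff₀ hpos] at hj
  · rw [indicator_of_notMem hz]
    exact tendsto_const_nhds.congr fun j => (tent_of_notMem j hz).symm

end Tent

namespace IsGrowthMeasure

variable {m : Measure (Lq q)} {α : ℝ} {L : ℝ≥0} {O : Set (Lq q)} {V : Lq q → Lq q}
  {Φ : ℝ → Lq q → Lq q}

theorem exists_measure_ball_lt_top (h : IsGrowthMeasure q m α L O V) {y : Lq q}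
    (hy : y ≠ unitLq q) : ∃ ρ > 0, m (Metric.ball y ρ) < ⊤ := by
  obtain ⟨i, κ, hκ, hi⟩ := exists_coord_away hy
  refine ⟨κ, hκ, lt_of_le_of_lt (measure_mono_ae ?_) (h.finite_away κ hκ)⟩
  filter_upwards [h.ae_cone] with z hz hzy
  refine hi z hz ?_
  have := abs_apply_le_norm (z - y) i
  rw [lp.coeFn_sub, Pi.sub_apply] at this
  have h2 : ‖z - y‖ < κ := mem_ball_iff_norm.1 hzy
  linarith

/-- The divergence identity for the time average of `k`, combined with Fubini on a ball of finite
measure that contains all the supports, gives `u(0) - u(ε) = α ∫₀^ε u` for `u(s) = ∫ k∘Φₛ dm`. -/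
theorem integral_comp_flow (h : IsGrowthMeasure q m α L O V) (hΦ : IsBackwardFlow O V Φ)
    {y : Lq q} {R T ρ : ℝ} (hR : 0 < R) (hρ : 2 * R ≤ ρ)
    (hball : Metric.ball y (4 * R) ⊆ O) (hfin : m (Metric.ball y ρ) < ⊤)
    (hctl : ∀ s, |s| ≤ T → ∀ w, Φ s w ∈ Metric.ball y R → w ∈ Metric.ball y (2 * R))
    (hcore : ∀ (H g : Lq q → ℝ) (K : ℝ≥0) (M : ℝ), LipschitzWith K H →
      (∀ z, 0 ≤ H z) → (∀ z, H z ≤ M) → (∀ z ∉ Metric.ball y ρ, H z = 0) →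
      (∀ z ∉ Metric.ball y ρ, g z = 0) →
      (∀ z ∈ O, ∀ η > 0, ∃ r > 0, ∀ z' ∈ Metric.ball z r, ∀ v ∈ Metric.ball (V z) r, ∀ σ : ℝ,
        |σ| < r → |H (z' + σ • v) - H z' - σ * g z| ≤ η * |σ|) →
      ∫ z, g z ∂m = α * ∫ z, H z ∂m)
    {k : Lq q → ℝ} {K : ℝ≥0} (hkL : LipschitzWith K k) (hk0 : ∀ w, 0 ≤ k w) (hk1 : ∀ w, k w ≤ 1)
    (hk : ∀ w ∉ Metric.ball y R, k w = 0) {t : ℝ} (ht : t ∈ Icc 0 T) :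
    ∫ z, k (Φ t z) ∂m = Real.exp (-(α * t)) * ∫ z, k z ∂m := by
  set D := Metric.ball y (2 * R) with hD
  have hDρ : D ⊆ Metric.ball y ρ := Metric.ball_subset_ball hρ
  have hDfin : m D < ⊤ := (measure_mono hDρ).trans_lt hfin
  have : IsFiniteMeasure (m.restrict D) := ⟨by simpa using hDfin⟩
  have hV := h.euler
  have hL := hV.lipschitz
  have hmeas : Measurable fun p : ℝ × Lq q => k (Φ p.1 p.2) :=
    hΦ.measurable_comp hL hV.isOpen hkL.continuous
  have hmt : ∀ s, Measurable fun z => k (Φ s z) := fun s =>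
    hmeas.comp (measurable_const.prodMk measurable_id)
  have hzero : ∀ s, |s| ≤ T → ∀ z ∉ D, k (Φ s z) = 0 := fun s hs z hz =>
    hk _ fun hh => hz (hctl s hs z hh)
  have habs : ∀ w, ‖k w‖ ≤ 1 := fun w => by
    rw [Real.norm_eq_abs, abs_of_nonneg (hk0 w)]; exact hk1 w
  set u : ℝ → ℝ := fun s => ∫ z in D, k (Φ s z) ∂m with hu
  have hT : (0 : ℝ) ≤ T := ht.1.trans ht.2
  have hIcc : ∀ s ∈ Icc 0 T, |s| ≤ T := fun s hs => by rw [abs_of_nonneg hs.1]; exact hs.2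
  have hu_eq : ∀ s ∈ Icc 0 T, ∫ z, k (Φ s z) ∂m = u s := fun s hs =>
    (setIntegral_eq_integral_of_forall_compl_eq_zero fun z hz => hzero s (hIcc s hs) z hz).symm
  have huc : Continuous u := by
    refine continuous_of_dominated (bound := fun _ => 1) (fun s => (hmt s).aestronglyMeasurable)
      (fun s => ae_of_all _ fun z => habs _) (integrable_const _) (ae_of_all _ fun z => ?_)
    exact hkL.continuous.comp (hΦ.continuous_time z)
  have hint : ∀ s, Integrable (fun z => k (Φ s z)) (m.restrict D) := fun s =>
    (integrable_const (1 : ℝ)).mono' (hmt s).aestronglyMeasurable (ae_of_all _ fun z => habs _)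
  have heq : ∀ ε ∈ Icc 0 T, u 0 - u ε = α * ∫ s in 0..ε, u s := by
    intro ε hε
    obtain ⟨K', hK'⟩ := hΦ.lipschitzWith_average hV hR hball hctl hkL hk0 hk1 hk hε
    have hsub : ∀ s ∈ uIcc 0 ε, s ∈ Icc 0 T := fun s hs => by
      rw [uIcc_of_le hε.1] at hs; exact ⟨hs.1, hs.2.trans hε.2⟩
    have hA0 : ∀ z ∉ D, IsBackwardFlow.average Φ k ε z = 0 := by
      intro z hz
      rw [IsBackwardFlow.average, intervalIntegral.integral_congr (g := fun _ => 0),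
        intervalIntegral.integral_zero]
      exact fun s hs => hzero s (hIcc s (hsub s hs)) z hz
    have h1 := hcore (IsBackwardFlow.average Φ k ε) (fun z => k z - k (Φ ε z)) K' ε hK'
      (fun z => intervalIntegral.integral_nonneg hε.1 fun s _ => hk0 _)
      (fun z => by
        have := intervalIntegral.integral_mono_on (a := 0) (b := ε) (μ := volume)
          (f := fun s => k (Φ s z)) (g := fun _ => 1) hε.1
          ((hkL.continuous.comp (hΦ.continuous_time z)).intervalIntegrable _ _)
          (continuous_const.intervalIntegrable _ _) (fun s _ => hk1 _)
        simpa [IsBackwardFlow.average] using this)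
      (fun z hz => hA0 z fun hh => hz (hDρ hh))
      (fun z hz => by
        have hzD : z ∉ D := fun hh => hz (hDρ hh)
        have := hzero 0 (by simpa using hT) z hzD
        rw [hΦ.zero] at this
        rw [this, hzero ε (hIcc ε hε) z hzD, sub_zero])
      (fun z hz η hη => hΦ.average_strict_deriv hV hkL.continuous hK' hz hη)
    have h2 : ∫ z, (k z - k (Φ ε z)) ∂m = u 0 - u ε := by
      rw [← setIntegral_eq_integral_of_forall_compl_eq_zero (s := D), hu]
      · simp only [hΦ.zero]
        rw [integral_sub]
        · simpa [hΦ.zero] using hint 0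
        · exact hint ε
      · intro z hz
        have := hzero 0 (by simpa using hT) z hz
        rw [hΦ.zero] at this
        rw [this, hzero ε (hIcc ε hε) z hz, sub_zero]
    have h3 : ∫ z, IsBackwardFlow.average Φ k ε z ∂m = ∫ s in 0..ε, u s := by
      rw [← setIntegral_eq_integral_of_forall_compl_eq_zero (s := D) hA0, hu]
      symm
      refine intervalIntegral_integral_swap (f := fun s z => k (Φ s z)) ?_
      have : IsFiniteMeasure (volume.restrict (uIoc 0 ε)) := ⟨by simp [uIoc]⟩
      exact (integrable_const (1 : ℝ)).mono' hmeas.aestronglyMeasurable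
        (ae_of_all _ fun z => habs _)
    rw [← h2, h1, h3]
  have := eq_exp_of_integral_eq huc.continuousOn heq ht
  rw [hu_eq t ht, this, ← hu_eq 0 ⟨le_rfl, hT⟩]
  simp only [hΦ.zero]

theorem exists_forward_scaling (h : IsGrowthMeasure q m α L O V) (hΦ : IsBackwardFlow O V Φ)
    {y : Lq q} (hyO : y ∈ O) (hy : y ≠ unitLq q) : ∃ R T : ℝ, 0 < R ∧ 0 < T ∧
      ∀ s ∈ Icc 0 T, ∀ B ⊆ Metric.ball y R, MeasurableSet B →
        m (Φ s ⁻¹' B) = ENNReal.ofReal (Real.exp (-(α * s))) * m B := by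
  have hV := h.euler
  have hL := hV.lipschitz
  obtain ⟨ρ, κ, hρ, hκ, haway, hcore⟩ := h.exists_integral_eq_of_strict_deriv hy
    fun z hzO hzs hzu => h.mem_approxLq_of_mem_support hzO hzs hzu
  obtain ⟨R, T, hR, hT, hRρ, hball, hctl⟩ := hΦ.exists_local_control hV hyO hρ
  have hfin : m (Metric.ball y ρ) < ⊤ := lt_of_le_of_lt (measure_mono_ae (by
    filter_upwards [h.ae_cone] with z hz hzy using haway z hz hzy)) (h.finite_away κ hκ)
  have hD : m (Metric.ball y (2 * R)) < ⊤ :=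
    (measure_mono (Metric.ball_subset_ball hRρ)).trans_lt hfin
  -- This provides a point outside every `W` in the ball: tent functions use the distance to the
  -- complement, which has the default value `0` when the complement is empty.
  have heR : unitLq q ∉ Metric.ball y R := fun hh => unitLq_notMem_awayLq hκ
    (haway _ unitLq_mem_coneLq (Metric.ball_subset_ball (by linarith) hh))
  refine ⟨R, T, hR, hT, fun s hs => ?_⟩
  have hmeas := hΦ.measurable hL hV.isOpen
  have hsub : ∀ r ∈ Icc 0 T, ∀ B ⊆ Metric.ball y R, Φ r ⁻¹' B ⊆ Metric.ball y (2 * R) :=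
    fun r hr B hB w hw => hctl r (by rw [abs_of_nonneg hr.1]; exact hr.2) w (hB hw)
  have hopen : ∀ W, IsOpen W → W ⊆ Metric.ball y R →
      m.real (Φ s ⁻¹' W) = Real.exp (-(α * s)) * m.real W := by
    intro W hW hWR
    have hlim : ∀ r ∈ Icc 0 T, Tendsto (fun j => ∫ z, tent W j (Φ r z) ∂m) atTop
        (𝓝 (m.real (Φ r ⁻¹' W))) := by
      intro r hr
      rw [← integral_indicator_one (hmeas r hW.measurableSet)]
      refine tendsto_integral_of_dominated_convergence
        ((Metric.ball y (2 * R)).indicator fun _ => (1 : ℝ))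
        (fun j => ((lipschitzWith_tent j).continuous.measurable.comp
          (hmeas r)).aestronglyMeasurable)
        ((integrable_indicator_iff Metric.isOpen_ball.measurableSet).2
          (integrableOn_const hD.ne)) (fun j => ae_of_all _ fun z => ?_)
        (ae_of_all _ fun z => ?_)
      · rw [Real.norm_eq_abs, abs_of_nonneg (tent_nonneg _ _)]
        by_cases hz : Φ r z ∈ W
        · rw [indicator_of_mem (hsub r hr W hWR hz)]
          exact tent_le_one _ _
        · rw [tent_of_notMem _ hz]
          exact indicator_nonneg (fun _ _ => zero_le_one) _
      · exact tendsto_tent hW ⟨_, fun hh => heR (hWR hh)⟩ (Φ r z)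
    have h0 := hlim 0 ⟨le_rfl, hT.le⟩
    have e0 : Φ 0 = id := funext hΦ.zero
    simp only [e0, id, preimage_id] at h0
    refine tendsto_nhds_unique (hlim s hs) ((h0.const_mul _).congr fun j => ?_)
    exact (h.integral_comp_flow hΦ hR hRρ hball hfin hctl hcore (lipschitzWith_tent j)
      (tent_nonneg j) (tent_le_one j) (fun w hw => tent_of_notMem j fun hh => hw (hWR hh)) hs).symm
  set b := Metric.ball y R with hb
  have hbm : MeasurableSet b := Metric.isOpen_ball.measurableSet
  have hbfin : m b < ⊤ := (measure_mono (Metric.ball_subset_ball (by linarith))).trans_lt hD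
  have hopen' : ∀ W, IsOpen W → W ⊆ b →
      m (Φ s ⁻¹' W) = ENNReal.ofReal (Real.exp (-(α * s))) * m W := by
    intro W hW hWR
    have h1 := hopen W hW hWR
    have h2 : m (Φ s ⁻¹' W) ≠ ⊤ := ((measure_mono (hsub s hs W hWR)).trans_lt hD).ne
    have h3 : m W ≠ ⊤ := ((measure_mono hWR).trans_lt hbfin).ne
    rw [← ENNReal.ofReal_toReal h2, ← ENNReal.ofReal_toReal h3,
      ← ENNReal.ofReal_mul (Real.exp_pos _).le]
    exact congrArg ENNReal.ofReal h1
  have : IsFiniteMeasure ((m.map (Φ s)).restrict b) := ⟨by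
    rw [Measure.restrict_apply_univ, Measure.map_apply (hmeas s) hbm]
    exact (measure_mono (hsub s hs b subset_rfl)).trans_lt hD⟩
  have hmeq : (m.map (Φ s)).restrict b
      = ENNReal.ofReal (Real.exp (-(α * s))) • m.restrict b := by
    refine ext_of_generate_finite {W | IsOpen W} BorelSpace.measurable_eq isPiSystem_isOpen
      (fun W hW => ?_) ?_
    · have hWm : MeasurableSet W := IsOpen.measurableSet hW
      rw [Measure.restrict_apply hWm, Measure.map_apply (hmeas s) (hWm.inter hbm),
        Measure.smul_apply, Measure.restrict_apply hWm, smul_eq_mul]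
      exact hopen' _ (IsOpen.inter hW Metric.isOpen_ball) inter_subset_right
    · rw [Measure.restrict_apply_univ, Measure.map_apply (hmeas s) hbm,
        Measure.smul_apply, Measure.restrict_apply_univ, smul_eq_mul]
      exact hopen' _ Metric.isOpen_ball subset_rfl
  intro B hB hBm
  have := congrArg (fun μ => μ B) hmeq
  rwa [Measure.restrict_apply hBm, Measure.map_apply (hmeas s) (hBm.inter hbm),
    Measure.smul_apply, Measure.restrict_apply hBm, smul_eq_mul, inter_eq_left.2 hB] at this

/-- Near a point of `O` other than `(1, 0, …)`, the flow scales the measure for a short time. -/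
theorem exists_local_scaling (h : IsGrowthMeasure q m α L O V) (hΦ : IsBackwardFlow O V Φ)
    {y : Lq q} (hyO : y ∈ O) (hy : y ≠ unitLq q) : ∃ U : Set (Lq q), ∃ T : ℝ, IsOpen U ∧ y ∈ U ∧
      0 < T ∧ ∀ s, |s| ≤ T → ∀ B ⊆ U, MeasurableSet B →
        m (Φ s ⁻¹' B) = ENNReal.ofReal (Real.exp (-(α * s))) * m B := by
  have hV := h.euler
  have hL := hV.lipschitz
  obtain ⟨R, T, hR, hT, hfor⟩ := h.exists_forward_scaling hΦ hyO hy
  obtain ⟨R', T', hR', hT', hRR, -, hctl⟩ := hΦ.exists_local_control hV hyO hR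
  refine ⟨Metric.ball y R', min T T', Metric.isOpen_ball, Metric.mem_ball_self hR',
    lt_min hT hT', fun s hs B hB hBm => ?_⟩
  have hsT : |s| ≤ T := hs.trans (min_le_left _ _)
  rcases le_total 0 s with h0 | h0
  · rw [abs_of_nonneg h0] at hsT
    exact hfor s ⟨h0, hsT⟩ B (hB.trans (Metric.ball_subset_ball (by linarith))) hBm
  · rw [abs_of_nonpos h0] at hsT
    -- A negative time is handled by the forward scaling of the set `Φₛ⁻¹ B`; the smaller radius
    -- `R'` keeps this set in the ball of radius `R`.
    have h1 := hfor (-s) ⟨by linarith, hsT⟩ (Φ s ⁻¹' B)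
      (fun w hw => Metric.ball_subset_ball hRR (hctl s (hs.trans (min_le_right _ _)) w (hB hw)))
      (hΦ.measurable hL hV.isOpen s hBm)
    rw [← preimage_comp] at h1
    have h2 : Φ s ∘ Φ (-s) = id := funext fun z => hΦ.apply_neg hL s z
    rw [h2, preimage_id] at h1
    rw [h1, ← mul_assoc, ← ENNReal.ofReal_mul (Real.exp_pos _).le, ← Real.exp_add]
    have h3 : -(α * s) + -(α * -s) = 0 := by ring
    rw [h3, Real.exp_zero, ENNReal.ofReal_one, one_mul]

end IsGrowthMeasure

end LocalScaling

/-! ### Global scaling and the role of the point `(1, 0, …)` -/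

section GlobalScaling

theorem ofReal_exp_mul_cancel (a : ℝ) (c : ℝ≥0∞) :
    ENNReal.ofReal (Real.exp (-a)) * (ENNReal.ofReal (Real.exp a) * c) = c := by
  rw [← mul_assoc, ← ENNReal.ofReal_mul (Real.exp_pos _).le, ← Real.exp_add, neg_add_cancel,
    Real.exp_zero, ENNReal.ofReal_one, one_mul]

variable {q : ℝ≥0∞} [Fact (1 ≤ q)]

namespace IsGrowthMeasure

variable {m : Measure (Lq q)} {α : ℝ} {L : ℝ≥0} {O : Set (Lq q)} {V : Lq q → Lq q}
  {Φ : ℝ → Lq q → Lq q}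

/-- If the orbit of `y` avoids `(1, 0, …)` up to time `t`, then the flow scales the measure of the
sets near `y`. -/
theorem exists_scaling_of_avoids (h : IsGrowthMeasure q m α L O V) (hΦ : IsBackwardFlow O V Φ)
    {y : Lq q} (hyO : y ∈ O) {t : ℝ} (hy : ∀ s ∈ uIcc 0 t, Φ s y ≠ unitLq q) :
    ∃ U ∈ 𝓝 y, IsOpen U ∧ ∀ B ⊆ U, MeasurableSet B →
      m (Φ (-t) ⁻¹' B) = ENNReal.ofReal (Real.exp (α * t)) * m B := by
  have hV := h.euler
  have hL := hV.lipschitz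
  set Q : ℝ → Prop := fun s => ∃ U ∈ 𝓝 y, IsOpen U ∧ ∀ B ⊆ U, MeasurableSet B →
      m (Φ (-s) ⁻¹' B) = ENNReal.ofReal (Real.exp (α * s)) * m B with hQ
  have h0 : Q 0 := ⟨univ, univ_mem, isOpen_univ, fun B _ _ => by
    have : Φ (-0) = id := funext fun z => by rw [neg_zero, hΦ.zero]; rfl
    rw [this]
    simp⟩
  -- Local scaling around `Φₛ y` makes `Q` locally constant in time: it passes from `s` to nearby
  -- times and back. Connectedness of the interval carries it from `0` to `t`.
  refine isPreconnected_uIcc.induction₂' (s := uIcc (0 : ℝ) t) (fun s s' => Q s → Q s')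
    (fun s hs => ?_) (fun a b c _ _ _ hab hbc ha => hbc (hab ha)) left_mem_uIcc right_mem_uIcc h0
  obtain ⟨U₀, T₀, hU₀, hyU₀, hT₀, hsc⟩ := h.exists_local_scaling hΦ (hΦ.mem s y hyO) (hy s hs)
  have step : ∀ a b, |b - a| ≤ T₀ → Φ a y ∈ U₀ → Q a → Q b := by
    rintro a b hab hay ⟨U, hUy, hUo, hU⟩
    have hW : IsOpen (Φ a ⁻¹' (U₀ ∩ O)) :=
      hΦ.isOpen_preimage hL hV.isOpen (hU₀.inter hV.isOpen) inter_subset_right a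
    refine ⟨U ∩ Φ a ⁻¹' (U₀ ∩ O), inter_mem hUy (hW.mem_nhds ⟨hay, hΦ.mem _ _ hyO⟩),
      hUo.inter hW, fun B hB hBm => ?_⟩
    have h1 := hU B (hB.trans inter_subset_left) hBm
    have h2 := hsc (-(b - a)) (by rwa [abs_neg]) (Φ (-a) ⁻¹' B) (fun w hw => by
      have := (hB hw).2.1
      rwa [hΦ.apply_neg hL] at this) (hΦ.measurable hL hV.isOpen _ hBm)
    rw [h1, ← preimage_comp] at h2
    have h3 : Φ (-a) ∘ Φ (-(b - a)) = Φ (-b) := funext fun z => by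
      rw [Function.comp, ← hΦ.add hL]
      congr 1
      ring
    rw [h3] at h2
    rw [h2, ← mul_assoc, ← ENNReal.ofReal_mul (Real.exp_pos _).le, ← Real.exp_add]
    congr 3
    ring
  have hev : ∀ᶠ s' in 𝓝[uIcc 0 t] s, |s' - s| ≤ T₀ ∧ Φ s' y ∈ U₀ := by
    refine mem_nhdsWithin_of_mem_nhds (inter_mem ?_ ?_)
    · filter_upwards [Metric.ball_mem_nhds s hT₀] with x hx
      exact (by simpa [Real.dist_eq] using hx : |x - s| < T₀).le
    · exact (hΦ.continuous_time y).continuousAt (hU₀.mem_nhds hyU₀)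
  filter_upwards [hev] with s' hs'
  exact ⟨step s s' hs'.1 hyU₀, step s' s (by rw [abs_sub_comm]; exact hs'.1) hs'.2⟩

/-- Countably many neighbourhoods with scaling cover the part of `B` in the cone. The rest of `B` is
null, but its preimage is not yet known to be null, hence only an inequality. -/
theorem le_measure_preimage_of_avoids (h : IsGrowthMeasure q m α L O V)
    (hΦ : IsBackwardFlow O V Φ) {t : ℝ} {B : Set (Lq q)} (hB : MeasurableSet B) (hBO : B ⊆ O)
    (hav : ∀ y ∈ B, ∀ s ∈ uIcc 0 t, Φ s y ≠ unitLq q) :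
    ENNReal.ofReal (Real.exp (α * t)) * m B ≤ m (Φ (-t) ⁻¹' B) := by
  have hmeas := hΦ.measurable h.euler.lipschitz h.euler.isOpen
  set B₀ := B ∩ coneLq q with hB₀
  have hB₀m : MeasurableSet B₀ := hB.inter isClosed_coneLq.measurableSet
  have hBeq : m B = m B₀ := measure_congr (by
    filter_upwards [h.ae_cone] with z hz
    exact propext ⟨fun hzB => ⟨hzB, hz⟩, fun hzB => hzB.1⟩)
  choose U hUn hUo hU using fun y : B₀ => h.exists_scaling_of_avoids hΦ (hBO y.2.1) (hav y y.2.1)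
  obtain ⟨I, hI, hcov⟩ := (isLindelof_of_subset_approxLq
    (inter_subset_right.trans coneLq_subset_approxLq : B₀ ⊆ approxLq q)).elim_nhds_subcover'
    (fun y hy => U ⟨y, hy⟩) (fun y hy => hUn ⟨y, hy⟩)
  have hres : (m.map (Φ (-t))).restrict (⋃ y ∈ I, U y)
      = (ENNReal.ofReal (Real.exp (α * t)) • m).restrict (⋃ y ∈ I, U y) := by
    refine (Measure.restrict_biUnion_congr hI).2 fun y _ => Measure.ext fun S hS => ?_
    have hm := hS.inter (hUo y).measurableSet
    rw [Measure.restrict_apply hS, Measure.restrict_apply hS, Measure.map_apply (hmeas _) hm,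
      Measure.smul_apply, smul_eq_mul]
    exact hU y _ inter_subset_right hm
  have h1 := congrArg (fun μ => μ B₀) hres
  simp only [Measure.restrict_apply hB₀m] at h1
  rw [inter_eq_left.2 hcov, Measure.map_apply (hmeas _) hB₀m, Measure.smul_apply,
    smul_eq_mul] at h1
  rw [hBeq, ← h1]
  exact measure_mono (preimage_mono inter_subset_left)

/-- The reverse inequality is the previous one for the set `Φ₋ₜ⁻¹ B` and the opposite time. -/
theorem measure_preimage_of_avoids (h : IsGrowthMeasure q m α L O V)
    (hΦ : IsBackwardFlow O V Φ) {t : ℝ} {B : Set (Lq q)} (hB : MeasurableSet B) (hBO : B ⊆ O)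
    (hav : ∀ y ∈ B, ∀ s ∈ uIcc 0 t, Φ s y ≠ unitLq q) :
    m (Φ (-t) ⁻¹' B) = ENNReal.ofReal (Real.exp (α * t)) * m B := by
  have hL := h.euler.lipschitz
  refine le_antisymm ?_ (h.le_measure_preimage_of_avoids hΦ hB hBO hav)
  have h1 := h.le_measure_preimage_of_avoids hΦ (t := -t)
    (hΦ.measurable hL h.euler.isOpen (-t) hB)
    (fun y hy => hΦ.mem_iff.1 (hBO hy)) (fun y hy s hs => ?_)
  · rw [neg_neg, ← preimage_comp] at h1
    have h3 : Φ (-t) ∘ Φ t = id := funext fun z => hΦ.neg_apply hL t z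
    rw [h3, preimage_id, mul_neg] at h1
    calc m (Φ (-t) ⁻¹' B) = ENNReal.ofReal (Real.exp (α * t)) *
          (ENNReal.ofReal (Real.exp (-(α * t))) * m (Φ (-t) ⁻¹' B)) := by
          simpa using (ofReal_exp_mul_cancel (-(α * t)) _).symm
      _ ≤ _ := by gcongr
  · have h4 := hav _ hy (s + t) (by
      rcases le_total 0 t with h0 | h0
      · rw [uIcc_of_ge (by linarith)] at hs
        rw [uIcc_of_le h0]
        exact ⟨by linarith [hs.1], by linarith [hs.2]⟩
      · rw [uIcc_of_le (by linarith)] at hs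
        rw [uIcc_of_ge h0]
        exact ⟨by linarith [hs.1], by linarith [hs.2]⟩)
    rwa [hΦ.add hL, hΦ.apply_neg hL] at h4

/-- Along the orbits that avoid `(1, 0, …)` in the future, the sets of not too large measure are
eventually left. -/
theorem ae_eventually_notMem_of_avoids (h : IsGrowthMeasure q m α L O V)
    (hΦ : IsBackwardFlow O V Φ) {A : Set (Lq q)} (hA : MeasurableSet A) (hAO : A ⊆ O)
    (hav : ∀ y ∈ A, ∀ s, 0 ≤ s → Φ s y ≠ unitLq q) {D : ℕ → Set (Lq q)}
    (hD : ∀ k, MeasurableSet (D k)) {C : ℝ≥0∞} (hC : C ≠ ⊤)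
    (hDC : ∀ k : ℕ, m (D k) ≤ ENNReal.ofReal (Real.exp (α / 2 * k)) * C) :
    ∀ᵐ y ∂m, ∀ᶠ k : ℕ in atTop, y ∈ A → Φ k y ∉ D k := by
  have hL := h.euler.lipschitz
  have hmeas := hΦ.measurable hL h.euler.isOpen
  -- Transporting this set by `Φₖ` multiplies its measure by `exp(αk)` and puts it inside `D k`. The
  -- growth rate `α/2` allowed for `D k` leaves a geometric series, and Borel–Cantelli applies.
  have hk : ∀ k : ℕ, m (A ∩ Φ k ⁻¹' D k) ≤ ENNReal.ofReal (Real.exp (k * (-(α / 2)))) * C := by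
    intro k
    have h1 := h.measure_preimage_of_avoids hΦ (t := k) (B := A ∩ Φ k ⁻¹' D k)
      (hA.inter (hmeas _ (hD k)))
      (inter_subset_left.trans hAO) (fun y hy s hs => hav y hy.1 s (by
        rw [uIcc_of_le k.cast_nonneg] at hs; exact hs.1))
    have h2 : Φ (-k) ⁻¹' (A ∩ Φ k ⁻¹' D k) ⊆ D k := fun w hw => by
      have := hw.2
      rwa [mem_preimage, hΦ.apply_neg hL] at this
    have h3 := (h1.symm.le.trans (measure_mono h2)).trans (hDC k)
    calc m (A ∩ Φ k ⁻¹' D k) = ENNReal.ofReal (Real.exp (-(α * k))) *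
          (ENNReal.ofReal (Real.exp (α * k)) * m (A ∩ Φ k ⁻¹' D k)) :=
          (ofReal_exp_mul_cancel _ _).symm
      _ ≤ ENNReal.ofReal (Real.exp (-(α * k))) *
          (ENNReal.ofReal (Real.exp (α / 2 * k)) * C) := by gcongr
      _ = _ := by
        rw [← mul_assoc, ← ENNReal.ofReal_mul (Real.exp_pos _).le, ← Real.exp_add]
        congr 3
        ring
  have hsum : ∑' k : ℕ, m (A ∩ Φ k ⁻¹' D k) ≠ ⊤ := by
    refine ne_top_of_le_ne_top ?_ (ENNReal.tsum_le_tsum hk)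
    rw [ENNReal.tsum_mul_right]
    exact ENNReal.mul_ne_top (Summable.tsum_ofReal_lt_top
      (Real.summable_exp_nat_mul_iff.2 (by linarith [h.pos]))).ne hC
  filter_upwards [ae_eventually_notMem hsum] with y hy
  filter_upwards [hy] with k hk hyA hkD
  exact hk ⟨hyA, hkD⟩

/-- Almost all the orbits that avoid `(1, 0, …)` converge to this point. -/
theorem ae_tendsto_of_avoids (h : IsGrowthMeasure q m α L O V)
    (hΦ : IsBackwardFlow O V Φ) {A : Set (Lq q)} (hA : MeasurableSet A) (hAO : A ⊆ O)
    (hav : ∀ y ∈ A, ∀ s, 0 ≤ s → Φ s y ≠ unitLq q) : ∀ᵐ y ∂m, y ∈ A →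
      Tendsto (fun k : ℕ => Φ k y) atTop (𝓝 (unitLq q)) ∧
      Tendsto (fun k : ℕ => ‖V (Φ k y)‖) atTop (𝓝 0) := by
  have hL := h.euler.lipschitz
  have hO := h.euler.isOpen
  have hα := h.pos
  have hexp : ∀ k : ℕ, 1 ≤ ENNReal.ofReal (Real.exp (α / 2 * k)) := fun k => by
    rw [ENNReal.one_le_ofReal]
    exact Real.one_le_exp (by positivity)
  have h1 := h.ae_eventually_notMem_of_avoids hΦ hA hAO hav (D := fun _ => (coneLq q)ᶜ)
    (fun _ => isClosed_coneLq.measurableSet.compl) (C := 0) (by simp)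
    (fun k => by rw [mul_zero]; exact (mem_ae_iff.1 h.ae_cone).le)
  have h2 : ∀ᵐ y ∂m, ∀ j : ℕ, ∀ᶠ k : ℕ in atTop, y ∈ A → Φ k y ∉ awayLq q (1 / ((j : ℝ) + 1)) :=
    ae_all_iff.2 fun j => h.ae_eventually_notMem_of_avoids hΦ hA hAO hav
      (fun _ => measurableSet_awayLq _) (h.finite_away _ (by positivity)).ne
      (fun k => le_mul_of_one_le_left zero_le (hexp k))
  -- By Chebyshev for `‖V‖²`, the set where the speed exceeds `exp(-αk/4)` has measure at most
  -- `exp(αk/2) ∫ ‖V‖²`, exactly the allowed growth. Eventual speeds below `exp(-αk/4)` are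
  -- summable, which makes the orbit Cauchy.
  have h3 := h.ae_eventually_notMem_of_avoids hΦ hA hAO hav
    (D := fun k => O ∩ V ⁻¹' {v | Real.exp (-(α / 4 * k)) < ‖v‖})
    (fun k => (hL.continuousOn.isOpen_inter_preimage hO
      (isOpen_lt continuous_const continuous_norm)).measurableSet)
    (C := ∫⁻ z, ENNReal.ofReal (‖V z‖ ^ 2) ∂m) h.sq_integrable.ne (fun k => by
      have hmk := mul_meas_ge_le_lintegral₀ (μ := m) (f := fun z => ENNReal.ofReal (‖V z‖ ^ 2))
        (h.aemeasurable.norm.pow_const 2).ennreal_ofReal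
        (ENNReal.ofReal (Real.exp (-(α / 2 * k))))
      calc _ = ENNReal.ofReal (Real.exp (α / 2 * k)) *
          (ENNReal.ofReal (Real.exp (-(α / 2 * k))) *
            m (O ∩ V ⁻¹' {v | Real.exp (-(α / 4 * k)) < ‖v‖})) := by
            simpa using (ofReal_exp_mul_cancel (-(α / 2 * k)) _).symm
        _ ≤ _ := by
          gcongr
          refine le_trans ?_ hmk
          gcongr
          rintro z ⟨-, hz⟩
          refine ENNReal.ofReal_le_ofReal ?_
          have : Real.exp (-(α / 2 * k)) = Real.exp (-(α / 4 * k)) ^ 2 := by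
            rw [← Real.exp_nat_mul]
            congr 1
            push_cast
            ring
          rw [this]
          exact pow_le_pow_left₀ (Real.exp_pos _).le (le_of_lt hz) 2)
  filter_upwards [h1, h2, h3] with y hy1 hy2 hy3 hyA
  have hyO := hAO hyA
  have hVk : ∀ᶠ k : ℕ in atTop, ‖V (Φ k y)‖ ≤ Real.exp (-(α / 4 * k)) := by
    filter_upwards [hy3] with k hk
    by_contra hcon
    exact hk hyA ⟨hΦ.mem _ _ hyO, not_le.1 hcon⟩
  have hsum : Summable fun k : ℕ => Real.exp (k * (-(α / 4))) :=
    Real.summable_exp_nat_mul_iff.2 (by linarith)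
  have hcau : CauchySeq fun k : ℕ => Φ k y := by
    refine cauchySeq_of_summable_dist (Summable.of_norm_bounded_eventually_nat
      (hsum.mul_right (Real.exp L)) ?_)
    filter_upwards [hVk] with k hk
    rw [Real.norm_of_nonneg dist_nonneg]
    have h5 := hΦ.dist_apply_le hL (hΦ.mem k y hyO) (s := 0) (t := 1) (T := 1) (by simp)
      (by simp)
    rw [hΦ.zero, ← hΦ.add hL, mul_one, zero_sub, abs_neg, abs_one, mul_one, add_comm] at h5
    rw [Nat.succ_eq_add_one, Nat.cast_add, Nat.cast_one]
    refine h5.trans ?_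
    have e : (k : ℝ) * (-(α / 4)) = -(α / 4 * k) := by ring
    rw [e]
    gcongr
  obtain ⟨w, hw⟩ := cauchySeq_tendsto_of_complete hcau
  have hwc : w ∈ coneLq q := by
    refine isClosed_coneLq.mem_of_tendsto hw ?_
    filter_upwards [hy1] with k hk
    by_contra hcon
    exact hk hyA hcon
  -- A limit in the cone other than `(1, 0, …)` would keep the orbit at a positive distance in the
  -- coordinates `0` or `1`, but each set `awayLq` is eventually left.
  have hwe : w = unitLq q := by
    by_contra hne
    obtain ⟨i, κ, hκ, hi⟩ := exists_coord_away hne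
    obtain ⟨j, hj⟩ := exists_nat_one_div_lt hκ
    have hcoord : ∀ᶠ k : ℕ in atTop, |Φ k y i - w i| ≤ κ := by
      have := (((continuous_apply_Lq i).tendsto w).comp hw).eventually
        (Metric.closedBall_mem_nhds _ hκ)
      filter_upwards [this] with k hk
      exact (by simpa [Real.dist_eq] using hk)
    obtain ⟨k, hk1, hk2, hk3⟩ := (hy1.and ((hy2 j).and hcoord)).exists
    refine hk2 hyA ?_
    have hkc : Φ k y ∈ coneLq q := by
      by_contra hcon
      exact hk1 hyA hcon
    exact (hi _ hkc hk3).imp hj.le.trans hj.le.trans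
  refine ⟨hwe ▸ hw, ?_⟩
  refine squeeze_zero' (Eventually.of_forall fun _ => norm_nonneg _) hVk ?_
  refine hsum.tendsto_atTop_zero.congr fun k => ?_
  congr 1
  ring

/-- When `V` does not vanish at `(1, 0, …)`, almost no orbit avoids this point. -/
theorem measure_eq_zero_of_avoids (h : IsGrowthMeasure q m α L O V)
    (hΦ : IsBackwardFlow O V Φ) (heO : unitLq q ∈ O) (hVe : V (unitLq q) ≠ 0) {A : Set (Lq q)}
    (hA : MeasurableSet A) (hAO : A ⊆ O)
    (hav : ∀ y ∈ A, ∀ s, 0 ≤ s → Φ s y ≠ unitLq q) : m A = 0 := by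
  have hae : ∀ᵐ y ∂m, y ∉ A := by
    filter_upwards [h.ae_tendsto_of_avoids hΦ hA hAO hav] with y hy hyA
    have hlim := ((h.euler.lipschitz.continuousOn.continuousAt
      (h.euler.isOpen.mem_nhds heO)).tendsto.comp (hy hyA).1).norm
    exact hVe (norm_eq_zero.1 (tendsto_nhds_unique hlim (hy hyA).2))
  simpa using (ae_iff.1 hae)

/-- Where `V` does not vanish, `‖V‖` is bounded below near `(1, 0, …)`, and square integrability
bounds the measure there. At the other points the measure is locally finite anyway. -/
theorem exists_measure_nhds_lt_top (h : IsGrowthMeasure q m α L O V) (heO : unitLq q ∈ O)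
    (hVe : V (unitLq q) ≠ 0) (y : Lq q) : ∃ U ∈ 𝓝 y, m U < ⊤ := by
  by_cases hy : y = unitLq q
  · subst hy
    have hc : 0 < ‖V (unitLq q)‖ := norm_pos_iff.2 hVe
    have hcont := (h.euler.lipschitz.continuousOn.continuousAt (h.euler.isOpen.mem_nhds heO)).norm
    refine ⟨_, hcont.eventually_const_lt (half_lt_self hc), ?_⟩
    have hmk := meas_ge_le_lintegral_div (μ := m) (f := fun z => ENNReal.ofReal (‖V z‖ ^ 2))
      (h.aemeasurable.norm.pow_const 2).ennreal_ofReal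
      (ε := ENNReal.ofReal ((‖V (unitLq q)‖ / 2) ^ 2))
      (by rw [Ne, ENNReal.ofReal_eq_zero, not_le]; positivity) ENNReal.ofReal_ne_top
    refine lt_of_le_of_lt ((measure_mono fun z hz => ?_).trans hmk)
      (ENNReal.div_lt_top h.sq_integrable.ne
        (by rw [Ne, ENNReal.ofReal_eq_zero, not_le]; positivity))
    exact ENNReal.ofReal_le_ofReal (pow_le_pow_left₀ (by positivity) (le_of_lt hz) 2)
  · obtain ⟨ρ, hρ, hfin⟩ := h.exists_measure_ball_lt_top hy
    exact ⟨_, Metric.ball_mem_nhds y hρ, hfin⟩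

/-- If the past orbit returns to `(1, 0, …)` it is periodic, hence compact. Otherwise it is a
compact arc followed by successive preimages of the arc `[1, 2]`, whose measures form a geometric
series. -/
theorem measure_orbit_lt_top (h : IsGrowthMeasure q m α L O V) (hΦ : IsBackwardFlow O V Φ)
    (heO : unitLq q ∈ O) (hVe : V (unitLq q) ≠ 0) :
    m ((fun s => Φ (-s) (unitLq q)) '' Ici 0) < ⊤ := by
  have hL := h.euler.lipschitz
  set f : ℝ → Lq q := fun s => Φ (-s) (unitLq q) with hf
  have hfc : Continuous f := (hΦ.continuous_time _).comp continuous_neg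
  have hseg : ∀ a b, m (f '' Icc a b) < ⊤ := fun a b =>
    (isCompact_Icc.image hfc).measure_lt_top_of_nhdsWithin fun y _ => by
      obtain ⟨U, hU, hfin⟩ := h.exists_measure_nhds_lt_top heO hVe y
      exact ⟨U, mem_nhdsWithin_of_mem_nhds hU, hfin⟩
  by_cases hper : ∃ P > 0, f P = unitLq q
  · obtain ⟨P, hP, hPe⟩ := hper
    have hp : Function.Periodic f P := fun s => by
      have : -(s + P) = -s + -P := by ring
      simp only [hf] at hPe ⊢
      rw [this, hΦ.add hL, hPe]
    rw [← zero_add P] at hP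
    have := hp.image_Icc (by simpa using hP) 0
    exact (measure_mono ((image_subset_range _ _).trans this.superset)).trans_lt (hseg _ _)
  · push Not at hper
    -- The arc starts at time `1` and not `0`: it has to avoid `(1, 0, …)` for the scaling to apply.
    have hR : MeasurableSet (f '' Icc 1 2) := (isCompact_Icc.image hfc).measurableSet
    have hk : ∀ k : ℕ, m (Φ k ⁻¹' (f '' Icc 1 2))
        = ENNReal.ofReal (Real.exp (k * (-α))) * m (f '' Icc 1 2) := by
      intro k
      have h1 := h.measure_preimage_of_avoids hΦ (t := -k) hR
        (by rintro _ ⟨s, -, rfl⟩; exact hΦ.mem _ _ heO) (by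
          rintro _ ⟨s, hs, rfl⟩ r hr
          rw [uIcc_of_ge (by simp)] at hr
          have e : Φ r (f s) = f (s - r) := by
            simp only [hf]
            rw [← hΦ.add hL]
            congr 1
            ring
          rw [e]
          exact hper _ (by linarith [hs.1, hr.2]))
      rw [neg_neg] at h1
      rw [h1]
      congr 3
      ring
    have hsub : f '' Ici 0 ⊆ f '' Icc 0 1 ∪ ⋃ k : ℕ, Φ k ⁻¹' (f '' Icc 1 2) := by
      rintro _ ⟨s, hs, rfl⟩
      rcases le_total s 1 with hs1 | hs1
      · exact Or.inl ⟨s, ⟨hs, hs1⟩, rfl⟩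
      · refine Or.inr (mem_iUnion.2 ⟨⌊s - 1⌋₊, s - ⌊s - 1⌋₊, ⟨?_, ?_⟩, ?_⟩)
        · have := Nat.floor_le (sub_nonneg.2 hs1)
          linarith
        · have := Nat.lt_floor_add_one (s - 1)
          linarith
        · simp only [hf]
          rw [← hΦ.add hL]
          congr 1
          ring
    refine (measure_mono hsub).trans_lt ((measure_union_le _ _).trans_lt
      (ENNReal.add_lt_top.2 ⟨hseg 0 1, (measure_iUnion_le _).trans_lt ?_⟩))
    simp only [hk]
    rw [ENNReal.tsum_mul_right]
    exact ENNReal.mul_lt_top (Summable.tsum_ofReal_lt_top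
      (Real.summable_exp_nat_mul_iff.2 (by linarith [h.pos]))) (hseg 1 2)

/-- A point of `O` off the past orbit of `(1, 0, …)` never meets it in the future, and such points
form a null set. The past orbit has finite measure, so `m` is finite, hence null. -/
theorem eq_zero_of_ne_zero (h : IsGrowthMeasure q m α L O V) (hΦ : IsBackwardFlow O V Φ)
    (heO : unitLq q ∈ O) (hVe : V (unitLq q) ≠ 0) : m = 0 := by
  have hL := h.euler.lipschitz
  set R := (fun s => Φ (-s) (unitLq q)) '' Ici 0 with hR
  have hfc : Continuous fun s => Φ (-s) (unitLq q) := (hΦ.continuous_time _).comp continuous_neg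
  have hRm : MeasurableSet R := by
    have : R = ⋃ n : ℕ, (fun s => Φ (-s) (unitLq q)) '' Icc 0 (n : ℝ) := by
      rw [← image_iUnion, hR]
      congr 1
      ext s
      simp only [mem_Ici, mem_iUnion, mem_Icc]
      exact ⟨fun hs => (exists_nat_ge s).imp fun n hn => ⟨hs, hn⟩, fun ⟨n, hn⟩ => hn.1⟩
    rw [this]
    exact MeasurableSet.iUnion fun n => (isCompact_Icc.image hfc).measurableSet
  have hA : m (O \ R) = 0 := by
    refine h.measure_eq_zero_of_avoids hΦ heO hVe (h.euler.isOpen.measurableSet.diff hRm)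
      sdiff_subset fun y hy s hs hys => hy.2 ⟨s, hs, ?_⟩
    simp only [← hys]
    exact hΦ.neg_apply hL s y
  have : IsFiniteMeasure m := ⟨by
    have huniv : (univ : Set (Lq q)) ⊆ R ∪ ((O \ R) ∪ Oᶜ) := fun z _ => by
      by_cases h1 : z ∈ R <;> by_cases h2 : z ∈ O <;> simp [h1, h2]
    refine (measure_mono huniv).trans_lt ((measure_union_le _ _).trans_lt
      (ENNReal.add_lt_top.2 ⟨h.measure_orbit_lt_top hΦ heO hVe, ?_⟩))
    refine (measure_union_le _ _).trans_lt ?_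
    have hOc : m Oᶜ = 0 := mem_ae_iff.1 h.ae_mem
    simp [hA, hOc]⟩
  exact h.eq_zero_of_isFiniteMeasure

/-- Unless the measure is null, the point `(1, 0, …)` is fixed by the flow. -/
theorem flow_unitLq (h : IsGrowthMeasure q m α L O V) (hΦ : IsBackwardFlow O V Φ) (hm : m ≠ 0)
    (t : ℝ) : Φ t (unitLq q) = unitLq q := by
  by_cases heO : unitLq q ∈ O
  · by_cases hVe : V (unitLq q) = 0
    · refine (hΦ.unique h.euler.lipschitz (c := fun _ => unitLq q) rfl
        (fun t => ⟨heO, ?_⟩) t).symm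
      rw [hVe, neg_zero]
      exact hasDerivAt_const _ _
    · exact absurd (h.eq_zero_of_ne_zero hΦ heO hVe) hm
  · exact hΦ.off t _ heO

/-- The flow scales the measure away from `(1, 0, …)`. -/
theorem measure_preimage (h : IsGrowthMeasure q m α L O V) (hΦ : IsBackwardFlow O V Φ) (t : ℝ)
    {B : Set (Lq q)} (hB : MeasurableSet B) (hBe : unitLq q ∉ B) :
    m (Φ t ⁻¹' B) = ENNReal.ofReal (Real.exp (-(α * t))) * m B := by
  by_cases hm : m = 0
  · simp [hm]
  have hO := h.euler.isOpen.measurableSet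
  have h1 := h.measure_preimage_of_avoids hΦ (t := -t) (hB.inter hO) inter_subset_right
    (fun y hy s _ hs => hBe (by
      have := congrArg (Φ (-s)) hs
      rw [hΦ.neg_apply h.euler.lipschitz, h.flow_unitLq hΦ hm] at this
      exact this ▸ hy.1))
  rw [neg_neg, mul_neg] at h1
  have e1 : m (B ∩ O) = m B := measure_congr (by
    filter_upwards [h.ae_mem] with z hz
    exact propext ⟨fun hzB => hzB.1, fun hzB => ⟨hzB, hz⟩⟩)
  have e2 : m (Φ t ⁻¹' (B ∩ O)) = m (Φ t ⁻¹' B) := measure_congr (by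
    filter_upwards [h.ae_mem] with z hz
    exact propext ⟨fun hzB => hzB.1, fun hzB => ⟨hzB, hΦ.mem _ _ hz⟩⟩)
  rw [← e1, ← e2, h1]

/-- The measure is infinite in the neighbourhoods of `(1, 0, …)`, even without this point. -/
theorem measure_nhds_diff_eq_top (h : IsGrowthMeasure q m α L O V) (hΦ : IsBackwardFlow O V Φ)
    (hm : m ≠ 0) (he : m {unitLq q} ≠ ⊤) {U : Set (Lq q)} (hU : U ∈ 𝓝 (unitLq q)) :
    m (U \ {unitLq q}) = ⊤ := by
  by_contra hfin
  have hL := h.euler.lipschitz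
  have hO := h.euler.isOpen.measurableSet
  obtain ⟨W, hWU, hWo, heW⟩ := mem_nhds_iff.1 hU
  set W' := W \ {unitLq q} with hW'
  have hW'm : MeasurableSet W' := hWo.measurableSet.diff (measurableSet_singleton _)
  have hne : ∀ (s : ℝ) (y : Lq q), y ≠ unitLq q → Φ s y ≠ unitLq q := fun s y hy hs => hy (by
    have := congrArg (Φ (-s)) hs
    rwa [hΦ.neg_apply hL, h.flow_unitLq hΦ hm] at this)
  have hW'fin : m W' ≠ ⊤ := ne_top_of_le_ne_top hfin (measure_mono (sdiff_subset_sdiff_left hWU))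
  -- If `W'` had finite measure, Borel–Cantelli would make almost every orbit leave it for good,
  -- whereas almost every orbit from a point other than `(1, 0, …)` converges to this point without
  -- reaching it. So `m` would be a finite point mass, hence null.
  have hk : ∀ k : ℕ, m (Φ k ⁻¹' W') = ENNReal.ofReal (Real.exp (k * (-α))) * m W' := fun k => by
    rw [h.measure_preimage hΦ k hW'm (fun hh => hh.2 rfl)]
    congr 3
    ring
  have hsum : ∑' k : ℕ, m (Φ k ⁻¹' W') ≠ ⊤ := by
    simp only [hk]
    rw [ENNReal.tsum_mul_right]
    exact ENNReal.mul_ne_top (Summable.tsum_ofReal_lt_top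
      (Real.summable_exp_nat_mul_iff.2 (by linarith [h.pos]))).ne hW'fin
  have hae : ∀ᵐ y ∂m, y = unitLq q := by
    filter_upwards [h.ae_tendsto_of_avoids hΦ (hO.diff (measurableSet_singleton (unitLq q)))
      sdiff_subset (fun y hy s _ => hne s y hy.2), ae_eventually_notMem hsum, h.ae_mem]
      with y hy1 hy2 hyO
    by_contra hy
    obtain ⟨k, hk1, hk2⟩ := (((hy1 ⟨hyO, hy⟩).1.eventually (hWo.mem_nhds heW)).and hy2).exists
    exact hk2 ⟨hk1, hne k y hy⟩
  have : IsFiniteMeasure m := ⟨by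
    have h1 : m univ = m {unitLq q} := measure_congr (by
      filter_upwards [hae] with y hy
      exact propext ⟨fun _ => hy, fun _ => trivial⟩)
    rw [h1]
    exact he.lt_top⟩
  exact hm h.eq_zero_of_isFiniteMeasure

end IsGrowthMeasure

end GlobalScaling

/-! ### Support, monotonicity and integrals along the flow -/

section Growing

variable {q : ℝ≥0∞} [Fact (1 ≤ q)]

variable (q) in
/-- The points of `ℓ_q` that belong to `𝓔`. -/
def posConeLq : Set (Lq q) := {z | z ∈ coneLq q ∧ 0 < z 0}

theorem measurableSet_posConeLq : MeasurableSet (posConeLq q) :=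
  isClosed_coneLq.measurableSet.inter
    (isOpen_lt continuous_const (continuous_apply_Lq 0)).measurableSet

theorem unitLq_mem_posConeLq : unitLq q ∈ posConeLq q :=
  ⟨unitLq_mem_coneLq, by simp [unitLq_apply]⟩

/-- A point of `𝓔 ∩ ℓ_q` seen in `𝓔`. -/
def ofLq (z : posConeLq q) : SplitSeq := ⟨z.1, z.2.2, z.2.1⟩

theorem toLq_coe (z : Lq q) : toLq q (z : ℕ → ℝ) = z := by
  rw [toLq, dif_pos (lp.memℓp z)]

theorem toLq_mem_posConeLq {y : SplitSeq} (hy : Memℓp y.1 q) : toLq q y.1 ∈ posConeLq q :=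
  ⟨toLq_mem_coneLq hy, by rw [toLq_apply hy]; exact y.2.1⟩

theorem ofLq_toLq {y : SplitSeq} (hy : Memℓp y.1 q) :
    ofLq ⟨toLq q y.1, toLq_mem_posConeLq hy⟩ = y :=
  Subtype.ext (coe_toLq hy)

theorem continuous_ofLq : Continuous (ofLq : posConeLq q → SplitSeq) :=
  Continuous.subtype_mk (continuous_pi fun i =>
    (continuous_apply_Lq i).comp continuous_subtype_val) _

theorem continuous_ofLq_topLq :
    @Continuous (posConeLq q) SplitSeq inferInstance (topLq q) ofLq := by
  refine continuous_induced_rng.2 ?_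
  have : (fun y : SplitSeq => toLq q y.1) ∘ ofLq = fun z : posConeLq q => z.1 :=
    funext fun z => toLq_coe z.1
  rw [this]
  exact continuous_subtype_val

theorem continuous_toLq_top : Continuous fun y : SplitSeq => toLq ⊤ y.1 := by
  refine continuous_iff_continuousAt.2 fun y => Metric.tendsto_nhds.2 fun ε hε => ?_
  have hmem : ∀ z : SplitSeq, Memℓp z.1 ⊤ := fun z =>
    memℓp_infty_iff.2 z.2.2.2.2.norm.bddAbove_range
  filter_upwards [SplitSeq.tendsto_iff_uniform.1 tendsto_id (ε / 2) (half_pos hε)] with z hz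
  rw [dist_eq_norm]
  refine lt_of_le_of_lt (lp.norm_le_of_forall_le (half_pos hε).le fun i => ?_) (half_lt_self hε)
  rw [lp.coeFn_sub, Pi.sub_apply, toLq_apply (hmem z), toLq_apply (hmem y)]
  exact hz i

theorem hasDerivAt_apply_Lq {c : ℝ → Lq q} {c' : Lq q} {t : ℝ} (hc : HasDerivAt c c' t) (i : ℕ) :
    HasDerivAt (fun s => c s i) (c' i) t :=
  hasDerivAt_pi.1 ((coordsLq q (i + 1)).hasFDerivAt.comp_hasDerivAt t hc) ⟨i, i.lt_succ_self⟩

namespace IsGrowthMeasure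

variable {m : Measure (Lq q)} {α : ℝ} {L : ℝ≥0} {O : Set (Lq q)} {V : Lq q → Lq q}
  {Φ : ℝ → Lq q → Lq q}

theorem flow_mem_support (h : IsGrowthMeasure q m α L O V) (hΦ : IsBackwardFlow O V Φ) {z : Lq q}
    (hzO : z ∈ O) (hz : z ∈ m.support) (t : ℝ) : Φ t z ∈ m.support := by
  have hL := h.euler.lipschitz
  have hm : m ≠ 0 := by rintro rfl; simp at hz
  by_cases hze : z = unitLq q
  · rw [hze, h.flow_unitLq hΦ hm, ← hze]
    exact hz
  refine (Measure.mem_support_iff_forall _).2 fun U hU => ?_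
  obtain ⟨W, hWU, hWo, hW⟩ := mem_nhds_iff.1 hU
  set W' := W ∩ O ∩ {unitLq q}ᶜ with hW'
  have hW'o : IsOpen W' := (hWo.inter h.euler.isOpen).inter isOpen_compl_singleton
  have hzW : Φ t z ∈ W' := ⟨⟨hW, hΦ.mem t z hzO⟩, fun hh => hze (by
    have := congrArg (Φ (-t)) (show Φ t z = unitLq q from hh)
    rwa [hΦ.neg_apply hL, h.flow_unitLq hΦ hm] at this)⟩
  have h1 := (Measure.mem_support_iff_forall _).1 hz (Φ t ⁻¹' W')
    ((hΦ.isOpen_preimage hL h.euler.isOpen hW'o (fun w hw => hw.1.2) t).mem_nhds hzW)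
  rw [h.measure_preimage hΦ t hW'o.measurableSet (fun hh => hh.2 rfl)] at h1
  exact (pos_of_mul_pos_right h1 zero_le).trans_le (measure_mono fun w hw => hWU hw.1.1)

/-- A failure at a point of the support would extend, by continuity, to an open set of positive
measure. -/
theorem generator_le (h : IsGrowthMeasure q m α L O V) (hle : ∀ᵐ z ∂m, ∀ i, V z i ≤ z i)
    {z : Lq q} (hzO : z ∈ O) (hz : z ∈ m.support) (i : ℕ) : V z i ≤ z i := by
  by_contra hcon
  have hc : ContinuousOn (fun w => (V w - w) i) O :=
    (continuous_apply_Lq i).comp_continuousOn (h.euler.lipschitz.continuousOn.sub continuousOn_id)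
  have hU := hc.isOpen_inter_preimage h.euler.isOpen isOpen_Ioi (t := Ioi 0)
  have h1 := (Measure.mem_support_iff_forall _).1 hz _ (hU.mem_nhds ⟨hzO, by
    simpa [lp.coeFn_sub] using hcon⟩)
  refine h1.ne' (measure_mono_null (fun w hw => ?_) (ae_iff.1 hle))
  have h2 : 0 < (V w - w) i := hw.2
  rw [lp.coeFn_sub, Pi.sub_apply, sub_pos] at h2
  exact fun h3 => absurd (h3 i) (not_le.2 h2)

theorem monotone_exp_mul (h : IsGrowthMeasure q m α L O V) (hΦ : IsBackwardFlow O V Φ)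
    (hle : ∀ᵐ z ∂m, ∀ i, V z i ≤ z i) {z : Lq q} (hzO : z ∈ O) (hz : z ∈ m.support) (i : ℕ) :
    Monotone fun s => Real.exp s * Φ s z i := by
  have hd : ∀ s, HasDerivAt (fun s => Real.exp s * Φ s z i)
      (Real.exp s * Φ s z i + Real.exp s * (-V (Φ s z)) i) s := fun s =>
    (Real.hasDerivAt_exp s).mul (hasDerivAt_apply_Lq (hΦ.hasDerivAt z hzO s) i)
  refine monotone_of_deriv_nonneg (fun s => (hd s).differentiableAt) fun s => ?_
  rw [(hd s).deriv, ← mul_add, lp.coeFn_neg, Pi.neg_apply]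
  have := h.generator_le hle (hΦ.mem s z hzO) (h.flow_mem_support hΦ hzO hz s) i
  exact mul_nonneg (Real.exp_pos s).le (by linarith)

/-- The points of `O ∩ m.support` whose orbit keeps a positive coordinate of index `0`. -/
def orbitSet (m : Measure (Lq q)) (O : Set (Lq q)) (Φ : ℝ → Lq q → Lq q) : Set (Lq q) :=
  {z | z ∈ O ∧ z ∈ m.support ∧ ∀ t, 0 < Φ t z 0}

theorem flow_mem_orbitSet (h : IsGrowthMeasure q m α L O V) (hΦ : IsBackwardFlow O V Φ)
    {z : Lq q} (hz : z ∈ orbitSet m O Φ) (t : ℝ) : Φ t z ∈ orbitSet m O Φ :=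
  ⟨hΦ.mem t z hz.1, h.flow_mem_support hΦ hz.1 hz.2.1 t, fun s => by
    rw [← hΦ.add h.euler.lipschitz]
    exact hz.2.2 _⟩

theorem orbitSet_subset_posConeLq (h : IsGrowthMeasure q m α L O V) (hΦ : IsBackwardFlow O V Φ) :
    orbitSet m O Φ ⊆ posConeLq q := fun z hz =>
  ⟨h.support_subset_coneLq hz.2.1, by simpa [hΦ.zero] using hz.2.2 0⟩

/-- Since `exp(s) Φₛ(z)₀` is non-decreasing, positivity at the times `-n` gives positivity at all
times. The set becomes a countable intersection, hence Borel and of full measure. -/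
theorem orbitSet_eq (h : IsGrowthMeasure q m α L O V) (hΦ : IsBackwardFlow O V Φ)
    (hle : ∀ᵐ z ∂m, ∀ i, V z i ≤ z i) :
    orbitSet m O Φ = (O ∩ m.support) ∩ ⋂ n : ℕ, {z | 0 < Φ (-n) z 0} := by
  ext z
  simp only [orbitSet, mem_ofPred_eq, mem_inter_iff, mem_iInter]
  refine ⟨fun hz => ⟨⟨hz.1, hz.2.1⟩, fun n => hz.2.2 _⟩,
    fun hz => ⟨hz.1.1, hz.1.2, fun t => ?_⟩⟩
  obtain ⟨n, hn⟩ := exists_nat_ge (-t)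
  have h1 : Real.exp (-n) * Φ (-n) z 0 ≤ Real.exp t * Φ t z 0 :=
    h.monotone_exp_mul hΦ hle hz.1.1 hz.1.2 0 (by linarith)
  exact pos_of_mul_pos_right ((mul_pos (Real.exp_pos _) (hz.2 n)).trans_le h1) (Real.exp_pos _).le

theorem measurableSet_orbitSet (h : IsGrowthMeasure q m α L O V) (hΦ : IsBackwardFlow O V Φ)
    (hle : ∀ᵐ z ∂m, ∀ i, V z i ≤ z i) : MeasurableSet (orbitSet m O Φ) := by
  rw [h.orbitSet_eq hΦ hle]
  refine (h.euler.isOpen.measurableSet.inter Measure.isClosed_support.measurableSet).inter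
    (MeasurableSet.iInter fun n => ?_)
  exact hΦ.measurable h.euler.lipschitz h.euler.isOpen _
    (isOpen_lt continuous_const (continuous_apply_Lq 0)).measurableSet

theorem ae_mem_orbitSet (h : IsGrowthMeasure q m α L O V) (hΦ : IsBackwardFlow O V Φ)
    (hle : ∀ᵐ z ∂m, ∀ i, V z i ≤ z i) : ∀ᵐ z ∂m, z ∈ orbitSet m O Φ := by
  have h1 : ∀ᵐ z ∂m, ∀ n : ℕ, 0 < Φ (-n) z 0 := by
    refine ae_all_iff.2 fun n => ae_iff.2 ?_
    -- The set where `z₀ ≤ 0` is null and does not contain `(1, 0, …)`, so its preimages under the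
    -- flow are null.
    have h2 := h.measure_preimage hΦ (-n) (B := {z | ¬ 0 < z 0})
      (isOpen_lt continuous_const (continuous_apply_Lq 0)).measurableSet.compl
      (by simp [unitLq_apply])
    rw [ae_iff.1 h.ae_pos, mul_zero] at h2
    exact h2
  rw [h.orbitSet_eq hΦ hle]
  filter_upwards [h1, h.ae_mem, h.ae_support] with z hz hzO hzs
  exact ⟨⟨hzO, hzs⟩, mem_iInter.2 hz⟩

/-- Off the fixed point `(1, 0, …)` this is the scaling of the measure. At that point the mass is
unscaled: either `ψ` vanishes there, or the atom is infinite, or `ψ` is bounded below on a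
neighbourhood of infinite measure. In the last two cases both sides are infinite. -/
theorem lintegral_comp_flow (h : IsGrowthMeasure q m α L O V) (hΦ : IsBackwardFlow O V Φ)
    {ψ : Lq q → ℝ≥0∞} (hψ : Measurable ψ)
    (hψe : ψ (unitLq q) ≠ 0 → ∃ c ≠ 0, ∃ U ∈ 𝓝 (unitLq q), ∀ᵐ z ∂m, z ∈ U → c ≤ ψ z) (t : ℝ) :
    ∫⁻ z, ψ (Φ t z) ∂m = ENNReal.ofReal (Real.exp (-(α * t))) * ∫⁻ z, ψ z ∂m := by
  by_cases hm : m = 0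
  · simp [hm]
  have hL := h.euler.lipschitz
  have hmeas := hΦ.measurable hL h.euler.isOpen t
  have hs : MeasurableSet {unitLq q} := measurableSet_singleton _
  set a := ENNReal.ofReal (Real.exp (-(α * t))) with ha
  have ha0 : a ≠ 0 := by simp [ha, Real.exp_pos]
  have hpre : Φ t ⁻¹' {unitLq q} = {unitLq q} := by
    ext z
    simp only [mem_preimage, mem_singleton_iff]
    refine ⟨fun hz => ?_, fun hz => by rw [hz, h.flow_unitLq hΦ hm]⟩
    have := congrArg (Φ (-t)) hz
    rwa [hΦ.neg_apply hL, h.flow_unitLq hΦ hm] at this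
  have hres : (m.map (Φ t)).restrict {unitLq q}ᶜ = a • m.restrict {unitLq q}ᶜ := by
    refine Measure.ext fun S hS => ?_
    rw [Measure.smul_apply, Measure.restrict_apply hS, Measure.restrict_apply hS,
      Measure.map_apply hmeas (hS.inter hs.compl),
      h.measure_preimage hΦ t (hS.inter hs.compl) (fun hh => hh.2 rfl), smul_eq_mul]
  rw [← lintegral_map hψ hmeas, ← lintegral_add_compl _ hs, ← lintegral_add_compl (μ := m) _ hs,
    lintegral_singleton, lintegral_singleton, hres, lintegral_smul_measure,
    Measure.map_apply hmeas hs, hpre, mul_add, smul_eq_mul]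
  by_cases h0 : ψ (unitLq q) = 0
  · simp [h0]
  by_cases htop : m {unitLq q} = ⊤
  · rw [htop, ENNReal.mul_top h0, ENNReal.mul_top ha0]
  obtain ⟨c, hc, U, hU, hcU⟩ := hψe h0
  obtain ⟨W, hWU, hWo, heW⟩ := mem_nhds_iff.1 hU
  have hI : ∫⁻ z in {unitLq q}ᶜ, ψ z ∂m = ⊤ := by
    refine top_le_iff.1 ?_
    calc ⊤ = ∫⁻ _ in W \ {unitLq q}, c ∂m := by
          rw [setLIntegral_const, h.measure_nhds_diff_eq_top hΦ hm htop (hWo.mem_nhds heW),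
            ENNReal.mul_top hc]
      _ ≤ ∫⁻ z in W \ {unitLq q}, ψ z ∂m := by
        refine lintegral_mono_ae ((ae_restrict_iff' (hWo.measurableSet.diff hs)).2 ?_)
        filter_upwards [hcU] with z hz hzW using hz (hWU hzW.1)
      _ ≤ _ := lintegral_mono_set fun z hz => hz.2
  rw [hI, ENNReal.mul_top ha0]
  simp

/-- With `w = Φ_{log x}(z)`, the derivative in `x` is `w₀ - 1 - V(w)₀`. Up to time `T` the
displacement is at most `‖V z‖ exp(LT) T` and the speed at most `‖V z‖ exp(LT)`, whence the
constant. -/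
theorem abs_sub_le_of_mem_Icc (h : IsGrowthMeasure q m α L O V) (hΦ : IsBackwardFlow O V Φ)
    {z : Lq q} (hz : z ∈ O) {T x x' : ℝ} (hT : 0 ≤ T) (hx : x ∈ Icc (Real.exp (-T)) (Real.exp T))
    (hx' : x' ∈ Icc (Real.exp (-T)) (Real.exp T)) :
    |x * (Φ (Real.log x) z 0 - 1) - x' * (Φ (Real.log x') z 0 - 1)| ≤
      (1 + Real.exp (L * T) * (T + 1)) * (|z 0 - 1| + ‖V z‖) * |x - x'| := by
  have hL := h.euler.lipschitz
  have hpos : ∀ x ∈ Icc (Real.exp (-T)) (Real.exp T), 0 < x := fun x hx =>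
    (Real.exp_pos _).trans_le hx.1
  refine Convex.norm_image_sub_le_of_norm_hasDerivWithin_le
    (s := Icc (Real.exp (-T)) (Real.exp T)) (f := fun x => x * (Φ (Real.log x) z 0 - 1))
    (f' := fun x => Φ (Real.log x) z 0 - 1 - V (Φ (Real.log x) z) 0)
    (fun x hx => HasDerivAt.hasDerivWithinAt ?_) (fun x hx => ?_) (convex_Icc _ _) hx' hx
  · have h0 := hpos x hx
    have h1 : HasDerivAt (fun s => Φ s z 0) ((-V (Φ (Real.log x) z)) 0) (Real.log x) :=
      hasDerivAt_apply_Lq (hΦ.hasDerivAt z hz _) 0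
    have h2 := (hasDerivAt_id x).mul ((h1.comp x (Real.hasDerivAt_log h0.ne')).sub_const 1)
    refine h2.congr_deriv ?_
    simp only [id, Function.comp, lp.coeFn_neg, Pi.neg_apply]
    field_simp
    ring
  · have h0 := hpos x hx
    have hlog : |Real.log x| ≤ T := abs_le.2
      ⟨(Real.le_log_iff_exp_le h0).2 hx.1, (Real.log_le_iff_le_exp h0).2 hx.2⟩
    have h1 := hΦ.dist_apply_le hL hz hlog (t := 0) (by simpa using hT)
    have h2 := abs_apply_le_norm (Φ (Real.log x) z - z) 0
    have h3 := (abs_apply_le_norm (V (Φ (Real.log x) z)) 0).trans (hΦ.norm_le hL hz _)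
    rw [hΦ.zero, sub_zero, dist_eq_norm] at h1
    rw [lp.coeFn_sub, Pi.sub_apply] at h2
    have h4 : ‖V z‖ * Real.exp (L * T) * |Real.log x| ≤ ‖V z‖ * Real.exp (L * T) * T := by gcongr
    have h5 : ‖V z‖ * Real.exp (L * |Real.log x|) ≤ ‖V z‖ * Real.exp (L * T) := by gcongr
    have h6 : 0 ≤ Real.exp (L * T) * (T + 1) * |z 0 - 1| := by positivity
    rw [Real.norm_eq_abs]
    have e : Φ (Real.log x) z 0 - 1 - V (Φ (Real.log x) z) 0
        = (Φ (Real.log x) z 0 - z 0) + (z 0 - 1) - V (Φ (Real.log x) z) 0 := by ring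
    rw [e]
    have h7 := abs_sub ((Φ (Real.log x) z 0 - z 0) + (z 0 - 1)) (V (Φ (Real.log x) z) 0)
    have h8 := abs_add_le (Φ (Real.log x) z 0 - z 0) (z 0 - 1)
    have h9 := norm_nonneg (V z)
    nlinarith

end IsGrowthMeasure

theorem IsBackwardFlow.continuousOn_log {L : ℝ≥0} {O : Set (Lq q)} {V : Lq q → Lq q}
    {Φ : ℝ → Lq q → Lq q} (hΦ : IsBackwardFlow O V Φ) (hL : LipschitzOnWith L V O) {X : Type*}
    [TopologicalSpace X] {g : X → Lq q} {S : Set X} (hg : ContinuousOn g S) (hS : MapsTo g S O) :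
    ContinuousOn (fun p : ℝ × X => Φ (Real.log p.1) (g p.2)) (Ioi 0 ×ˢ S) := by
  refine (hΦ.continuousOn hL).comp (f := fun p : ℝ × X => (Real.log p.1, g p.2)) ?_
    fun p hp => ⟨mem_univ _, hS hp.2⟩
  refine ContinuousOn.prodMk ?_ (hg.comp continuousOn_snd fun p hp => hp.2)
  exact continuousOn_fst.log fun p hp => (ne_of_gt hp.1)

theorem IsBackwardFlow.isFlowLine {L : ℝ≥0} {O : Set (Lq q)} {V : Lq q → Lq q}
    {Φ : ℝ → Lq q → Lq q} (hΦ : IsBackwardFlow O V Φ) (hL : LipschitzOnWith L V O) {z : Lq q}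
    (hz : z ∈ O) : IsFlowLine q O V z (fun x => Φ (Real.log x) z) ∧
      ∀ c : ℝ → Lq q, IsFlowLine q O V z c → ∀ x, 0 < x → c x = Φ (Real.log x) z := by
  refine ⟨⟨by simp [hΦ.zero], fun x hx => ⟨hΦ.mem _ _ hz, ?_⟩⟩, fun c hc x hx => ?_⟩
  · have := (hΦ.hasDerivAt z hz (Real.log x)).scomp x (Real.hasDerivAt_log hx.ne')
    refine this.congr_deriv ?_
    rw [smul_neg, neg_smul, one_div]
  · rw [← hΦ.unique hL (c := fun t => c (Real.exp t)) (by simpa using hc.1) (fun t => ?_)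
      (Real.log x), Real.exp_log hx]
    have h1 := hc.2 (Real.exp t) (Real.exp_pos t)
    refine ⟨h1.1, (h1.2.scomp t (Real.hasDerivAt_exp t)).congr_deriv ?_⟩
    rw [smul_smul, mul_neg, mul_one_div_cancel (Real.exp_pos t).ne', neg_one_smul]

end Growing

/-! ### Return to `𝓔` and verification of the growth properties -/

section Main

variable {q : ℝ≥0∞} [Fact (1 ≤ q)] {Ξ : Measure SplitSeq} {α : ℝ} {L : ℝ≥0} {O : Set (Lq q)}
  {V : Lq q → Lq q} {Φ : ℝ → Lq q → Lq q}

theorem IsNiceGenerator.ae_generator_le (hV : IsNiceGenerator q Ξ α O V)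
    (h : IsGrowthMeasure q (Ξ.map fun y => toLq q y.1) α L O V) :
    ∀ᵐ z ∂(Ξ.map fun y => toLq q y.1), ∀ i, V z i ≤ z i := by
  have htr := ae_mem_traceLq hV.concentrated
  filter_upwards [h.ae_mem, h.ae_cone, h.ae_pos, h.ae_support] with z hzO hzc hz0 hzs i
  set y := ofLq (q := q) ⟨z, hzc, hz0⟩ with hy
  have hyz : toLq q y.1 = z := toLq_coe z
  have hym : Memℓp y.1 q := lp.memℓp z
  have := hV.inequalities y ⟨⟨hym, by rwa [hyz]⟩, (mem_suppLq_iff (htr.mono fun _ h => h.1)).2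
    ⟨hym, by rwa [hyz]⟩⟩ i
  rwa [hyz] at this

/-- A function on `𝓔` whose restriction to `𝓔 ∩ ℓ_q` is continuous for the `ℓ_q`-norm is
integrated against the flow as in the growth property. -/
theorem IsGrowthMeasure.lintegral_comp_of_continuous
    (h : IsGrowthMeasure q (Ξ.map fun y => toLq q y.1) α L O V) (hΦ : IsBackwardFlow O V Φ)
    (hΞ : ∀ᵐ y ∂Ξ, Memℓp y.1 q) {φ : SplitSeq → ℝ≥0}
    (hφ : Continuous fun z : posConeLq q => φ (ofLq z)) (t : ℝ) {T : SplitSeq → SplitSeq}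
    (hT : ∀ᵐ y ∂Ξ, Memℓp (T y).1 q ∧ toLq q (T y).1 = Φ t (toLq q y.1)) :
    ∫⁻ y, (φ (T y) : ℝ≥0∞) ∂Ξ =
      ENNReal.ofReal (Real.exp (-(α * t))) * ∫⁻ y, (φ y : ℝ≥0∞) ∂Ξ := by
  classical
  set ψ : Lq q → ℝ≥0∞ := fun z => if hz : z ∈ posConeLq q then (φ (ofLq ⟨z, hz⟩) : ℝ≥0∞) else 0
    with hψ
  have hψm : Measurable ψ := Measurable.dite
    (ENNReal.continuous_coe.comp hφ).measurable measurable_const measurableSet_posConeLq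
  have hψy : ∀ y : SplitSeq, Memℓp y.1 q → ψ (toLq q y.1) = φ y := fun y hy => by
    rw [hψ]
    simp only [dif_pos (toLq_mem_posConeLq hy), ofLq_toLq hy]
  have hmeas := hΦ.measurable h.euler.lipschitz h.euler.isOpen t
  have e1 : ∫⁻ y, (φ y : ℝ≥0∞) ∂Ξ = ∫⁻ z, ψ z ∂(Ξ.map fun y => toLq q y.1) := by
    rw [lintegral_map hψm (measurable_toLq q)]
    refine lintegral_congr_ae ?_
    filter_upwards [hΞ] with y hy using (hψy y hy).symm
  have e2 : ∫⁻ y, (φ (T y) : ℝ≥0∞) ∂Ξ = ∫⁻ z, ψ (Φ t z) ∂(Ξ.map fun y => toLq q y.1) := by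
    rw [lintegral_map (f := fun z => ψ (Φ t z)) (hψm.comp hmeas) (measurable_toLq q)]
    refine lintegral_congr_ae ?_
    filter_upwards [hT] with y hy
    rw [← hy.2, hψy _ hy.1]
  rw [e1, e2]
  refine h.lintegral_comp_flow hΦ hψm (fun h0 => ?_) t
  set e : posConeLq q := ⟨unitLq q, unitLq_mem_posConeLq⟩ with he
  have hφe : φ (ofLq e) ≠ 0 := fun hh => h0 (by
    rw [hψ]
    simp only [dif_pos unitLq_mem_posConeLq]
    rw [← he, hh, ENNReal.coe_zero])
  -- Half the value at `(1, 0, …)` is the lower bound near this point required by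
  -- `lintegral_comp_flow`.
  have hhalf : φ (ofLq e) / 2 < φ (ofLq e) := NNReal.half_lt_self hφe
  obtain ⟨U, hU, hUsub⟩ := (mem_nhds_subtype _ e _).1
    (hφ.continuousAt.eventually_const_lt hhalf)
  refine ⟨((φ (ofLq e) / 2 : ℝ≥0) : ℝ≥0∞), ?_, U, hU, ?_⟩
  · rw [Ne, ENNReal.coe_eq_zero]
    exact (half_pos (pos_iff_ne_zero.2 hφe)).ne'
  · filter_upwards [h.ae_cone, h.ae_pos] with z hzc hz0 hzU
    have h1 : φ (ofLq e) / 2 < φ (ofLq ⟨z, hzc, hz0⟩) := hUsub hzU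
    rw [hψ]
    simp only [dif_pos (show z ∈ posConeLq q from ⟨hzc, hz0⟩)]
    exact ENNReal.coe_le_coe.2 h1.le

theorem IsGrowthMeasure.exists_lintegral_sq_sub_le
    (h : IsGrowthMeasure q (Ξ.map fun y => toLq q y.1) α L O V) (hΦ : IsBackwardFlow O V Φ)
    (hΞ : IsSplittingMeasure Ξ) (hV : IsNiceGenerator q Ξ α O V) {G : ℝ → SplitSeq → SplitSeq}
    (hG : ∀ x, 0 < x → ∀ᵐ y ∂Ξ, (G x y).1 0 = Φ (Real.log x) (toLq q y.1) 0)
    {K : Set ℝ} (hK : IsCompact K) (hK0 : K ⊆ Ioi 0) : ∃ C : ℝ, 0 < C ∧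
    ∀ x ∈ K, ∀ x' ∈ K,
      ∫⁻ y, ENNReal.ofReal ((x * ((G x y).1 0 - 1) - x' * ((G x' y).1 0 - 1)) ^ 2) ∂Ξ ≤
        ENNReal.ofReal (C * (x - x') ^ 2) := by
  obtain ⟨T, hT0, hT⟩ : ∃ T : ℝ, 0 ≤ T ∧ ∀ x ∈ K, |Real.log x| ≤ T := by
    have hc : ContinuousOn (fun x => |Real.log x|) K :=
      (Real.continuousOn_log.mono fun x hx => (ne_of_gt (hK0 hx))).abs
    obtain ⟨T, hT⟩ := (hK.image_of_continuousOn hc).bddAbove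
    exact ⟨max T 0, le_max_right _ _, fun x hx =>
      (hT (mem_image_of_mem _ hx)).trans (le_max_left _ _)⟩
  have hKI : ∀ x ∈ K, x ∈ Icc (Real.exp (-T)) (Real.exp T) := fun x hx => by
    have h1 := abs_le.1 (hT x hx)
    exact ⟨(Real.le_log_iff_exp_le (hK0 hx)).1 h1.1, (Real.log_le_iff_le_exp (hK0 hx)).1 h1.2⟩
  set A : ℝ := 1 + Real.exp (L * T) * (T + 1) with hA
  set I₁ := ∫⁻ y, ENNReal.ofReal ((y.1 0 - 1) ^ 2) ∂Ξ with hI₁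
  set I₂ := ∫⁻ y, ENNReal.ofReal (‖V (toLq q y.1)‖ ^ 2) ∂Ξ with hI₂
  -- The factor `2` comes from squaring the sum `|y₀ - 1| + ‖V‖`; the added `1` only makes the
  -- constant positive when both integrals vanish.
  refine ⟨2 * A ^ 2 * (I₁ + I₂).toReal + 1, by positivity, fun x hx x' hx' => ?_⟩
  have hmeas : Measurable fun y : SplitSeq => ENNReal.ofReal ((y.1 0 - 1) ^ 2) :=
    ((((measurable_pi_apply 0).comp measurable_subtype_coe).sub_const 1).pow_const 2).ennreal_ofReal
  calc _ ≤ ∫⁻ y, ENNReal.ofReal (2 * A ^ 2 * (x - x') ^ 2) *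
        (ENNReal.ofReal ((y.1 0 - 1) ^ 2) + ENNReal.ofReal (‖V (toLq q y.1)‖ ^ 2)) ∂Ξ := by
        refine lintegral_mono_ae ?_
        filter_upwards [ae_mem_traceLq hV.concentrated, hG x (hK0 hx), hG x' (hK0 hx')]
          with y hy h1 h2
        rw [h1, h2, ← ENNReal.ofReal_add (sq_nonneg _) (sq_nonneg _),
          ← ENNReal.ofReal_mul (by positivity)]
        refine ENNReal.ofReal_le_ofReal ?_
        have h3 := h.abs_sub_le_of_mem_Icc hΦ hy.2 hT0 (hKI x hx) (hKI x' hx')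
        rw [← hA, toLq_apply hy.1] at h3
        rw [← sq_abs]
        refine (pow_le_pow_left₀ (abs_nonneg _) h3 2).trans ?_
        rw [mul_pow, mul_pow, sq_abs, ← sq_abs (y.1 0 - 1)]
        have h4 : (|y.1 0 - 1| + ‖V (toLq q y.1)‖) ^ 2
            ≤ 2 * (|y.1 0 - 1| ^ 2 + ‖V (toLq q y.1)‖ ^ 2) := by
          nlinarith [sq_nonneg (|y.1 0 - 1| - ‖V (toLq q y.1)‖)]
        calc _ ≤ A ^ 2 * (2 * (|y.1 0 - 1| ^ 2 + ‖V (toLq q y.1)‖ ^ 2)) * (x - x') ^ 2 := by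
              gcongr
          _ = _ := by ring
    _ = ENNReal.ofReal (2 * A ^ 2 * (x - x') ^ 2) * (I₁ + I₂) := by
      rw [lintegral_const_mul' _ _ ENNReal.ofReal_ne_top, lintegral_add_left hmeas]
    _ = ENNReal.ofReal (2 * A ^ 2 * (x - x') ^ 2 * (I₁ + I₂).toReal) := by
      rw [ENNReal.ofReal_mul (p := 2 * A ^ 2 * (x - x') ^ 2) (by positivity),
        ENNReal.ofReal_toReal (ENNReal.add_lt_top.2 ⟨hΞ.compensated, hV.sq_integrable⟩).ne]
    _ ≤ _ := by
      refine ENNReal.ofReal_le_ofReal ?_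
      nlinarith [sq_nonneg (x - x')]

theorem mem_growingSet_iff (hV : IsNiceGenerator q Ξ α O V) {y : SplitSeq} :
    y ∈ growingSet q Ξ O (fun x z => Φ (Real.log x) z) ↔ Memℓp y.1 q ∧
      toLq q y.1 ∈ IsGrowthMeasure.orbitSet (Ξ.map fun y => toLq q y.1) O Φ := by
  have htr := ae_mem_traceLq hV.concentrated
  simp only [growingSet, mem_ofPred_eq, mem_inter_iff, traceLq,
    mem_suppLq_iff (htr.mono fun _ h => h.1), IsGrowthMeasure.orbitSet]
  refine ⟨fun h => ⟨h.1.1.1, h.1.1.2, h.1.2.2, fun t => ?_⟩,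
    fun h => ⟨⟨⟨h.1, h.2.1⟩, h.1, h.2.2.1⟩, fun x _ => h.2.2.2 _⟩⟩
  simpa using h.2 (Real.exp t) (Real.exp_pos t)

open Classical in
/-- The action of the flow on `𝓔`, in the multiplicative time scale. -/
noncomputable def growthMap (E₀ : Set SplitSeq) (Φ : ℝ → Lq q → Lq q) (x : ℝ) (y : SplitSeq) :
    SplitSeq :=
  -- For the growing set, the second condition follows from the first; it is there only so that the
  -- value can be formed in `𝓔`.
  if h : y ∈ E₀ ∧ Φ (Real.log x) (toLq q y.1) ∈ posConeLq q then ofLq ⟨_, h.2⟩ else y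

theorem growthMap_of_notMem {E₀ : Set SplitSeq} {x : ℝ} {y : SplitSeq} (hy : y ∉ E₀) :
    growthMap E₀ Φ x y = y :=
  dif_neg fun h => hy h.1

theorem coe_growthMap {E₀ : Set SplitSeq} {x : ℝ} {y : SplitSeq} (hy : y ∈ E₀)
    (h : Φ (Real.log x) (toLq q y.1) ∈ posConeLq q) :
    ((growthMap E₀ Φ x y).1 : ℕ → ℝ) = Φ (Real.log x) (toLq q y.1) := by
  rw [growthMap, dif_pos ⟨hy, h⟩, ofLq]

/-- One argument serves both topologies. `hτ` makes `τ`-continuous test functions continuous for the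
`ℓ_q`-norm and brings the flow back to `𝓔`; `hcont` lets the continuity of the flow on `O` be read
on the growing set. -/
theorem isGrowing_growthMap (τ : TopologicalSpace SplitSeq)
    (hτ : @Continuous _ _ inferInstance τ (ofLq : posConeLq q → SplitSeq))
    (h : IsGrowthMeasure q (Ξ.map fun y => toLq q y.1) α L O V) (hΦ : IsBackwardFlow O V Φ)
    (hΞ : IsSplittingMeasure Ξ) (hV : IsNiceGenerator q Ξ α O V)
    (hcont : @ContinuousOn _ _ τ _ (fun y : SplitSeq => toLq q y.1)
      (growingSet q Ξ O fun x z => Φ (Real.log x) z)) :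
    IsGrowing τ Ξ α (growingSet q Ξ O fun x z => Φ (Real.log x) z)
      (growthMap (growingSet q Ξ O fun x z => Φ (Real.log x) z) Φ) := by
  have hL := h.euler.lipschitz
  have hle := hV.ae_generator_le h
  have htr := ae_mem_traceLq hV.concentrated
  set m := Ξ.map fun y => toLq q y.1 with hm
  set E₀ := growingSet q Ξ O fun x z => Φ (Real.log x) z with hE₀
  have hmem : ∀ {y}, y ∈ E₀ ↔ Memℓp y.1 q ∧ toLq q y.1 ∈ IsGrowthMeasure.orbitSet m O Φ := mem_growingSet_iff hV
  have hP : ∀ y ∈ E₀, ∀ t, Φ t (toLq q y.1) ∈ IsGrowthMeasure.orbitSet m O Φ := fun y hy t =>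
    h.flow_mem_orbitSet hΦ (hmem.1 hy).2 t
  have hcoe : ∀ x, ∀ y ∈ E₀, ((growthMap E₀ Φ x y).1 : ℕ → ℝ) = Φ (Real.log x) (toLq q y.1) :=
    fun x y hy => coe_growthMap hy (h.orbitSet_subset_posConeLq hΦ (hP y hy _))
  have hto : ∀ x, ∀ y ∈ E₀, toLq q (growthMap E₀ Φ x y).1 = Φ (Real.log x) (toLq q y.1) :=
    fun x y hy => by rw [hcoe x y hy, toLq_coe]
  have hmaps : ∀ x, MapsTo (growthMap E₀ Φ x) E₀ E₀ := fun x y hy => hmem.2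
    ⟨by rw [hcoe x y hy]; exact lp.memℓp _, by rw [hto x y hy]; exact hP y hy _⟩
  have hae : ∀ᵐ y ∂Ξ, y ∈ E₀ := by
    have h1 := (ae_map_iff (p := fun z => z ∈ IsGrowthMeasure.orbitSet m O Φ) (measurable_toLq q).aemeasurable
      (h.measurableSet_orbitSet hΦ hle)).1 (h.ae_mem_orbitSet hΦ hle)
    filter_upwards [htr, h1] with y hy hy1 using hmem.2 ⟨hy.1, hy1⟩
  have hcontG : @ContinuousOn (ℝ × SplitSeq) (Lq q) (@instTopologicalSpaceProd _ _ _ τ) _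
      (fun p => Φ (Real.log p.1) (toLq q p.2.1)) (Ioi 0 ×ˢ E₀) :=
    hΦ.continuousOn_log hL hcont fun y hy => (hmem.1 hy).2.1
  refine ⟨?_, mem_ae_iff.1 hae, fun y => ?_, fun x hx x' hx' y => ?_, fun φ x hx => ?_,
    fun y hy i => ?_, fun x _ => hmaps x, ?_, fun K hK hK0 => ?_⟩
  · have : E₀ = {y | Memℓp y.1 q} ∩ (fun y => toLq q y.1) ⁻¹' IsGrowthMeasure.orbitSet m O Φ :=
      Set.ext fun y => hmem
    rw [this]
    exact (measurableSet_memℓp q).inter (measurable_toLq q (h.measurableSet_orbitSet hΦ hle))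
  · by_cases hy : y ∈ E₀
    · refine Subtype.ext ?_
      rw [hcoe 1 y hy, Real.log_one, hΦ.zero, coe_toLq (hmem.1 hy).1]
    · exact growthMap_of_notMem hy
  · by_cases hy : y ∈ E₀
    · refine Subtype.ext ?_
      rw [hcoe x _ (hmaps x' hy), hto x' y hy, hcoe _ y hy, ← hΦ.add hL,
        Real.log_mul hx.ne' hx'.ne']
    · simp only [growthMap_of_notMem hy]
  · rw [h.lintegral_comp_of_continuous hΦ (htr.mono fun _ h => h.1)
      (φ := fun y => φ y) (φ.continuous.comp hτ) (Real.log x) (T := growthMap E₀ Φ x)]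
    · rw [Real.rpow_def_of_pos hx]
      congr 4
      ring
    · filter_upwards [hae] with y hy
      exact ⟨(hmem.1 (hmaps x hy)).1, hto x y hy⟩
  · intro x hx x' hx' hxx
    have h1 := h.monotone_exp_mul hΦ hle (hmem.1 hy).2.1 (hmem.1 hy).2.2.1 i
      (Real.log_le_log hx hxx)
    simp only [Real.exp_log hx, Real.exp_log hx'] at h1
    simpa only [hcoe _ y hy] using h1
  · refine continuousOn_iff_continuous_domRestrict.2 ?_
    have hmemP : ∀ p : (Ioi (0 : ℝ) ×ˢ E₀ : Set (ℝ × SplitSeq)),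
        Φ (Real.log p.1.1) (toLq q p.1.2.1) ∈ posConeLq q := fun p =>
      h.orbitSet_subset_posConeLq hΦ (hP _ p.2.2 _)
    have heq : (Ioi (0 : ℝ) ×ˢ E₀).domRestrict (fun p => growthMap E₀ Φ p.1 p.2)
        = fun p => ofLq ⟨_, hmemP p⟩ :=
      funext fun p => Subtype.ext (hcoe _ _ p.2.2)
    rw [heq]
    exact hτ.comp (Continuous.subtype_mk (continuousOn_iff_continuous_domRestrict.1 hcontG) _)
  · refine h.exists_lintegral_sq_sub_le hΦ hΞ hV (fun x _ => ?_) hK hK0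
    filter_upwards [hae] with y hy
    rw [hcoe x y hy]

end Main

theorem mainTheorem8 (q : ℝ≥0∞) [Fact (1 ≤ q)] (Ξ : Measure SplitSeq)
    (hΞ : IsSplittingMeasure Ξ) (α : ℝ) (hα : 0 < α) (O : Set (Lq q)) (V : Lq q → Lq q)
    (hV : IsNiceGenerator q Ξ α O V) :
    ∃ G : ℝ → Lq q → Lq q,
      (∀ z ∈ O, IsFlowLine q O V z (fun x => G x z) ∧
        ∀ c : ℝ → Lq q, IsFlowLine q O V z c → ∀ x, 0 < x → c x = G x z) ∧
      ((∀ z ∈ O, 0 < z 0) → growingSet q Ξ O G = traceLq q O ∩ suppLq q Ξ) ∧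
      ∃ G' : ℝ → SplitSeq → SplitSeq,
        (∀ x, 0 < x → ∀ y ∈ growingSet q Ξ O G, ((G' x y).1 : ℕ → ℝ) = G x (toLq q y.1)) ∧
        (∀ x, 0 < x → ∀ y ∉ growingSet q Ξ O G, G' x y = y) ∧
        IsGrowing (topLq q) Ξ α (growingSet q Ξ O G) G' ∧
        ((q = ⊤ ∨ ContinuousOn (fun y : SplitSeq => toLq q y.1) (growingSet q Ξ O G)) →
          IsGrowing inferInstance Ξ α (growingSet q Ξ O G) G') := by
  obtain ⟨L, h⟩ := hV.isGrowthMeasure hΞ hα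
  obtain ⟨Φ, hΦ⟩ := h.euler.exists_isBackwardFlow
  refine ⟨fun x z => Φ (Real.log x) z, fun z hz => hΦ.isFlowLine h.euler.lipschitz hz,
    fun hpos => ?_, growthMap (growingSet q Ξ O fun x z => Φ (Real.log x) z) Φ,
    fun x _ y hy => coe_growthMap hy ?_, fun x _ y hy => growthMap_of_notMem hy, ?_, fun hq => ?_⟩
  · exact Set.ext fun y => ⟨fun hy => hy.1, fun hy => ⟨hy, fun x _ => hpos _ (hΦ.mem _ _ hy.1.2)⟩⟩
  · exact h.orbitSet_subset_posConeLq hΦ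
      (h.flow_mem_orbitSet hΦ ((mem_growingSet_iff hV).1 hy).2 _)
  · refine isGrowing_growthMap (topLq q) continuous_ofLq_topLq h hΦ hΞ hV ?_
    exact @Continuous.continuousOn _ _ (topLq q) _ _ _ continuous_induced_dom
  · refine isGrowing_growthMap inferInstance continuous_ofLq h hΦ hΞ hV ?_
    rcases hq with rfl | hq
    · exact continuous_toLq_top.continuousOn
    · exact hq
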